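/- **Setting.** Let $\omega=e^{2\pi i/3}$, $\Sigma=\bigcup_{j=1}^{3}e^{(j-1)\pi i/3}\mathbb R$, let $\Omega_n=\{k:\frac{(n-1)\pi}{3}<\arg k<\frac{n\pi}{3}\}$ ($n=1,\dots,6$, $\Omega_0=\Omega_6$), and orient the rays $e^{(n-1)\pi i/3}\mathbb R_+$ outward, so that $\Omega_n$ is on the left ($+$) and $\Omega_{n-1}$ on the right ($-$). Put $$\mathcal A=\begin{pmatrix}0&0&1\\1&0&0\\0&1&0\end{pmatrix},\qquad \mathcal B=\begin{pmatrix}0&1&0\\1&0&0\\0&0&1\end{pmatrix},\qquad D=\mathrm{diag}(\omega^2,\omega,1).$$ Let $r_1:(0,\infty)\to\mathbb C$ and $r_2:(-\infty,0)\to\mathbb C$ be smooth, rapidly decaying as $|k|\to\infty$, with asymptotic power series to all orders $r_1(k)\sim\sum_{j\ge0}a_jk^j$ ($k\downarrow0$) and $r_2(k)\sim\sum_{j\ge0}b_jk^j$ ($k\uparrow0$), where $a_0=\omega^2$ and $b_0=1$. Let $\theta_{ij}=(l_i-l_j)x+(z_i-z_j)t$ with $(l_1,l_2,l_3)=(\omega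 k,\omega^2k,k)$ and $(z_1,z_2,z_3)=9k^5(\omega^2,\omega,1)$. On the ray $e^{(n-1)\pi i/3}\mathbb R_+$ let $v=v_n$, where ($r_j^*$ denotes the complex conjugate, all arguments being real on the ray in question) $$v_1=\begin{pmatrix}1&-r_1(k)e^{-\theta_{21}}&0\\ r_1^*(k)e^{\theta_{21}}&1-|r_1(k)|^2&0\\0&0&1\end{pmatrix},\quad v_2=\begin{pmatrix}1&0&0\\0&1-|r_2(\omega k)|^2&-r_2^*(\omega k)e^{-\theta_{32}}\\0&r_2(\omega k)e^{\theta_{32}}&1\end{pmatrix},$$ $$v_3=\begin{pmatrix}1-|r_1(\omega^2k)|^2&0&r_1^*(\omega^2k)e^{-\theta_{31}}\\0&1&0\\-r_1(\omega^2k)e^{\theta_{31}}&0&1\end{pmatrix},\quad v_4=\begin{pmatrix}1-|r_2(k)|^2&-r_2^*(k)e^{-\theta_{21}}&0\\ r_2(k)e^{\theta_{21}}&1&0\\0&0&1\end{pmatrix},$$ $$v_5=\begin{pmatrix}1&0&0\\0&1&-r_1(\omega k)e^{-\theta_{32}}\\0&r_1^*(\omega k)e^{\theta_{32}}&1-|r_1(\omega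 k)|^2\end{pmatrix},\quad v_6=\begin{pmatrix}1&0&r_2(\omega^2k)e^{-\theta_{31}}\\0&1&0\\-r_2^*(\omega^2k)e^{\theta_{31}}&0&1-|r_2(\omega^2k)|^2\end{pmatrix}.$$ Consider families $F(x,t;k)\in\mathbb C^{3\times3}$, $x\in\mathbb R$, $t\ge0$, $k\in\mathbb C\setminus\Sigma$, with the following properties (i)–(iii) for all $x\in\mathbb R$, $t\ge 0$: (i) $F$ is analytic in $k\in\mathbb C\setminus\Sigma$; (ii) on each of the six open rays the limits $F_\pm$ from the left and right exist, are continuous and satisfy $F_+=F_-v$; (iii) $F(k)=\mathcal AF(\omega k)\mathcal A^{-1}=\mathcal B\,\overline{F(\bar k)}\,\mathcal B$. *mSK problem.* $(w,m)$, with $w(x,t)$ real and $w(\cdot,t)^2$ integrable at $+\infty$, solves the RH problem of the modified Sawada–Kotera equation if $m$ satisfies (i)–(iii); for each $t\ge 0$, $m=I+m^{(1)}_\infty(x,t)/k+O(k^{-2})$ as $k\to\infty$, $k\notin\Sigma$, uniformly for $x$ in bounded sets, where $$m^{(1)}_\infty=\frac{w}{3}\begin{pmatrix}0&\omega&1\\\omega^2&0&1\\\omega^2&\omega&0\end{pmatrix}+\frac13\Big(\int_\infty^xw(y,t)^2\,dy\Big)D;$$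 and in each sector $m=\sum_{l=0}^pm^{(l)}_0(x,t)k^l+O(k^{p+1})$ as $k\to0$ for every $p$, with coefficients depending on the sector. *SK problem.* $(u,M)$, with $u(x,t)$ real, continuous in $x$ and integrable in $x$ at $+\infty$, solves the RH problem of the Sawada–Kotera equation if $M$ satisfies (i)–(iii); for each $t\ge0$, $M=I+\frac1k\big(\int_x^\infty2u(y,t)\,dy\big)D+O(k^{-2})$ as $k\to\infty$, $k\notin\Sigma$, uniformly for $x$ in bounded sets; and in each sector $M=\sum_{l=-1}^pM^{(l)}_0(x,t)k^l+O(k^{p+1})$ as $k\to0$ for every $p\ge -1$, where in $\Omega_1$ $$M_0^{(-1)}=a_+(x,t)\begin{pmatrix}\omega^2&0&0\\\omega^2&0&0\\\omega^2&0&0\end{pmatrix}$$ with $a_+$ real-valued and rapidly decreasing as $x\to+\infty$ for each $t\ge0$ (by (iii) this fixes the residues in the other sectors). **Theorem 2.6.** Let $w:\mathbb R\times[0,\infty)\to\mathbb R$ be such that, for each $t\ge0$, $w(\cdot,t)$ is smooth and it and all its $x$-derivatives decrease rapidly as $x\to+\infty$. Suppose $(w,m)$ solves the mSK problem with $r_1,r_2$.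 Put $$A(x,t)=-\frac{w(x,t)}{3}\begin{pmatrix}\omega^2&\omega&1\\\omega^2&\omega&1\\\omega^2&\omega&1\end{pmatrix},\qquad M(x,t;k)=\Big(I+\frac{A(x,t)}{k}\Big)m(x,t;k).$$ (a) There is $u$ such that $(u,M)$ solves the SK problem with the same $r_1,r_2$. (b) For every solution $(u,\widetilde M)$ of the SK problem with the same $r_1,r_2$ one has, for all $x\in\mathbb R$, $t\ge 0$: $\widetilde M=M$ on $\mathbb C\setminus\Sigma$; the reconstruction formula $u=-\frac12\,\partial_x\lim_{k\to\infty}k(\widetilde M_{33}-1)$ holds (limit along $k\notin\Sigma$; the limit and the derivative exist); and $u$ and $w$ are related by the Miura transformation $$u(x,t)=\tfrac16\big(w_x(x,t)-w(x,t)^2\big).$$ Moreover, if $w$ is a smooth solution on $\mathbb R\times[0,\infty)$ of the mSK equation $w_t+w_{xxxxx}-(5w_xw_{xx}+5ww_x^2+5w^2w_{xx}-w^5)_x=0$, then $u$ is a smooth solution there of the SK equation $u_t+u_{xxxxx}+30(uu_{xxx}+u_xu_{xx})+180u^2u_x=0$. -/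

import Mathlib

open Filter Topology Asymptotics Set MeasureTheory


namespace Miura

/-- Complex `3 × 3` matrices. -/
abbrev Mat3 : Type := Matrix (Fin 3) (Fin 3) ℂ

/-- `ω = exp(2πi/3)`. -/
noncomputable def ω : ℂ := Complex.exp (2 * Real.pi * Complex.I / 3)

/-! ### The contour -/

/-- The contour `Σ`: the union of the three lines `exp((j-1)πi/3) ℝ`, `j = 1, 2, 3`. -/
def Sigma : Set ℂ :=
  {k | ∃ (j : Fin 3) (s : ℝ), k = s * Complex.exp ((j : ℕ) * Real.pi * Complex.I / 3)}

/-- The open sector `Ω_n = {(n-1)π/3 < arg k < nπ/3}`. The index is an integer and the sectors are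
`6`-periodic in it, so that `Ω_0 = Ω_6`. -/
def sector (n : ℤ) : Set ℂ :=
  {k | ∃ s φ : ℝ, 0 < s ∧ (n - 1) * Real.pi / 3 < φ ∧ φ < n * Real.pi / 3 ∧
    k = s * Complex.exp (φ * Complex.I)}

/-- The open ray `exp((n-1)πi/3) ℝ₊`. With the outward orientation its left (`+`) side is `Ω_n` and
its right (`-`) side is `Ω_{n-1}`. -/
def ray (n : ℤ) : Set ℂ :=
  {k | ∃ s : ℝ, 0 < s ∧ k = s * Complex.exp ((n - 1) * Real.pi / 3 * Complex.I)}

/-! ### The jump matrices -/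

/-- `l_1 = ω k`, `l_2 = ω² k`, `l_3 = k`. -/
noncomputable def l (k : ℂ) : Fin 3 → ℂ := ![ω * k, ω ^ 2 * k, k]

/-- `z_1 = 9 ω² k⁵`, `z_2 = 9 ω k⁵`, `z_3 = 9 k⁵`. -/
noncomputable def z (k : ℂ) : Fin 3 → ℂ := ![9 * ω ^ 2 * k ^ 5, 9 * ω * k ^ 5, 9 * k ^ 5]

/-- `θ_{ij} = (l_i - l_j) x + (z_i - z_j) t`; the indices start at `0` here. -/
noncomputable def θ (i j : Fin 3) (x t : ℝ) (k : ℂ) : ℂ :=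
  (l k i - l k j) * x + (z k i - z k j) * t

/-- The jump matrix `v_n` on the `n`-th ray, `n = 1, …, 6` (the value at other `n` is irrelevant).
The reflection coefficients are functions of a real variable: on the `n`-th ray exactly one of
`k`, `ω k`, `ω² k` is real, and that one is their argument; `r^*` is then the complex conjugate. -/
noncomputable def jump (r₁ r₂ : ℝ → ℂ) (n : ℤ) (x t : ℝ) (k : ℂ) : Mat3 :=
  let θ₂₁ := θ 1 0 x t k
  let θ₃₁ := θ 2 0 x t k
  let θ₃₂ := θ 2 1 x t k
  let ρ₁ : ℂ → ℂ := fun κ => r₁ κ.re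
  let ρ₂ : ℂ → ℂ := fun κ => r₂ κ.re
  let ρ₁' : ℂ → ℂ := fun κ => star (r₁ κ.re)
  let ρ₂' : ℂ → ℂ := fun κ => star (r₂ κ.re)
  if n = 1 then
    !![1, -ρ₁ k * Complex.exp (-θ₂₁), 0;
       ρ₁' k * Complex.exp θ₂₁, 1 - ρ₁ k * ρ₁' k, 0;
       0, 0, 1]
  else if n = 2 then
    !![1, 0, 0;
       0, 1 - ρ₂ (ω * k) * ρ₂' (ω * k), -ρ₂' (ω * k) * Complex.exp (-θ₃₂);
       0, ρ₂ (ω * k) * Complex.exp θ₃₂, 1]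
  else if n = 3 then
    !![1 - ρ₁ (ω ^ 2 * k) * ρ₁' (ω ^ 2 * k), 0, ρ₁' (ω ^ 2 * k) * Complex.exp (-θ₃₁);
       0, 1, 0;
       -ρ₁ (ω ^ 2 * k) * Complex.exp θ₃₁, 0, 1]
  else if n = 4 then
    !![1 - ρ₂ k * ρ₂' k, -ρ₂' k * Complex.exp (-θ₂₁), 0;
       ρ₂ k * Complex.exp θ₂₁, 1, 0;
       0, 0, 1]
  else if n = 5 then
    !![1, 0, 0;
       0, 1, -ρ₁ (ω * k) * Complex.exp (-θ₃₂);
       0, ρ₁' (ω * k) * Complex.exp θ₃₂, 1 - ρ₁ (ω * k) * ρ₁' (ω * k)]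
  else
    !![1, 0, ρ₂ (ω ^ 2 * k) * Complex.exp (-θ₃₁);
       0, 1, 0;
       -ρ₂' (ω ^ 2 * k) * Complex.exp θ₃₁, 0, 1 - ρ₂ (ω ^ 2 * k) * ρ₂' (ω ^ 2 * k)]

/-! ### Reflection coefficients -/

/-- The properties of the reflection coefficients `r₁` on `(0, ∞)` and `r₂` on `(-∞, 0)`: smooth,
rapidly decaying at infinity, with asymptotic power series at `k = 0` whose constant terms are
`ω²` and `1`. -/
structure IsReflectionPair (r₁ r₂ : ℝ → ℂ) : Prop where
  smooth₁ : ContDiffOn ℝ (⊤ : ℕ∞) r₁ (Ioi 0)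
  smooth₂ : ContDiffOn ℝ (⊤ : ℕ∞) r₂ (Iio 0)
  decay₁ : ∀ N : ℕ, r₁ =O[atTop] fun k : ℝ => (k ^ N)⁻¹
  decay₂ : ∀ N : ℕ, r₂ =O[atBot] fun k : ℝ => (k ^ N)⁻¹
  zero₁ : ∃ c : ℕ → ℂ, c 0 = ω ^ 2 ∧ ∀ p : ℕ,
    (fun k : ℝ => r₁ k - ∑ j ∈ Finset.range (p + 1), c j * (k : ℂ) ^ j)
      =O[𝓝[>] 0] fun k : ℝ => k ^ (p + 1)
  zero₂ : ∃ c : ℕ → ℂ, c 0 = 1 ∧ ∀ p : ℕ,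
    (fun k : ℝ => r₂ k - ∑ j ∈ Finset.range (p + 1), c j * (k : ℂ) ^ j)
      =O[𝓝[<] 0] fun k : ℝ => k ^ (p + 1)

/-! ### Conditions shared by the two Riemann-Hilbert problems -/

/-- The matrix `𝒜`. -/
def matA : Mat3 := !![0, 0, 1; 1, 0, 0; 0, 1, 0]

/-- The matrix `ℬ`. -/
def matB : Mat3 := !![0, 1, 0; 1, 0, 0; 0, 0, 1]

/-- Analyticity of `k ↦ F k` off `Σ`. -/
def AnalyticOff (F : ℂ → Mat3) : Prop :=
  ∀ i j, DifferentiableOn ℂ (fun k => F k i j) Sigmaᶜ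

/-- On each of the six rays the limits `F₊` and `F₋` from the left and from the right exist, are
continuous, and satisfy `F₊ = F₋ v`. -/
def HasJumps (v : ℤ → ℂ → Mat3) (F : ℂ → Mat3) : Prop :=
  ∀ n ∈ Finset.Icc (1 : ℤ) 6, ∃ Fp Fm : ℂ → Mat3,
    ContinuousOn Fp (ray n) ∧ ContinuousOn Fm (ray n) ∧
    ∀ k ∈ ray n, Tendsto F (𝓝[sector n] k) (𝓝 (Fp k)) ∧
      Tendsto F (𝓝[sector (n - 1)] k) (𝓝 (Fm k)) ∧ Fp k = Fm k * v n k

/-- The two symmetries `F(k) = 𝒜 F(ωk) 𝒜⁻¹ = ℬ F(k^*)^* ℬ`, where `*` conjugates entrywise. -/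
def HasSymmetries (F : ℂ → Mat3) : Prop :=
  ∀ k ∉ Sigma, F k = matA * F (ω * k) * matA⁻¹ ∧
    F k = matB * (F (star k)).map star * matB

/-- `F(x;k) = I + F₁(x)/k + O(k⁻²)` as `k → ∞` off `Σ`, uniformly for `x` in bounded sets. -/
def HasExpansionAtInfinity (F : ℝ → ℂ → Mat3) (F₁ : ℝ → Mat3) : Prop :=
  ∀ X : ℝ, ∃ C R : ℝ, ∀ x : ℝ, |x| ≤ X → ∀ k ∉ Sigma, R ≤ ‖k‖ → ∀ i j,
    ‖(F x k - 1 - k⁻¹ • F₁ x) i j‖ ≤ C / ‖k‖ ^ 2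

/-- `F(k) = ∑_{j=0}^p c_j k^{j-d} + O(k^{p+1-d})` as `k → 0` in the sector `Ω_n`, for every `p`. -/
def HasExpansionAtZero (d : ℕ) (n : ℤ) (F : ℂ → Mat3) (c : ℕ → Mat3) : Prop :=
  ∀ p : ℕ, ∀ a b,
    (fun k : ℂ => (F k - ∑ j ∈ Finset.range (p + 1), k ^ ((j : ℤ) - d) • c j) a b)
      =O[𝓝[sector n] 0] fun k : ℂ => k ^ ((p : ℤ) + 1 - d)

/-- Rapid decrease as `x → +∞`. -/
def RapidlyDecreasing (f : ℝ → ℝ) : Prop :=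
  ∀ N : ℕ, f =O[atTop] fun x : ℝ => (x ^ N)⁻¹

/-! ### The two Riemann-Hilbert problems, for all `x ∈ ℝ` and `t ≥ 0` -/

/-- `m` solves the Riemann-Hilbert problem of the modified Sawada-Kotera equation with reflection
coefficients `r₁`, `r₂` and with potential `w`. Note `∫_∞^x w² = -∫_x^∞ w²`. -/
structure SolvesRHmSK (r₁ r₂ : ℝ → ℂ) (w : ℝ → ℝ → ℝ) (m : ℝ → ℝ → ℂ → Mat3) : Prop where
  analytic : ∀ x t : ℝ, 0 ≤ t → AnalyticOff (m x t)
  jumps : ∀ x t : ℝ, 0 ≤ t → HasJumps (fun n k => jump r₁ r₂ n x t k) (m x t)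
  symmetries : ∀ x t : ℝ, 0 ≤ t → HasSymmetries (m x t)
  integrable : ∀ x t : ℝ, 0 ≤ t → IntegrableOn (fun y => w y t ^ 2) (Ioi x)
  infinity : ∀ t : ℝ, 0 ≤ t → HasExpansionAtInfinity (fun x => m x t) fun x =>
    ((w x t : ℂ) / 3) • !![0, ω, 1; ω ^ 2, 0, 1; ω ^ 2, ω, 0]
      + (((-∫ y in Ioi x, w y t ^ 2 : ℝ) : ℂ) / 3) • !![ω ^ 2, 0, 0; 0, ω, 0; 0, 0, 1]
  zero : ∀ x t : ℝ, 0 ≤ t → ∀ n : ℤ, ∃ c : ℕ → Mat3, HasExpansionAtZero 0 n (m x t) c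

/-- `M` solves the Riemann-Hilbert problem of the Sawada-Kotera equation with reflection
coefficients `r₁`, `r₂` and with potential `u`. The coefficients of the expansion at `k = 0` depend
on the sector; the displayed residue is the one in `Ω_1`, and the residues in the other sectors are
then fixed by the symmetries. -/
structure SolvesRHSK (r₁ r₂ : ℝ → ℂ) (u : ℝ → ℝ → ℝ) (M : ℝ → ℝ → ℂ → Mat3) : Prop where
  analytic : ∀ x t : ℝ, 0 ≤ t → AnalyticOff (M x t)
  jumps : ∀ x t : ℝ, 0 ≤ t → HasJumps (fun n k => jump r₁ r₂ n x t k) (M x t)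
  symmetries : ∀ x t : ℝ, 0 ≤ t → HasSymmetries (M x t)
  continuous : ∀ t : ℝ, 0 ≤ t → Continuous fun y => u y t
  integrable : ∀ x t : ℝ, 0 ≤ t → IntegrableOn (fun y => u y t) (Ioi x)
  infinity : ∀ t : ℝ, 0 ≤ t → HasExpansionAtInfinity (fun x => M x t) fun x =>
    ((∫ y in Ioi x, 2 * u y t : ℝ) : ℂ) • !![ω ^ 2, 0, 0; 0, ω, 0; 0, 0, 1]
  zero : ∃ a : ℝ → ℝ → ℝ, (∀ t : ℝ, 0 ≤ t → RapidlyDecreasing fun x => a x t) ∧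
    ∀ x t : ℝ, 0 ≤ t → ∀ n : ℤ, ∃ c : ℕ → Mat3,
      HasExpansionAtZero 1 n (M x t) c ∧
      (n = 1 → c 0 = (a x t : ℂ) • !![ω ^ 2, 0, 0; ω ^ 2, 0, 0; ω ^ 2, 0, 0])

/-! ### The transformation and the two equations -/

/-- The matrix `A(x,t)`, as a function of the value `w = w(x,t)`. -/
noncomputable def miuraMatrix (w : ℝ) : Mat3 :=
  (-(w : ℂ) / 3) • !![ω ^ 2, ω, 1; ω ^ 2, ω, 1; ω ^ 2, ω, 1]

/-- `M(x,t;k) = (I + A(x,t)/k) m(x,t;k)`. -/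
noncomputable def miuraTransform (w : ℝ → ℝ → ℝ) (m : ℝ → ℝ → ℂ → Mat3) : ℝ → ℝ → ℂ → Mat3 :=
  fun x t k => (1 + k⁻¹ • miuraMatrix (w x t)) * m x t k

/-- The reconstruction formula `u = -½ ∂_x lim_{k → ∞} k (M₃₃ - 1)`: the limits exist, and so does
the derivative. -/
def IsRecoveredFrom (M : ℝ → ℝ → ℂ → Mat3) (u : ℝ → ℝ → ℝ) : Prop :=
  ∀ t : ℝ, 0 ≤ t → ∃ L : ℝ → ℂ,
    (∀ x, Tendsto (fun k => k * (M x t k 2 2 - 1)) (Bornology.cobounded ℂ ⊓ 𝓟 Sigmaᶜ)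
      (𝓝 (L x))) ∧
    ∀ x, ∃ L' : ℂ, HasDerivAt L L' x ∧ (u x t : ℂ) = -(1 / 2) * L'

/-- The `j`-th partial derivative in `x`. -/
noncomputable def Dx (j : ℕ) (f : ℝ → ℝ → ℝ) (x t : ℝ) : ℝ := iteratedDeriv j (fun y => f y t) x

/-- The partial derivative in `t ∈ [0, ∞)` (one-sided at `t = 0`). -/
noncomputable def Dt (f : ℝ → ℝ → ℝ) (x t : ℝ) : ℝ := derivWithin (fun s => f x s) (Ici 0) t

/-- Smoothness on `ℝ × [0, ∞)`. -/
def SmoothOnHalfPlane (f : ℝ → ℝ → ℝ) : Prop :=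
  ContDiffOn ℝ (⊤ : ℕ∞) (fun q : ℝ × ℝ => f q.1 q.2) (univ ×ˢ Ici 0)

/-- `u` is a smooth solution on `ℝ × [0, ∞)` of the Sawada-Kotera equation
`u_t + u_xxxxx + 30 (u u_xxx + u_x u_xx) + 180 u² u_x = 0`. -/
def SolvesSK (u : ℝ → ℝ → ℝ) : Prop :=
  SmoothOnHalfPlane u ∧ ∀ x t : ℝ, 0 ≤ t →
    Dt u x t + Dx 5 u x t + 30 * (u x t * Dx 3 u x t + Dx 1 u x t * Dx 2 u x t)
      + 180 * u x t ^ 2 * Dx 1 u x t = 0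

/-- `w` is a smooth solution on `ℝ × [0, ∞)` of the modified Sawada-Kotera equation
`w_t + w_xxxxx - (5 w_x w_xx + 5 w w_x² + 5 w² w_xx - w⁵)_x = 0`. -/
def SolvesmSK (w : ℝ → ℝ → ℝ) : Prop :=
  SmoothOnHalfPlane w ∧ ∀ x t : ℝ, 0 ≤ t →
    Dt w x t + Dx 5 w x t
      - Dx 1 (fun y s => 5 * Dx 1 w y s * Dx 2 w y s + 5 * w y s * Dx 1 w y s ^ 2
          + 5 * w y s ^ 2 * Dx 2 w y s - w y s ^ 5) x t = 0

end Miura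

/-!
Two normalized solutions of Riemann-Hilbert problems with the same jumps are compared through
their quotient, which has no jump and hence is entire (`exists_entire_quotient`, via Painlevé's
principle and Morera's theorem), and Liouville's theorem.

**Uniqueness.** The jumps have determinant `1`, so `det m = 1`. If `(u, M)` solves the
Sawada-Kotera problem, then `k M m⁻¹` is entire and equal to `k + C + o(1)` at infinity, with `C` the
difference of the coefficients of `k⁻¹`. Hence `M = (1 + C / k) m`, where the diagonal part of `C` is
known up to the unknown function `∫ₓ^∞ 2u`. The prescribed residue at `0` has equal rows, so `C` has
equal rows, and this forces both `C = A` and `∫ₓ^∞ 2u = -w / 3 - (∫ₓ^∞ w²) / 3`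
(`SolvesRHSK.eq_and_integral_eq`). Differentiation in `x` gives the Miura transformation, and the
passage from one differential equation to the other is then a computation with mixed partial
derivatives (`SolvesmSK.solvesSK`).

**Existence.** The matrix `A / k` obeys the two symmetries, and multiplication by `1 + A / k` from the
left does not affect the jumps, so only the residue at `0` needs an argument. Let `P(x)` be the limit of
`m` at `0` in `Ω₁`. The values of three consecutive jumps at `0`, which come from `r₁(0) = ω²` and
`r₂(0) = 1`, together with the two symmetries give `(ω², ω, 1) P = α (ω², 0, 0)` with `α` real
(`SolvesRHmSK.exists_real_row`). So the residue has the required form with `a₊ = -w α / 3`, and it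
remains to see that `α` is bounded as `x → +∞`. This needs the `x`-dependence of `P`, while no
regularity of `m` in `x` is assumed. The transition matrix
`m(x + h) exp(h diag(l₁, l₂, l₃)) m(x)⁻¹` is entire in `k`, the exponential factor being what carries
the jump at `x` to the jump at `x + h`. On circles of radius about `|h|^(-1/2)` the expansion at
infinity makes it close to `1 + h k J`, and the maximum principle and Schwarz's lemma carry the
estimate inside (`exists_transition_bound_disc`). Therefore `P` is continuous, and `P⁻¹ m` satisfies
the Lax equation `(P⁻¹ m)' = k P⁻¹ [J, m]` (`hasDerivAt_gauge`). Letting `k → ∞`, with `m₁` the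
coefficient of `k⁻¹`, gives `(P⁻¹)' = P⁻¹ [J, m₁]` (`hasDerivAt_zero_limit_inv`), of which one row reads
`(1 / α)' = w / α`. As `w` is integrable at `+∞`, `α` is bounded there
(`SolvesRHmSK.real_row_isBigO_one`).
-/

namespace Miura

/-! ### Analytic continuation across a line -/

/-- Painlevé's principle on an open set: a continuous function that is complex differentiable off
the real axis is complex differentiable. A rectangle is cut along the real axis, and Cauchy's
theorem, which asks for differentiability in the interior only, applies to both halves; then
Morera's theorem applies. -/
theorem differentiableOn_of_continuousOn_of_im_ne_zero {f : ℂ → ℂ} {U : Set ℂ} (hU : IsOpen U)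
    (hc : ContinuousOn f U) (hd : ∀ z ∈ U, z.im ≠ 0 → DifferentiableAt ℂ f z) :
    DifferentiableOn ℂ f U := by
  refine (Complex.isConservativeOn_and_continuousOn_iff_isDifferentiableOn hU).1 ⟨?_, hc⟩
  intro z w hzw
  rw [← add_eq_zero_iff_eq_neg, Complex.wedgeIntegral_add_wedgeIntegral_eq]
  -- Cauchy's theorem for the part of the rectangle between the heights `p` and `q`
  have key : ∀ p q : ℝ, uIcc p q ⊆ uIcc z.im w.im → (0 : ℝ) ∉ Ioo (min p q) (max p q) →
      (∫ x : ℝ in z.re..w.re, f (x + p * Complex.I))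
        - (∫ x : ℝ in z.re..w.re, f (x + q * Complex.I))
        + Complex.I • (∫ y : ℝ in p..q, f (w.re + y * Complex.I))
        - Complex.I • (∫ y : ℝ in p..q, f (z.re + y * Complex.I)) = 0 := by
    intro p q hpq h0
    have hsub : uIcc z.re w.re ×ℂ uIcc p q ⊆ U := fun x hx => hzw ⟨hx.1, hpq hx.2⟩
    have := Complex.integral_boundary_rect_eq_zero_of_continuousOn_of_differentiableOn f
      ⟨z.re, p⟩ ⟨w.re, q⟩ (hc.mono hsub) (fun x hx => by
        refine (hd x (hsub ⟨Ioo_subset_Icc_self hx.1, Ioo_subset_Icc_self hx.2⟩) ?_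
          ).differentiableWithinAt
        intro h
        exact h0 (h ▸ hx.2))
    simpa using this
  by_cases h0 : (0 : ℝ) ∈ Ioo (min z.im w.im) (max z.im w.im)
  swap
  · exact key _ _ Subset.rfl h0
  have h0' : (0 : ℝ) ∈ uIcc z.im w.im := Ioo_subset_Icc_self h0
  have s1 : uIcc z.im 0 ⊆ uIcc z.im w.im := uIcc_subset_uIcc left_mem_uIcc h0'
  have s2 : uIcc 0 w.im ⊆ uIcc z.im w.im := uIcc_subset_uIcc h0' right_mem_uIcc
  have k1 := key z.im 0 s1 (fun h => by
    rcases le_total z.im 0 with h' | h' <;> simp [h'] at h)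
  have k2 := key 0 w.im s2 (fun h => by
    rcases le_total w.im 0 with h' | h' <;> simp [h'] at h)
  have hint : ∀ a ∈ uIcc z.re w.re, ∀ p q : ℝ, uIcc p q ⊆ uIcc z.im w.im →
      IntervalIntegrable (fun y : ℝ => f (a + y * Complex.I)) volume p q := by
    intro a ha p q hpq
    refine ContinuousOn.intervalIntegrable (hc.comp (by fun_prop) ?_)
    intro y hy
    exact hzw ⟨by simpa using ha, by simpa using hpq hy⟩
  have a1 := intervalIntegral.integral_add_adjacent_intervals
    (hint _ right_mem_uIcc _ _ s1) (hint _ right_mem_uIcc _ _ s2)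
  have a2 := intervalIntegral.integral_add_adjacent_intervals
    (hint _ left_mem_uIcc _ _ s1) (hint _ left_mem_uIcc _ _ s2)
  rw [← a1, ← a2]
  simp only [smul_eq_mul] at k1 k2 ⊢
  linear_combination k1 + k2

/-! ### The contour and the sectors -/

/-- The rotation taking the positive real axis to the `n`-th ray. -/
noncomputable def rot (n : ℤ) : ℂ := Complex.exp ((n - 1) * Real.pi / 3 * Complex.I)

theorem rot_ne_zero (n : ℤ) : rot n ≠ 0 := Complex.exp_ne_zero _

theorem mem_ray_iff {n : ℤ} {k : ℂ} : k ∈ ray n ↔ ∃ s : ℝ, 0 < s ∧ k = s * rot n := Iff.rfl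

theorem mul_rot_mem_sector (n : ℤ) {s φ : ℝ} (hs : 0 < s) (h1 : 0 < φ) (h2 : φ < Real.pi / 3) :
    s * Complex.exp (φ * Complex.I) * rot n ∈ sector n := by
  refine ⟨s, φ + (n - 1) * Real.pi / 3, hs, by linarith, by linarith, ?_⟩
  rw [rot, mul_assoc, ← Complex.exp_add]
  congr 2
  push_cast
  ring

theorem mul_rot_mem_sector_pred (n : ℤ) {s φ : ℝ} (hs : 0 < s) (h1 : φ < 0)
    (h2 : -(Real.pi / 3) < φ) :
    s * Complex.exp (φ * Complex.I) * rot n ∈ sector (n - 1) := by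
  refine ⟨s, φ + (n - 1) * Real.pi / 3, hs, ?_, ?_, ?_⟩
  · push_cast; linarith
  · push_cast; linarith
  rw [rot, mul_assoc, ← Complex.exp_add]
  congr 2
  push_cast
  ring

theorem exists_mem_ray_or_mem_sector {k : ℂ} (hk : k ≠ 0) :
    ∃ n ∈ Finset.Icc (1 : ℤ) 6, k ∈ ray n ∨ k ∈ sector n := by
  have hpi := Real.pi_pos
  -- the argument in `[0, 2π)`
  obtain ⟨φ, h0, h2, hφ⟩ : ∃ φ : ℝ, 0 ≤ φ ∧ φ < 2 * Real.pi ∧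
      k = ‖k‖ * Complex.exp (φ * Complex.I) := by
    rcases le_or_gt 0 k.arg with h | h
    · exact ⟨k.arg, h, by linarith [Complex.arg_le_pi k], (Complex.norm_mul_exp_arg_mul_I k).symm⟩
    · refine ⟨k.arg + 2 * Real.pi, by linarith [Complex.neg_pi_lt_arg k], by linarith, ?_⟩
      push_cast
      rw [add_mul, Complex.exp_add, Complex.exp_two_pi_mul_I, mul_one,
        Complex.norm_mul_exp_arg_mul_I]
  have hfl := Int.floor_le (3 * φ / Real.pi)
  have hfl' := Int.lt_floor_add_one (3 * φ / Real.pi)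
  have hk' : 0 < ‖k‖ := norm_pos_iff.2 hk
  refine ⟨⌊3 * φ / Real.pi⌋ + 1, ?_, ?_⟩
  · rw [Finset.mem_Icc]
    constructor
    · have : (0 : ℤ) ≤ ⌊3 * φ / Real.pi⌋ := Int.floor_nonneg.2 (by positivity)
      linarith
    · have : ⌊3 * φ / Real.pi⌋ < 6 := by
        rw [Int.floor_lt, div_lt_iff₀ hpi]
        push_cast
        linarith
      linarith
  · rw [le_div_iff₀ hpi] at hfl
    rw [div_lt_iff₀ hpi] at hfl'
    rcases hfl.eq_or_lt with h | h
    · left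
      refine ⟨‖k‖, hk', ?_⟩
      have hφ' : φ = ⌊3 * φ / Real.pi⌋ * Real.pi / 3 := by linarith
      conv_lhs => rw [hφ, hφ']
      push_cast
      simp
    · right
      refine ⟨‖k‖, φ, hk', ?_, ?_, hφ⟩
      · push_cast
        linarith
      · push_cast
        linarith

theorem im_cube_polar (s φ : ℝ) :
    ((s * Complex.exp (φ * Complex.I)) ^ 3).im = s ^ 3 * Real.sin (3 * φ) := by
  rw [mul_pow, ← Complex.exp_nat_mul]
  have : ((3 : ℕ) : ℂ) * (φ * Complex.I) = ((3 * φ : ℝ) : ℂ) * Complex.I := by push_cast; ring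
  rw [this, ← Complex.ofReal_pow, Complex.im_ofReal_mul,
    Complex.exp_ofReal_mul_I_im]

theorem im_cube_ne_zero_of_mem_sector {n : ℤ} {k : ℂ} (hk : k ∈ sector n) : (k ^ 3).im ≠ 0 := by
  obtain ⟨s, φ, hs, h1, h2, rfl⟩ := hk
  rw [im_cube_polar]
  refine mul_ne_zero (by positivity) ?_
  rw [Real.sin_ne_zero_iff]
  intro m hm
  have hpi := Real.pi_pos
  have e1 : ((n - 1 : ℤ) : ℝ) < m := by
    push_cast
    nlinarith
  have e2 : (m : ℝ) < n := by nlinarith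
  have e1' : n - 1 < m := by exact_mod_cast e1
  have e2' : m < n := by exact_mod_cast e2
  omega

theorem im_cube_eq_zero_of_mem_Sigma {k : ℂ} (hk : k ∈ Sigma) : (k ^ 3).im = 0 := by
  obtain ⟨j, s, rfl⟩ := hk
  have : ((j : ℕ) : ℂ) * Real.pi * Complex.I / 3 = ((j * Real.pi / 3 : ℝ) : ℂ) * Complex.I := by
    push_cast; ring
  rw [this, im_cube_polar]
  have : 3 * ((j : ℕ) * Real.pi / 3) = (j : ℕ) * Real.pi := by ring
  rw [this, Real.sin_nat_mul_pi, mul_zero]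

theorem zero_mem_Sigma : (0 : ℂ) ∈ Sigma := ⟨0, 0, by simp⟩

theorem ray_subset_Sigma {n : ℤ} (hn : n ∈ Finset.Icc (1 : ℤ) 6) : ray n ⊆ Sigma := by
  rintro k ⟨s, -, rfl⟩
  have hI : ∀ a : ℂ, Complex.exp ((a + Real.pi * Complex.I)) = -Complex.exp a := by
    intro a; rw [Complex.exp_add, Complex.exp_pi_mul_I]; ring
  rw [Finset.mem_Icc] at hn
  obtain ⟨h1, h6⟩ := hn
  interval_cases n
  · exact ⟨0, s, by simp⟩
  · refine ⟨1, s, ?_⟩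
    congr 2; push_cast; simp; ring
  · refine ⟨2, s, ?_⟩
    congr 2; push_cast; simp; ring
  · refine ⟨0, -s, ?_⟩
    rw [show (((4 : ℤ) : ℂ) - 1) * Real.pi / 3 * Complex.I = 0 + Real.pi * Complex.I by
      push_cast; ring, hI]
    simp
  · refine ⟨1, -s, ?_⟩
    rw [show (((5 : ℤ) : ℂ) - 1) * Real.pi / 3 * Complex.I
      = ((1 : Fin 3) : ℕ) * Real.pi * Complex.I / 3 + Real.pi * Complex.I by
      push_cast; simp; ring, hI]
    push_cast; ring
  · refine ⟨2, -s, ?_⟩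
    rw [show (((6 : ℤ) : ℂ) - 1) * Real.pi / 3 * Complex.I
      = ((2 : Fin 3) : ℕ) * Real.pi * Complex.I / 3 + Real.pi * Complex.I by
      push_cast; simp; ring, hI]
    push_cast; ring

theorem mem_Sigma_iff {k : ℂ} : k ∈ Sigma ↔ (k ^ 3).im = 0 := by
  refine ⟨im_cube_eq_zero_of_mem_Sigma, fun h => ?_⟩
  rcases eq_or_ne k 0 with rfl | hk
  · exact zero_mem_Sigma
  obtain ⟨n, hn, hr | hs⟩ := exists_mem_ray_or_mem_sector hk
  · exact ray_subset_Sigma hn hr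
  · exact absurd h (im_cube_ne_zero_of_mem_sector hs)

theorem sector_subset_compl_Sigma (n : ℤ) : sector n ⊆ Sigmaᶜ := fun _ hk h =>
  im_cube_ne_zero_of_mem_sector hk (im_cube_eq_zero_of_mem_Sigma h)

theorem isOpen_compl_Sigma : IsOpen Sigmaᶜ := by
  have : Sigma = (fun k : ℂ => (k ^ 3).im) ⁻¹' {0} := by
    ext k; exact mem_Sigma_iff
  rw [this, isOpen_compl_iff]
  exact isClosed_singleton.preimage (by fun_prop)

theorem exists_mem_sector {k : ℂ} (hk : k ∉ Sigma) : ∃ n ∈ Finset.Icc (1 : ℤ) 6, k ∈ sector n := by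
  have h0 : k ≠ 0 := fun h => hk (h ▸ zero_mem_Sigma)
  obtain ⟨n, hn, hr | hs⟩ := exists_mem_ray_or_mem_sector h0
  · exact absurd (ray_subset_Sigma hn hr) hk
  · exact ⟨n, hn, hs⟩

theorem ne_zero_of_notMem_Sigma {k : ℂ} (hk : k ∉ Sigma) : k ≠ 0 := fun h =>
  hk (h ▸ zero_mem_Sigma)

theorem omega_eq : ω = Complex.exp (((2 * Real.pi / 3 : ℝ) : ℂ) * Complex.I) := by
  rw [ω]; congr 1; push_cast; ring

theorem omega_cube : ω ^ 3 = 1 := by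
  rw [ω, ← Complex.exp_nat_mul]
  have : ((3 : ℕ) : ℂ) * (2 * Real.pi * Complex.I / 3) = 2 * Real.pi * Complex.I := by
    push_cast; ring
  rw [this, Complex.exp_two_pi_mul_I]

theorem omega_ne_zero : ω ≠ 0 := Complex.exp_ne_zero _

theorem omega_ne_one : ω ≠ 1 := by
  intro h
  have h1 : (ω).im = Real.sin (2 * Real.pi / 3) := by
    rw [omega_eq, Complex.exp_ofReal_mul_I_im]
  rw [h] at h1
  have : 0 < Real.sin (2 * Real.pi / 3) :=
    Real.sin_pos_of_pos_of_lt_pi (by positivity) (by linarith [Real.pi_pos])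
  simp only [Complex.one_im] at h1
  linarith

theorem omega_sq : ω ^ 2 = -1 - ω := by
  have h : (ω - 1) * (ω ^ 2 + ω + 1) = 0 := by linear_combination omega_cube
  rcases mul_eq_zero.1 h with h | h
  · exact absurd (sub_eq_zero.1 h) omega_ne_one
  · linear_combination h

theorem norm_omega : ‖ω‖ = 1 := by rw [omega_eq, Complex.norm_exp_ofReal_mul_I]

theorem star_omega : star ω = ω ^ 2 := by
  have h : ω * star ω = 1 := by
    have := Complex.mul_conj ω
    rw [Complex.normSq_eq_norm_sq, norm_omega] at this
    simpa using this
  have := omega_cube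
  calc star ω = ω ^ 2 * (ω * star ω) - (ω ^ 3 - 1) * star ω := by ring
    _ = ω ^ 2 := by rw [h, this]; ring

theorem omega_mul_mem_sector {n : ℤ} {k : ℂ} (hk : k ∈ sector n) : ω * k ∈ sector (n + 2) := by
  obtain ⟨s, φ, hs, h1, h2, rfl⟩ := hk
  refine ⟨s, φ + 2 * Real.pi / 3, hs, ?_, ?_, ?_⟩
  · push_cast; linarith
  · push_cast; linarith
  · rw [omega_eq, mul_left_comm, ← Complex.exp_add]
    congr 2; push_cast; ring

theorem star_mem_sector {n : ℤ} {k : ℂ} (hk : k ∈ sector n) : star k ∈ sector (1 - n) := by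
  obtain ⟨s, φ, hs, h1, h2, rfl⟩ := hk
  refine ⟨s, -φ, hs, ?_, ?_, ?_⟩
  · push_cast; linarith
  · push_cast; linarith
  · simp [← Complex.exp_conj]

/-- The points `s e^{iπ/6}` of the bisector of `Ω₁`. -/
theorem bisector_mem_sector {s : ℝ} (hs : 0 < s) :
    (s : ℂ) * Complex.exp ((Real.pi / 6 : ℝ) * Complex.I) ∈ sector 1 :=
  ⟨s, Real.pi / 6, hs, by push_cast; linarith [Real.pi_pos],
    by push_cast; linarith [Real.pi_pos], rfl⟩

/-! ### Neighbourhoods of points of the contour -/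

theorem neBot_nhdsWithin_sector_zero (n : ℤ) : (𝓝[sector n] (0 : ℂ)).NeBot := by
  have h : Tendsto (fun s : ℝ => (s : ℂ) * Complex.exp ((Real.pi / 6 : ℝ) * Complex.I) * rot n)
      (𝓝[>] 0) (𝓝[sector n] 0) := by
    refine tendsto_nhdsWithin_iff.2 ⟨?_, ?_⟩
    · refine Tendsto.mono_left ?_ nhdsWithin_le_nhds
      have : Continuous fun s : ℝ =>
        (s : ℂ) * Complex.exp ((Real.pi / 6 : ℝ) * Complex.I) * rot n := by fun_prop
      simpa using this.tendsto 0
    · filter_upwards [self_mem_nhdsWithin] with s hs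
      exact mul_rot_mem_sector n hs (by linarith [Real.pi_pos]) (by linarith [Real.pi_pos])
  exact h.neBot

theorem neBot_nhdsWithin_sector {n : ℤ} {k : ℂ} (hk : k ∈ ray n) : (𝓝[sector n] k).NeBot := by
  obtain ⟨s, hs, rfl⟩ := mem_ray_iff.1 hk
  have h : Tendsto (fun φ : ℝ => (s : ℂ) * Complex.exp (φ * Complex.I) * rot n)
      (𝓝[>] 0) (𝓝[sector n] (s * rot n)) := by
    refine tendsto_nhdsWithin_iff.2 ⟨?_, ?_⟩
    · refine Tendsto.mono_left ?_ nhdsWithin_le_nhds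
      have : Continuous fun φ : ℝ => (s : ℂ) * Complex.exp (φ * Complex.I) * rot n := by fun_prop
      simpa using this.tendsto 0
    · filter_upwards [Ioo_mem_nhdsGT (show (0 : ℝ) < Real.pi / 3 by positivity)] with φ hφ
      exact mul_rot_mem_sector n hs hφ.1 hφ.2
  exact h.neBot

theorem neBot_nhdsWithin_sector_pred {n : ℤ} {k : ℂ} (hk : k ∈ ray n) :
    (𝓝[sector (n - 1)] k).NeBot := by
  obtain ⟨s, hs, rfl⟩ := mem_ray_iff.1 hk
  have h : Tendsto (fun φ : ℝ => (s : ℂ) * Complex.exp (φ * Complex.I) * rot n)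
      (𝓝[<] 0) (𝓝[sector (n - 1)] (s * rot n)) := by
    refine tendsto_nhdsWithin_iff.2 ⟨?_, ?_⟩
    · refine Tendsto.mono_left ?_ nhdsWithin_le_nhds
      have : Continuous fun φ : ℝ => (s : ℂ) * Complex.exp (φ * Complex.I) * rot n := by fun_prop
      simpa using this.tendsto 0
    · filter_upwards [Ioo_mem_nhdsLT (show -(Real.pi / 3) < (0 : ℝ) by
        linarith [Real.pi_pos])] with φ hφ
      exact mul_rot_mem_sector_pred n hs hφ.2 hφ.1
  exact h.neBot

theorem neBot_nhdsWithin_ray_zero (n : ℤ) : (𝓝[ray n] (0 : ℂ)).NeBot := by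
  have h : Tendsto (fun s : ℝ => (s : ℂ) * rot n) (𝓝[>] 0) (𝓝[ray n] 0) := by
    refine tendsto_nhdsWithin_iff.2 ⟨?_, ?_⟩
    · refine Tendsto.mono_left ?_ nhdsWithin_le_nhds
      have : Continuous fun s : ℝ => (s : ℂ) * rot n := by fun_prop
      simpa using this.tendsto 0
    · filter_upwards [self_mem_nhdsWithin] with s hs
      exact ⟨s, hs, rfl⟩
  exact h.neBot

theorem dense_compl_Sigma : Dense Sigmaᶜ := by
  intro k
  by_cases hk : k ∈ Sigma
  swap
  · exact subset_closure hk
  rw [mem_closure_iff_nhdsWithin_neBot]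
  rcases eq_or_ne k 0 with rfl | h0
  · exact (neBot_nhdsWithin_sector_zero 1).mono
      (nhdsWithin_mono _ (sector_subset_compl_Sigma 1))
  obtain ⟨n, hn, hr | hs⟩ := exists_mem_ray_or_mem_sector h0
  · exact (neBot_nhdsWithin_sector hr).mono (nhdsWithin_mono _ (sector_subset_compl_Sigma n))
  · exact absurd hk (sector_subset_compl_Sigma n hs)

/-- Points near `k` in polar coordinates centred on the `n`-th ray. -/
theorem exists_polar_nhds {n : ℤ} {k : ℂ} (hk : k ∈ ray n) :
    ∀ᶠ κ in 𝓝 k, ∃ s φ : ℝ, 0 < s ∧ -(Real.pi / 3) < φ ∧ φ < Real.pi / 3 ∧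
      κ = s * Complex.exp (φ * Complex.I) * rot n := by
  obtain ⟨s, hs, rfl⟩ := mem_ray_iff.1 hk
  have hcont : ContinuousAt (fun κ : ℂ => (κ / rot n).arg) (s * rot n) := by
    refine ContinuousAt.comp (g := Complex.arg) (f := fun κ : ℂ => κ / rot n)
      (x := (s : ℂ) * rot n) ?_ (by fun_prop)
    rw [mul_div_cancel_right₀ _ (rot_ne_zero n)]
    exact Complex.continuousAt_arg (by simp [Complex.mem_slitPlane_iff, hs])
  have h0 : (s * rot n / rot n).arg = 0 := by
    rw [mul_div_cancel_right₀ _ (rot_ne_zero n), Complex.arg_ofReal_of_nonneg hs.le]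
  have h1 : ∀ᶠ κ in 𝓝 ((s : ℂ) * rot n), (κ / rot n).arg ∈
      Ioo (-(Real.pi / 3)) (Real.pi / 3) := by
    apply hcont
    beta_reduce
    rw [h0]
    exact Ioo_mem_nhds (by linarith [Real.pi_pos]) (by linarith [Real.pi_pos])
  have h2 : ∀ᶠ κ in 𝓝 ((s : ℂ) * rot n), κ ≠ 0 :=
    isOpen_ne.mem_nhds (mul_ne_zero (by exact_mod_cast hs.ne') (rot_ne_zero n))
  filter_upwards [h1, h2] with κ hκ hκ0
  refine ⟨‖κ / rot n‖, (κ / rot n).arg,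
    norm_pos_iff.2 (div_ne_zero hκ0 (rot_ne_zero n)), hκ.1, hκ.2, ?_⟩
  rw [Complex.norm_mul_exp_arg_mul_I, div_mul_cancel₀ _ (rot_ne_zero n)]

theorem nhdsWithin_compl_Sigma_le {n : ℤ} (hn : n ∈ Finset.Icc (1 : ℤ) 6) {k : ℂ}
    (hk : k ∈ ray n) : 𝓝[Sigmaᶜ] k ≤ 𝓝[sector n] k ⊔ 𝓝[sector (n - 1)] k := by
  rw [← nhdsWithin_union]
  refine nhdsWithin_le_iff.2 ?_
  rw [mem_nhdsWithin_iff_eventually]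
  filter_upwards [exists_polar_nhds hk]
  rintro κ ⟨s, φ, hs, h1, h2, rfl⟩ hκ
  rcases lt_trichotomy φ 0 with h | h | h
  · exact Or.inr (mul_rot_mem_sector_pred n hs h h1)
  · subst h
    exact absurd (ray_subset_Sigma hn ⟨s, hs, by simp [rot]⟩) hκ
  · exact Or.inl (mul_rot_mem_sector n hs h h2)

theorem nhdsWithin_compl_Sigma_zero_le :
    𝓝[Sigmaᶜ] (0 : ℂ) ≤ ⨆ n ∈ Finset.Icc (1 : ℤ) 6, 𝓝[sector n] 0 := by
  have h : Sigmaᶜ ⊆ ⋃ n ∈ Finset.Icc (1 : ℤ) 6, sector n := fun k hk => by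
    obtain ⟨n, hn, h⟩ := exists_mem_sector hk
    exact mem_biUnion hn h
  refine (nhdsWithin_mono _ h).trans ?_
  exact (nhdsWithin_biUnion (Finset.finite_toSet (Finset.Icc (1 : ℤ) 6)) sector 0).le

/-- A bound off the contour extends to the contour by continuity. -/
theorem norm_le_of_norm_le_off_Sigma {f : ℂ → ℂ} {U : Set ℂ} (hU : IsOpen U)
    (hf : ContinuousOn f U) {C : ℝ} (h : ∀ k ∈ U, k ∉ Sigma → ‖f k‖ ≤ C) :
    ∀ k ∈ U, ‖f k‖ ≤ C := by
  intro k hk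
  have hne : (𝓝[Sigmaᶜ] k).NeBot := mem_closure_iff_nhdsWithin_neBot.1 (dense_compl_Sigma k)
  have ht : Tendsto f (𝓝[Sigmaᶜ] k) (𝓝 (f k)) :=
    (hf.continuousAt (hU.mem_nhds hk)).tendsto.mono_left nhdsWithin_le_nhds
  refine le_of_tendsto ht.norm ?_
  filter_upwards [self_mem_nhdsWithin, nhdsWithin_le_nhds (hU.mem_nhds hk)] with κ h1 h2
  exact h κ h2 h1

/-! ### Functions without jumps are entire -/

/-- A function that is analytic off the contour, has equal limits from both sides on the rays, and
has a limit at `0` from each sector, extends to an entire function. -/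
theorem exists_entire_extension {f : ℂ → ℂ} (hd : DifferentiableOn ℂ f Sigmaᶜ)
    (hj : ∀ n ∈ Finset.Icc (1 : ℤ) 6, ∀ k ∈ ray n, ∃ a, Tendsto f (𝓝[sector n] k) (𝓝 a) ∧
      Tendsto f (𝓝[sector (n - 1)] k) (𝓝 a))
    (h0 : ∀ n : ℤ, ∃ a, Tendsto f (𝓝[sector n] 0) (𝓝 a)) :
    ∃ g : ℂ → ℂ, Differentiable ℂ g ∧ ∀ k ∉ Sigma, g k = f k := by
  set F := extendFrom Sigmaᶜ f with hF
  have hFf : ∀ k ∉ Sigma, F k = f k := extendFrom_extends hd.continuousOn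
  have hcont : ContinuousOn F {0}ᶜ := by
    refine continuousOn_extendFrom (fun k _ => dense_compl_Sigma k) (fun k hk => ?_)
    by_cases hkS : k ∈ Sigma
    · obtain ⟨n, hn, hr | hs⟩ := exists_mem_ray_or_mem_sector hk
      · obtain ⟨a, ha1, ha2⟩ := hj n hn k hr
        exact ⟨a, (ha1.sup ha2).mono_left (nhdsWithin_compl_Sigma_le hn hr)⟩
      · exact absurd hkS (sector_subset_compl_Sigma n hs)
    · exact ⟨f k, (hd.continuousOn k hkS)⟩
  have hdiff_off : ∀ k ∉ Sigma, DifferentiableAt ℂ F k := fun k hk => by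
    have hmem : Sigmaᶜ ∈ 𝓝 k := isOpen_compl_Sigma.mem_nhds hk
    refine (hd.differentiableAt hmem).congr_of_eventuallyEq ?_
    filter_upwards [hmem] with κ hκ using hFf κ hκ
  have hdiff : ∀ k ≠ 0, DifferentiableAt ℂ F k := fun k hk => by
    by_cases hkS : k ∈ Sigma
    swap
    · exact hdiff_off k hkS
    obtain ⟨n, hn, hr | hs⟩ := exists_mem_ray_or_mem_sector hk
    swap
    · exact absurd hkS (sector_subset_compl_Sigma n hs)
    -- rotate the ray to the positive real axis
    obtain ⟨U, hUsub, hUo, hkU⟩ := eventually_nhds_iff.1 (exists_polar_nhds hr)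
    have hrot := rot_ne_zero n
    have hmaps : Continuous fun κ : ℂ => κ * rot n := by fun_prop
    have hU0 : ∀ κ ∈ U, κ ≠ 0 := by
      rintro κ hκ rfl
      obtain ⟨s, φ, hs, -, -, h⟩ := hUsub _ hκ
      exact mul_ne_zero (mul_ne_zero (by exact_mod_cast hs.ne') (Complex.exp_ne_zero _)) hrot h.symm
    have hrotd : DifferentiableOn ℂ (fun κ => F (κ * rot n)) ((fun κ => κ * rot n) ⁻¹' U) := by
      refine differentiableOn_of_continuousOn_of_im_ne_zero (hUo.preimage hmaps)
        (hcont.comp hmaps.continuousOn (fun κ hκ => hU0 _ hκ)) ?_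
      intro κ hκ him
      refine DifferentiableAt.comp κ (hdiff_off _ ?_) (by fun_prop)
      obtain ⟨s, φ, hs, h1, h2, h⟩ := hUsub _ hκ
      change κ * rot n = _ at h
      have hκe := mul_right_cancel₀ hrot h
      rcases lt_trichotomy φ 0 with h' | h' | h'
      · rw [h]; exact sector_subset_compl_Sigma _ (mul_rot_mem_sector_pred n hs h' h1)
      · subst h'
        exact absurd (by simp [hκe]) him
      · rw [h]; exact sector_subset_compl_Sigma _ (mul_rot_mem_sector n hs h' h2)
    have hk' : k / rot n ∈ (fun κ => κ * rot n) ⁻¹' U := by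
      simpa [div_mul_cancel₀ _ hrot] using hkU
    have h1 := hrotd.differentiableAt ((hUo.preimage hmaps).mem_nhds hk')
    have h2 : DifferentiableAt ℂ ((fun κ => F (κ * rot n)) ∘ fun κ => κ / rot n) k :=
      DifferentiableAt.comp k h1 (by fun_prop)
    refine h2.congr_of_eventuallyEq (Eventually.of_forall fun κ => ?_)
    simp [div_mul_cancel₀ _ hrot]
  -- boundedness near `0`
  have hb : ∃ C : ℝ, ∀ᶠ k in 𝓝[Sigmaᶜ] (0 : ℂ), ‖f k‖ ≤ C := by
    choose a ha using h0
    obtain ⟨C, hC⟩ := ((Finset.Icc (1 : ℤ) 6).finite_toSet.image fun n => ‖a n‖ + 1).bddAbove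
    refine ⟨C, nhdsWithin_compl_Sigma_zero_le ?_⟩
    simp only [mem_iSup]
    intro n hn
    have h1 : ∀ᶠ k in 𝓝[sector n] (0 : ℂ), ‖f k‖ < ‖a n‖ + 1 :=
      (ha n).norm.eventually_lt_const (by linarith)
    filter_upwards [h1] with k hk
    exact hk.le.trans (hC (mem_image_of_mem _ hn))
  obtain ⟨C, hC⟩ := hb
  obtain ⟨V, hVsub, hVo, h0V⟩ := eventually_nhds_iff.1 (eventually_nhdsWithin_iff.1 hC)
  have hbV : ∀ k ∈ V \ {0}, ‖F k‖ ≤ C := by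
    refine norm_le_of_norm_le_off_Sigma (hVo.sdiff isClosed_singleton)
      (hcont.mono fun k hk => hk.2) (fun k hk hkS => ?_)
    rw [hFf k hkS]
    exact hVsub k hk.1 hkS
  refine ⟨Function.update F 0 (limUnder (𝓝[≠] 0) F), ?_, fun k hk => ?_⟩
  · have hloc := Complex.differentiableOn_update_limUnder_of_bddAbove (f := F) (hVo.mem_nhds h0V)
      (fun k hk => (hdiff k hk.2).differentiableWithinAt)
      ⟨C, by rintro _ ⟨k, hk, rfl⟩; exact hbV k hk⟩
    intro k
    rcases eq_or_ne k 0 with rfl | hk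
    · exact hloc.differentiableAt (hVo.mem_nhds h0V)
    · refine (hdiff k hk).congr_of_eventuallyEq ?_
      filter_upwards [isOpen_ne.mem_nhds hk] with κ hκ
      exact Function.update_of_ne hκ _ _
  · rw [Function.update_of_ne (ne_zero_of_notMem_Sigma hk), hFf k hk]

/-- Liouville's theorem with the limit at infinity known off the contour only. -/
theorem eq_const_of_tendsto_off_Sigma {g : ℂ → ℂ} (hg : Differentiable ℂ g) {c : ℂ}
    (h : Tendsto g (Bornology.cobounded ℂ ⊓ 𝓟 Sigmaᶜ) (𝓝 c)) : ∀ k, g k = c := by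
  intro k
  refine hg.apply_eq_of_tendsto_cocompact k ?_
  rw [Metric.cobounded_eq_cocompact.symm, Metric.tendsto_nhds]
  intro ε hε
  have h1 := (Metric.tendsto_nhds.1 h) (ε / 2) (by linarith)
  rw [eventually_inf_principal, ← comap_norm_atTop, eventually_comap] at h1
  obtain ⟨R, hR⟩ := eventually_atTop.1 h1
  rw [← comap_norm_atTop, eventually_comap]
  filter_upwards [eventually_gt_atTop R] with r hr κ hκ
  have hU : IsOpen {κ : ℂ | R < ‖κ‖} := isOpen_lt continuous_const continuous_norm
  have := norm_le_of_norm_le_off_Sigma hU (f := fun κ => g κ - c) (C := ε / 2)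
    (hg.continuous.sub continuous_const).continuousOn (fun κ hκ hκS => by
      have := hR _ (le_of_lt hκ) κ rfl hκS
      rw [dist_eq_norm] at this
      exact this.le) κ (by simpa [hκ] using hr)
  rw [dist_eq_norm]
  linarith

/-! ### The jump matrices -/

theorem det_jump (r₁ r₂ : ℝ → ℂ) (n : ℤ) (x t : ℝ) (k : ℂ) : (jump r₁ r₂ n x t k).det = 1 := by
  have h : ∀ a : ℂ, Complex.exp (-a) * Complex.exp a = 1 := fun a => by
    rw [← Complex.exp_add, neg_add_cancel, Complex.exp_zero]
  have h1 := h (θ 1 0 x t k)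
  have h2 := h (θ 2 0 x t k)
  have h3 := h (θ 2 1 x t k)
  unfold jump
  simp only
  split_ifs <;> simp only [Matrix.det_fin_three, Matrix.of_apply, Matrix.cons_val', Matrix.cons_val,
    Matrix.cons_val_zero, Matrix.cons_val_one, Matrix.cons_val_fin_one]
  · linear_combination (r₁ k.re * star (r₁ k.re)) * h1
  · linear_combination (r₂ (ω * k).re * star (r₂ (ω * k).re)) * h3
  · linear_combination (r₁ (ω ^ 2 * k).re * star (r₁ (ω ^ 2 * k).re)) * h2
  · linear_combination (r₂ k.re * star (r₂ k.re)) * h1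
  · linear_combination (r₁ (ω * k).re * star (r₁ (ω * k).re)) * h3
  · linear_combination (r₂ (ω ^ 2 * k).re * star (r₂ (ω ^ 2 * k).re)) * h2

/-- The diagonal matrix `exp(h · diag(l₁, l₂, l₃))`. -/
noncomputable def expL (h : ℝ) (k : ℂ) : Mat3 := Matrix.diagonal fun i => Complex.exp (l k i * h)

theorem exp_theta_shift (i j : Fin 3) (x y t : ℝ) (k : ℂ) :
    Complex.exp (θ i j x t k) * Complex.exp (l k j * (x - y : ℝ))
      = Complex.exp (l k i * (x - y : ℝ)) * Complex.exp (θ i j y t k) := by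
  rw [← Complex.exp_add, ← Complex.exp_add, θ, θ]
  congr 1; push_cast; ring

theorem exp_neg_theta_shift (i j : Fin 3) (x y t : ℝ) (k : ℂ) :
    Complex.exp (-θ i j x t k) * Complex.exp (l k i * (x - y : ℝ))
      = Complex.exp (l k j * (x - y : ℝ)) * Complex.exp (-θ i j y t k) := by
  rw [← Complex.exp_add, ← Complex.exp_add, θ, θ]
  congr 1; push_cast; ring

/-- The jump matrices at two values of `x` are conjugate by `exp((x - y) diag(l₁, l₂, l₃))`. -/
theorem expL_mul_jump (r₁ r₂ : ℝ → ℂ) (n : ℤ) (x y t : ℝ) (k : ℂ) :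
    expL (x - y) k * jump r₁ r₂ n y t k = jump r₁ r₂ n x t k * expL (x - y) k := by
  have a1 := exp_theta_shift 1 0 x y t k
  have a2 := exp_theta_shift 2 0 x y t k
  have a3 := exp_theta_shift 2 1 x y t k
  have b1 := exp_neg_theta_shift 1 0 x y t k
  have b2 := exp_neg_theta_shift 2 0 x y t k
  have b3 := exp_neg_theta_shift 2 1 x y t k
  ext i j
  rw [expL, Matrix.diagonal_mul, Matrix.mul_diagonal]
  unfold jump
  simp only
  split_ifs <;> fin_cases i <;> fin_cases j <;>
    simp only [Matrix.of_apply, Matrix.cons_val', Matrix.cons_val, Matrix.cons_val_zero,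
      Matrix.cons_val_one, Matrix.cons_val_fin_one, Fin.zero_eta, Fin.mk_one, Fin.isValue,
      Fin.reduceFinMk, mul_zero, zero_mul, mul_one, one_mul, neg_mul, mul_neg, neg_inj] <;>
    first
    | ring1
    | linear_combination (-r₁ k.re) * b1
    | linear_combination (-star (r₁ k.re)) * a1
    | linear_combination (-r₂ k.re) * a1
    | linear_combination (-star (r₂ k.re)) * b1
    | linear_combination (-r₂ (ω * k).re) * a3
    | linear_combination (-star (r₂ (ω * k).re)) * b3
    | linear_combination (-r₁ (ω * k).re) * b3
    | linear_combination (-star (r₁ (ω * k).re)) * a3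
    | linear_combination (-r₁ (ω ^ 2 * k).re) * a2
    | linear_combination (-star (r₁ (ω ^ 2 * k).re)) * b2
    | linear_combination (-r₂ (ω ^ 2 * k).re) * b2
    | linear_combination (-star (r₂ (ω ^ 2 * k).re)) * a2

theorem differentiable_expL (h : ℝ) (i j : Fin 3) : Differentiable ℂ fun k => expL h k i j := by
  unfold expL l
  fin_cases i <;> fin_cases j <;> simp [Matrix.diagonal] <;> fun_prop

/-! ### Matrix functions off the contour -/

theorem AnalyticOff.mul {F G : ℂ → Mat3} (hF : AnalyticOff F) (hG : AnalyticOff G) :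
    AnalyticOff fun k => F k * G k := fun i j => by
  simp only [Matrix.mul_apply]
  exact DifferentiableOn.fun_sum fun a _ => (hF i a).mul (hG a j)

theorem AnalyticOff.det {F : ℂ → Mat3} (hF : AnalyticOff F) :
    DifferentiableOn ℂ (fun k => (F k).det) Sigmaᶜ := by
  simp only [Matrix.det_fin_three]
  have h : ∀ i j, DifferentiableOn ℂ (fun k => F k i j) Sigmaᶜ := hF
  fun_prop

theorem AnalyticOff.adjugate {F : ℂ → Mat3} (hF : AnalyticOff F) :
    AnalyticOff fun k => (F k).adjugate := fun i j => by
  have h : ∀ i j, DifferentiableOn ℂ (fun k => F k i j) Sigmaᶜ := hF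
  simp only [Matrix.adjugate_fin_three]
  fin_cases i <;> fin_cases j <;> simp <;> fun_prop

theorem analyticOff_of_differentiable {D : ℂ → Mat3}
    (hD : ∀ i j, Differentiable ℂ fun k => D k i j) : AnalyticOff D :=
  fun i j => (hD i j).differentiableOn

theorem tendsto_matrix_iff {ι : Type*} {L : Filter ι} {F : ι → Mat3} {A : Mat3} :
    Tendsto F L (𝓝 A) ↔ ∀ i j, Tendsto (fun k => F k i j) L (𝓝 (A i j)) := by
  refine ⟨fun h i j => ((continuous_id.matrix_elem i j).tendsto A).comp h, fun h => ?_⟩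
  exact tendsto_pi_nhds.2 fun i => tendsto_pi_nhds.2 (h i)

theorem Tendsto.det {ι : Type*} {L : Filter ι} {F : ι → Mat3} {A : Mat3}
    (h : Tendsto F L (𝓝 A)) : Tendsto (fun k => (F k).det) L (𝓝 A.det) :=
  ((continuous_id (X := Mat3)).matrix_det.tendsto A).comp h

theorem Tendsto.adjugate {ι : Type*} {L : Filter ι} {F : ι → Mat3} {A : Mat3}
    (h : Tendsto F L (𝓝 A)) : Tendsto (fun k => (F k).adjugate) L (𝓝 A.adjugate) :=
  ((continuous_id (X := Mat3)).matrix_adjugate.tendsto A).comp h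

/-- If `D w = v D` with `D` entire, then `F D G⁻¹` has no jumps. Here `G⁻¹` is written as the
adjugate, since `det G = 1` in the applications. -/
theorem exists_entire_quotient {F G D : ℂ → Mat3} {v w : ℤ → ℂ → Mat3}
    (hF : AnalyticOff F) (hG : AnalyticOff G) (hD : ∀ i j, Differentiable ℂ fun k => D k i j)
    (jF : HasJumps v F) (jG : HasJumps w G) (hw : ∀ n k, (w n k).det = 1)
    (hDw : ∀ n k, D k * w n k = v n k * D k)
    (h0 : ∀ n : ℤ, ∃ A, Tendsto (fun k => F k * D k * (G k).adjugate) (𝓝[sector n] 0) (𝓝 A)) :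
    ∃ E : ℂ → Mat3, (∀ i j, Differentiable ℂ fun k => E k i j) ∧
      ∀ k ∉ Sigma, E k = F k * D k * (G k).adjugate := by
  have hDc : Continuous D := continuous_matrix fun i j => (hD i j).continuous
  have key : ∀ i j, ∃ g : ℂ → ℂ, Differentiable ℂ g ∧
      ∀ k ∉ Sigma, g k = (F k * D k * (G k).adjugate) i j := by
    intro i j
    refine exists_entire_extension
      (((hF.mul (analyticOff_of_differentiable hD)).mul hG.adjugate) i j) ?_ ?_
    · intro n hn k hk
      obtain ⟨Fp, Fm, -, -, hFl⟩ := jF n hn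
      obtain ⟨Gp, Gm, -, -, hGl⟩ := jG n hn
      obtain ⟨f1, f2, f3⟩ := hFl k hk
      obtain ⟨g1, g2, g3⟩ := hGl k hk
      have hDk : ∀ s : Set ℂ, Tendsto D (𝓝[s] k) (𝓝 (D k)) := fun s =>
        (hDc.tendsto k).mono_left nhdsWithin_le_nhds
      have e : Fp k * D k * (Gp k).adjugate = Fm k * D k * (Gm k).adjugate := by
        rw [f3, g3, Matrix.adjugate_mul_distrib, mul_assoc (Fm k), ← hDw]
        calc Fm k * (D k * w n k) * ((w n k).adjugate * (Gm k).adjugate)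
            = Fm k * D k * (w n k * (w n k).adjugate) * (Gm k).adjugate := by
              simp only [mul_assoc]
          _ = _ := by rw [Matrix.mul_adjugate, hw, one_smul, mul_one]
      refine ⟨(Fp k * D k * (Gp k).adjugate) i j, ?_, ?_⟩
      · exact tendsto_matrix_iff.1 ((f1.mul (hDk _)).mul (Tendsto.adjugate g1)) i j
      · rw [e]
        exact tendsto_matrix_iff.1 ((f2.mul (hDk _)).mul (Tendsto.adjugate g2)) i j
    · intro n
      obtain ⟨A, hA⟩ := h0 n
      exact ⟨A i j, tendsto_matrix_iff.1 hA i j⟩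
  choose g hg1 hg2 using key
  exact ⟨fun k => Matrix.of fun i j => g i j k, fun i j => hg1 i j, fun k hk => by
    ext i j; exact hg2 i j k hk⟩

/-- A matrix solution that tends to `1` at infinity and has limits at `0` has determinant `1`. -/
theorem det_eq_one_of_hasJumps {F : ℂ → Mat3} {v : ℤ → ℂ → Mat3} (hF : AnalyticOff F)
    (jF : HasJumps v F) (hv : ∀ n k, (v n k).det = 1)
    (h0 : ∀ n : ℤ, ∃ A, Tendsto F (𝓝[sector n] 0) (𝓝 A))
    (hinf : Tendsto F (Bornology.cobounded ℂ ⊓ 𝓟 Sigmaᶜ) (𝓝 1)) :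
    ∀ k ∉ Sigma, (F k).det = 1 := by
  obtain ⟨g, hg, hgF⟩ := exists_entire_extension hF.det (fun n hn k hk => by
      obtain ⟨Fp, Fm, -, -, hFl⟩ := jF n hn
      obtain ⟨f1, f2, f3⟩ := hFl k hk
      refine ⟨(Fp k).det, Tendsto.det f1, ?_⟩
      rw [f3, Matrix.det_mul, hv, mul_one]
      exact Tendsto.det f2)
    (fun n => by
      obtain ⟨A, hA⟩ := h0 n
      exact ⟨A.det, Tendsto.det hA⟩)
  intro k hk
  rw [← hgF k hk]
  refine eq_const_of_tendsto_off_Sigma hg ?_ k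
  have h1 : Tendsto (fun k => (F k).det) (Bornology.cobounded ℂ ⊓ 𝓟 Sigmaᶜ) (𝓝 1) := by
    simpa using Tendsto.det hinf
  refine h1.congr' ?_
  filter_upwards [mem_inf_of_right (mem_principal_self _)] with κ hκ
  exact (hgF κ hκ).symm

/-! ### Limits at zero and at infinity -/

/-- The filter `k → ∞`, `k ∉ Σ`. -/
noncomputable abbrev atInf : Filter ℂ := Bornology.cobounded ℂ ⊓ 𝓟 Sigmaᶜ

theorem tendsto_bisector_atInf :
    Tendsto (fun s : ℝ => (s : ℂ) * Complex.exp ((Real.pi / 6 : ℝ) * Complex.I)) atTop atInf := by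
  refine tendsto_inf.2 ⟨?_, tendsto_principal.2 ?_⟩
  · rw [← tendsto_norm_atTop_iff_cobounded]
    have : (fun s : ℝ => ‖(s : ℂ) * Complex.exp ((Real.pi / 6 : ℝ) * Complex.I)‖)
        = fun s : ℝ => |s| := by
      ext s; rw [norm_mul, Complex.norm_exp_ofReal_mul_I, mul_one, Complex.norm_real,
        Real.norm_eq_abs]
    rw [this]
    exact tendsto_abs_atTop_atTop
  · filter_upwards [eventually_gt_atTop 0] with s hs
    exact sector_subset_compl_Sigma 1 (bisector_mem_sector hs)

instance atInf_neBot : atInf.NeBot := tendsto_bisector_atInf.neBot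

theorem eventually_atInf {p : ℂ → Prop} {R : ℝ} (h : ∀ k ∉ Sigma, R ≤ ‖k‖ → p k) :
    ∀ᶠ k in atInf, p k := by
  rw [eventually_inf_principal, ← comap_norm_atTop, eventually_comap]
  filter_upwards [eventually_ge_atTop R] with r hr k hk hkS
  exact h k hkS (hk ▸ hr)

theorem tendsto_inv_norm_atInf : Tendsto (fun k : ℂ => ‖k‖⁻¹) atInf (𝓝 0) :=
  (tendsto_norm_cobounded_atTop.mono_left inf_le_left).inv_tendsto_atTop

theorem HasExpansionAtInfinity.tendsto_mul_sub {F : ℝ → ℂ → Mat3} {F₁ : ℝ → Mat3}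
    (h : HasExpansionAtInfinity F F₁) (x : ℝ) :
    Tendsto (fun k => k • (F x k - 1)) atInf (𝓝 (F₁ x)) := by
  obtain ⟨C, R, hCR⟩ := h |x|
  refine tendsto_matrix_iff.2 fun i j => ?_
  rw [tendsto_iff_norm_sub_tendsto_zero]
  have hlim : Tendsto (fun k : ℂ => C * ‖k‖⁻¹) atInf (𝓝 0) := by
    simpa using tendsto_inv_norm_atInf.const_mul C
  refine squeeze_zero' (Eventually.of_forall fun _ => norm_nonneg _) ?_ hlim
  refine eventually_atInf (R := R) fun k hk hkR => ?_
  have hk0 := ne_zero_of_notMem_Sigma hk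
  have hkn : 0 < ‖k‖ := norm_pos_iff.2 hk0
  have h1 := hCR x le_rfl k hk hkR i j
  have e : (k • (F x k - 1)) i j - F₁ x i j = k * (F x k - 1 - k⁻¹ • F₁ x) i j := by
    simp only [Matrix.smul_apply, Matrix.sub_apply, smul_eq_mul]
    field_simp
  rw [e, norm_mul]
  calc ‖k‖ * _ ≤ ‖k‖ * (C / ‖k‖ ^ 2) := by gcongr
    _ = C * ‖k‖⁻¹ := by field_simp

theorem HasExpansionAtInfinity.tendsto_one {F : ℝ → ℂ → Mat3} {F₁ : ℝ → Mat3}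
    (h : HasExpansionAtInfinity F F₁) (x : ℝ) : Tendsto (F x) atInf (𝓝 1) := by
  have h1 := h.tendsto_mul_sub x
  have h2 : Tendsto (fun k : ℂ => k⁻¹) atInf (𝓝 0) :=
    tendsto_inv₀_cobounded.mono_left inf_le_left
  have h3 := (h2.smul h1).add_const (1 : Mat3)
  rw [zero_smul, zero_add] at h3
  refine h3.congr' ?_
  filter_upwards [mem_inf_of_right (mem_principal_self _)] with k hk
  rw [smul_smul, inv_mul_cancel₀ (ne_zero_of_notMem_Sigma hk), one_smul, sub_add_cancel]

theorem HasExpansionAtZero.tendsto {d : ℕ} {n : ℤ} {F : ℂ → Mat3} {c : ℕ → Mat3}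
    (h : HasExpansionAtZero d n F c) :
    Tendsto (fun k => k ^ d • F k) (𝓝[sector n] 0) (𝓝 (c 0)) := by
  refine tendsto_matrix_iff.2 fun i j => ?_
  have h1 := (isBigO_refl (fun k : ℂ => k ^ d) (𝓝[sector n] 0)).mul (h 0 i j)
  have hk0 : ∀ᶠ k in 𝓝[sector n] (0 : ℂ), k ≠ 0 := by
    filter_upwards [self_mem_nhdsWithin] with k hk
    exact ne_zero_of_notMem_Sigma (sector_subset_compl_Sigma n hk)
  have h2 : (fun k : ℂ => (k ^ d • F k) i j - c 0 i j) =O[𝓝[sector n] 0] fun k : ℂ => k := by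
    refine h1.congr' ?_ ?_
    · filter_upwards [hk0] with k hk
      simp only [Finset.sum_range_one, zero_add, Nat.cast_zero, Matrix.sub_apply,
        Matrix.smul_apply, smul_eq_mul, zero_sub, zpow_neg, zpow_natCast, mul_sub]
      rw [mul_inv_cancel_left₀ (pow_ne_zero d hk)]
    · filter_upwards [hk0] with k hk
      rw [← zpow_natCast, ← zpow_add₀ hk]
      simp
  have h3 : Tendsto (fun k : ℂ => k) (𝓝[sector n] 0) (𝓝 0) := nhdsWithin_le_nhds
  have h4 := (h2.trans_tendsto h3).add_const (c 0 i j)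
  simpa using h4

/-- The coefficient of `1/k` in the modified Sawada-Kotera Riemann-Hilbert problem. -/
noncomputable def mskCoeff (w : ℝ → ℝ → ℝ) (t x : ℝ) : Mat3 :=
  ((w x t : ℂ) / 3) • !![0, ω, 1; ω ^ 2, 0, 1; ω ^ 2, ω, 0]
    + (((-∫ y in Ioi x, w y t ^ 2 : ℝ) : ℂ) / 3) • !![ω ^ 2, 0, 0; 0, ω, 0; 0, 0, 1]

section msk

variable {r₁ r₂ : ℝ → ℂ} {w : ℝ → ℝ → ℝ} {m : ℝ → ℝ → ℂ → Mat3}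

theorem SolvesRHmSK.exists_tendsto_zero (hm : SolvesRHmSK r₁ r₂ w m) (x : ℝ) {t : ℝ} (ht : 0 ≤ t)
    (n : ℤ) : ∃ A, Tendsto (m x t) (𝓝[sector n] 0) (𝓝 A) := by
  obtain ⟨c, hc⟩ := hm.zero x t ht n
  exact ⟨c 0, by simpa using hc.tendsto⟩

theorem SolvesRHmSK.infinity' (hm : SolvesRHmSK r₁ r₂ w m) {t : ℝ} (ht : 0 ≤ t) :
    HasExpansionAtInfinity (fun x => m x t) (mskCoeff w t) := hm.infinity t ht

theorem SolvesRHmSK.det_eq_one (hm : SolvesRHmSK r₁ r₂ w m) (x : ℝ) {t : ℝ} (ht : 0 ≤ t) {k : ℂ}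
    (hk : k ∉ Sigma) : (m x t k).det = 1 :=
  det_eq_one_of_hasJumps (hm.analytic x t ht) (hm.jumps x t ht) (fun _ _ => det_jump ..)
    (hm.exists_tendsto_zero x ht) ((hm.infinity' ht).tendsto_one x) k hk

theorem SolvesRHmSK.adjugate_mul (hm : SolvesRHmSK r₁ r₂ w m) (x : ℝ) {t : ℝ} (ht : 0 ≤ t) {k : ℂ}
    (hk : k ∉ Sigma) : (m x t k).adjugate * m x t k = 1 := by
  rw [Matrix.adjugate_mul, hm.det_eq_one x ht hk, one_smul]

theorem SolvesRHmSK.mul_adjugate (hm : SolvesRHmSK r₁ r₂ w m) (x : ℝ) {t : ℝ} (ht : 0 ≤ t) {k : ℂ}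
    (hk : k ∉ Sigma) : m x t k * (m x t k).adjugate = 1 := by
  rw [Matrix.mul_adjugate, hm.det_eq_one x ht hk, one_smul]

/-! ### Uniqueness for the Sawada-Kotera problem -/

/-- The heart of uniqueness: `k M m⁻¹` is entire and equals `k + C` at infinity. Its value `C` at
`0` has equal rows, because the residue of `M` in `Ω₁` has, and this determines `C` from its
off-diagonal part, which is that of `-m_∞⁽¹⁾`. -/
theorem SolvesRHSK.eq_and_integral_eq {u : ℝ → ℝ → ℝ} {M : ℝ → ℝ → ℂ → Mat3}
    (hM : SolvesRHSK r₁ r₂ u M) (hm : SolvesRHmSK r₁ r₂ w m) (x : ℝ) {t : ℝ} (ht : 0 ≤ t) :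
    (∀ k ∉ Sigma, M x t k = miuraTransform w m x t k) ∧
      ∫ y in Ioi x, 2 * u y t = -(w x t) / 3 - (∫ y in Ioi x, w y t ^ 2) / 3 := by
  obtain ⟨a, -, ha⟩ := hM.zero
  have hlimM : ∀ n : ℤ, ∃ c : Mat3, Tendsto (fun k => k • M x t k) (𝓝[sector n] 0) (𝓝 c) ∧
      (n = 1 → c = (a x t : ℂ) • !![ω ^ 2, 0, 0; ω ^ 2, 0, 0; ω ^ 2, 0, 0]) := fun n => by
    obtain ⟨c, hc, hc1⟩ := ha x t ht n
    exact ⟨c 0, by simpa using hc.tendsto, hc1⟩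
  have hlim : ∀ n : ℤ, ∃ c P : Mat3, Tendsto (fun k => M x t k * (k • (1 : Mat3))
        * (m x t k).adjugate) (𝓝[sector n] 0) (𝓝 (c * P)) ∧
      (n = 1 → c = (a x t : ℂ) • !![ω ^ 2, 0, 0; ω ^ 2, 0, 0; ω ^ 2, 0, 0]) := fun n => by
    obtain ⟨c, hc, hc1⟩ := hlimM n
    obtain ⟨P, hP⟩ := hm.exists_tendsto_zero x ht n
    refine ⟨c, P.adjugate, ?_, hc1⟩
    simpa using hc.mul (Tendsto.adjugate hP)
  obtain ⟨E, hE, hEM⟩ := exists_entire_quotient (hM.analytic x t ht) (hm.analytic x t ht)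
    (D := fun k => k • 1)
    (fun i j => by simp only [Matrix.smul_apply, smul_eq_mul]; fun_prop)
    (hM.jumps x t ht) (hm.jumps x t ht) (fun _ _ => det_jump ..)
    (fun n k => by rw [smul_mul_assoc, mul_smul_comm, one_mul, mul_one])
    (fun n => by
      obtain ⟨c, P, h, -⟩ := hlim n
      exact ⟨_, h⟩)
  set d : ℂ := ((∫ y in Ioi x, 2 * u y t : ℝ) : ℂ) with hd
  set g : ℂ := (((-∫ y in Ioi x, w y t ^ 2 : ℝ) : ℂ) / 3) with hg
  set C : Mat3 := d • !![ω ^ 2, 0, 0; 0, ω, 0; 0, 0, 1] - mskCoeff w t x with hC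
  -- the expansion at infinity
  have hinf : Tendsto (fun k => E k - k • 1) atInf (𝓝 C) := by
    have h1 := (hM.infinity t ht).tendsto_mul_sub x
    have h2 := (hm.infinity' ht).tendsto_mul_sub x
    have h3 : Tendsto (fun k => (m x t k).adjugate) atInf (𝓝 1) := by
      simpa using Tendsto.adjugate ((hm.infinity' ht).tendsto_one x)
    have h4 := (h1.mul h3).sub (h2.mul h3)
    rw [mul_one, mul_one] at h4
    refine h4.congr' ?_
    filter_upwards [mem_inf_of_right (mem_principal_self _)] with k hk
    rw [hEM k hk, ← sub_mul, ← smul_sub, sub_sub_sub_cancel_right, smul_mul_assoc, sub_mul,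
      hm.mul_adjugate x ht hk, smul_sub, mul_smul_comm, mul_one, smul_mul_assoc]
  have hEC : ∀ k, E k = k • 1 + C := fun k => by
    ext i j
    have := eq_const_of_tendsto_off_Sigma (g := fun k => (E k - k • 1) i j) (c := C i j)
      (by
        simp only [Matrix.sub_apply, Matrix.smul_apply, smul_eq_mul]
        exact (hE i j).sub (by fun_prop)) (tendsto_matrix_iff.1 hinf i j) k
    rw [Matrix.add_apply, ← this, Matrix.sub_apply, add_sub_cancel]
  -- the value at zero has equal rows
  obtain ⟨c, P, hcP, hc⟩ := hlim 1
  have hC0 : C = c * P := by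
    have hEc : Continuous E := continuous_matrix fun i j => (hE i j).continuous
    have h1 : Tendsto E (𝓝[sector 1] 0) (𝓝 C) := by
      have := (hEc.tendsto 0).mono_left (nhdsWithin_le_nhds (s := sector 1))
      rwa [hEC 0, zero_smul, zero_add] at this
    have := neBot_nhdsWithin_sector_zero 1
    refine tendsto_nhds_unique (h1.congr' ?_) hcP
    filter_upwards [self_mem_nhdsWithin] with k hk
    exact hEM k (sector_subset_compl_Sigma 1 hk)
  have hrow : C 0 1 = C 1 1 := by
    rw [hC0, hc rfl]
    simp [Matrix.mul_apply, Fin.sum_univ_three]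
  have hdg : d = -(w x t : ℂ) / 3 + g := by
    have h1 : C 0 1 = -((w x t : ℂ) / 3 * ω) := by simp [hC, mskCoeff]
    have h2 : C 1 1 = d * ω - g * ω := by simp [hC, mskCoeff, hg]
    rw [h1, h2] at hrow
    exact mul_right_cancel₀ omega_ne_zero (by linear_combination -hrow)
  have hCA : C = miuraMatrix (w x t) := by
    have : mskCoeff w t x = ((w x t : ℂ) / 3) • !![0, ω, 1; ω ^ 2, 0, 1; ω ^ 2, ω, 0]
      + g • !![ω ^ 2, 0, 0; 0, ω, 0; 0, 0, 1] := rfl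
    rw [hC, this, miuraMatrix, hdg]
    ext i j
    fin_cases i <;> fin_cases j <;> simp <;> ring
  refine ⟨fun k hk => ?_, ?_⟩
  · have hk0 := ne_zero_of_notMem_Sigma hk
    have h1 := hEM k hk
    rw [hEC k, hCA] at h1
    have h2 : (k • 1 + miuraMatrix (w x t)) * m x t k = k • M x t k := by
      rw [h1, mul_assoc, hm.adjugate_mul x ht hk, mul_one, mul_smul_comm, mul_one]
    have h3 := congrArg (fun A : Mat3 => k⁻¹ • A) h2
    rw [← smul_mul_assoc, smul_add, smul_smul, smul_smul, inv_mul_cancel₀ hk0, one_smul,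
      one_smul] at h3
    exact h3.symm
  · have h1 : ((∫ y in Ioi x, 2 * u y t : ℝ) : ℂ)
        = ((-(w x t) / 3 - (∫ y in Ioi x, w y t ^ 2) / 3 : ℝ) : ℂ) := by
      rw [← hd, hdg, hg]
      push_cast
      ring
    exact_mod_cast h1

end msk

/-! ### Improper integrals of rapidly decreasing functions -/

theorem RapidlyDecreasing.integrableOn {f : ℝ → ℝ} (hf : RapidlyDecreasing f) (hc : Continuous f)
    (x : ℝ) : IntegrableOn f (Ioi x) := by
  have hg : IntegrableAtFilter (fun y : ℝ => (y ^ 2)⁻¹) atTop := by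
    refine ⟨Ioi 1, Ioi_mem_atTop 1, ?_⟩
    refine (integrableOn_Ioi_rpow_of_lt (a := -2) (by norm_num) one_pos).congr_fun
      (fun y hy => ?_) measurableSet_Ioi
    have hy' : (0 : ℝ) < y := one_pos.trans hy
    simp [Real.rpow_neg hy'.le]
  exact (((hc.locallyIntegrable (μ := volume)).locallyIntegrableOn
    (Ici x)).integrableOn_of_isBigO_atTop (hf 2) hg).mono_set Ioi_subset_Ici_self

theorem hasDerivAt_integral_Ioi {f : ℝ → ℝ} (hc : Continuous f)
    (hi : ∀ x, IntegrableOn f (Ioi x)) (x : ℝ) :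
    HasDerivAt (fun x => ∫ y in Ioi x, f y) (-f x) x := by
  have h : (fun x => ∫ y in Ioi x, f y) = fun x => (∫ y in Ioi 0, f y) - ∫ y in (0 : ℝ)..x, f y := by
    ext z
    rw [← intervalIntegral.integral_Ioi_sub_Ioi' (hi 0) (hi z)]
    ring
  rw [h]
  exact (intervalIntegral.integral_hasDerivAt_right (hc.intervalIntegrable _ _)
    hc.stronglyMeasurable.stronglyMeasurableAtFilter hc.continuousAt).const_sub _

theorem RapidlyDecreasing.tendsto_zero {f : ℝ → ℝ} (hf : RapidlyDecreasing f) :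
    Tendsto f atTop (𝓝 0) := by
  have h := hf 1
  simp only [pow_one] at h
  exact h.trans_tendsto tendsto_inv_atTop_zero

theorem hasDerivAt_Dx {w : ℝ → ℝ → ℝ} {t : ℝ} (hw : ContDiff ℝ (⊤ : ℕ∞) fun x => w x t) (j : ℕ)
    (x : ℝ) : HasDerivAt (fun y => Dx j w y t) (Dx (j + 1) w x t) x := by
  unfold Dx
  rw [iteratedDeriv_succ]
  exact (hw.differentiable_iteratedDeriv j (by exact_mod_cast ENat.natCast_lt_top j) x).hasDerivAt

theorem Dx_zero (w : ℝ → ℝ → ℝ) (x t : ℝ) : Dx 0 w x t = w x t := by simp [Dx]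

theorem Dx_succ_eq {f g : ℝ → ℝ → ℝ} {t : ℝ} {j : ℕ} (h : ∀ y, Dx j f y t = g y t)
    {x g' : ℝ} (hg : HasDerivAt (fun y => g y t) g' x) : Dx (j + 1) f x t = g' := by
  unfold Dx at h ⊢
  rw [iteratedDeriv_succ, funext h]
  exact hg.deriv

/-! ### The Miura transformation of solutions of the differential equations -/

section halfPlane

/-- The closed half plane `ℝ × [0, ∞)`. -/
def halfPlane : Set (ℝ × ℝ) := univ ×ˢ Ici 0

theorem uniqueDiffOn_halfPlane : UniqueDiffOn ℝ halfPlane :=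
  uniqueDiffOn_univ.prod (uniqueDiffOn_Ici 0)

theorem halfPlane_subset_closure_interior : halfPlane ⊆ closure (interior halfPlane) := by
  rw [halfPlane, interior_prod_eq, closure_prod_eq, interior_univ, closure_univ, interior_Ici,
    closure_Ioi]

theorem mk_mem_halfPlane {x t : ℝ} (ht : 0 ≤ t) : (x, t) ∈ halfPlane := ⟨mem_univ _, ht⟩

variable {f : ℝ × ℝ → ℝ}

theorem hasDerivAt_fst (hf : DifferentiableOn ℝ f halfPlane) {x t : ℝ} (ht : 0 ≤ t) :
    HasDerivAt (fun y => f (y, t)) (fderivWithin ℝ f halfPlane (x, t) (1, 0)) x := by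
  have h1 : HasDerivAt (fun y : ℝ => (y, t)) ((1 : ℝ), (0 : ℝ)) x :=
    (hasDerivAt_id x).prodMk (hasDerivAt_const x t)
  exact (hf (x, t) (mk_mem_halfPlane ht)).hasFDerivWithinAt.comp_hasDerivAt x h1
    (Eventually.of_forall fun _ => mk_mem_halfPlane ht)

theorem hasDerivWithinAt_snd (hf : DifferentiableOn ℝ f halfPlane) {x t : ℝ} (ht : 0 ≤ t) :
    HasDerivWithinAt (fun s => f (x, s)) (fderivWithin ℝ f halfPlane (x, t) (0, 1)) (Ici 0) t := by
  have h1 : HasDerivWithinAt (fun s : ℝ => (x, s)) ((0 : ℝ), (1 : ℝ)) (Ici 0) t :=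
    ((hasDerivAt_const t x).prodMk (hasDerivAt_id t)).hasDerivWithinAt
  exact (hf (x, t) (mk_mem_halfPlane ht)).hasFDerivWithinAt.comp_hasDerivWithinAt t h1
    (fun _ hs => mk_mem_halfPlane hs)

theorem contDiffOn_fderivWithin_apply (hf : ContDiffOn ℝ (⊤ : ℕ∞) f halfPlane) (v : ℝ × ℝ) :
    ContDiffOn ℝ (⊤ : ℕ∞) (fun q => fderivWithin ℝ f halfPlane q v) halfPlane :=
  (hf.fderivWithin uniqueDiffOn_halfPlane (by simp)).clm_apply contDiffOn_const

theorem fderivWithin_fderivWithin_comm (hf : ContDiffOn ℝ (⊤ : ℕ∞) f halfPlane) {q : ℝ × ℝ}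
    (hq : q ∈ halfPlane) (u v : ℝ × ℝ) :
    fderivWithin ℝ (fun q => fderivWithin ℝ f halfPlane q u) halfPlane q v
      = fderivWithin ℝ (fun q => fderivWithin ℝ f halfPlane q v) halfPlane q u := by
  have hd : DifferentiableWithinAt ℝ (fderivWithin ℝ f halfPlane) halfPlane q :=
    (hf.fderivWithin uniqueDiffOn_halfPlane (m := (⊤ : ℕ∞)) (by simp)).differentiableOn (by simp) q hq
  have key : ∀ u v : ℝ × ℝ, fderivWithin ℝ (fun q => fderivWithin ℝ f halfPlane q u) halfPlane q v
      = fderivWithin ℝ (fderivWithin ℝ f halfPlane) halfPlane q v u := by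
    intro u v
    have := (hd.hasFDerivWithinAt.clm_apply (hasFDerivWithinAt_const u q halfPlane)).fderivWithin
      (uniqueDiffOn_halfPlane q hq)
    rw [this]
    simp
  rw [key, key]
  exact (hf q hq).isSymmSndFDerivWithinAt (by simp; exact WithTop.coe_le_coe.2 le_top) uniqueDiffOn_halfPlane
    (halfPlane_subset_closure_interior hq) hq v u

end halfPlane

/-- If `w` solves the modified Sawada-Kotera equation, then `u = (w_x - w²)/6` solves the
Sawada-Kotera equation. With `w_t` and `w_{xt} = w_{tx}` eliminated by means of the equation for
`w`, this is an identity between polynomials in `w, w_x, …, w_{xxxxxx}`. -/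
theorem SolvesmSK.solvesSK {w u : ℝ → ℝ → ℝ} (hw : SolvesmSK w)
    (hu : ∀ x t : ℝ, 0 ≤ t → u x t = (1 / 6) * (Dx 1 w x t - w x t ^ 2)) : SolvesSK u := by
  obtain ⟨hs, heq⟩ := hw
  set f : ℝ × ℝ → ℝ := fun q => w q.1 q.2 with hf
  have hs' : ContDiffOn ℝ (⊤ : ℕ∞) f halfPlane := hs
  have hfd : DifferentiableOn ℝ f halfPlane := hs'.differentiableOn (by simp)
  set g₁ : ℝ × ℝ → ℝ := fun q => fderivWithin ℝ f halfPlane q (1, 0) with hg₁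
  set g₂ : ℝ × ℝ → ℝ := fun q => fderivWithin ℝ f halfPlane q (0, 1) with hg₂
  have hg₁s : ContDiffOn ℝ (⊤ : ℕ∞) g₁ halfPlane := contDiffOn_fderivWithin_apply hs' _
  have hg₂s : ContDiffOn ℝ (⊤ : ℕ∞) g₂ halfPlane := contDiffOn_fderivWithin_apply hs' _
  have hD1 : ∀ x t : ℝ, 0 ≤ t → Dx 1 w x t = g₁ (x, t) := fun x t ht => by
    rw [Dx, iteratedDeriv_one]
    exact (hasDerivAt_fst hfd ht).deriv
  have hDt : ∀ x t : ℝ, 0 ≤ t → Dt w x t = g₂ (x, t) := fun x t ht =>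
    (hasDerivWithinAt_snd hfd ht).derivWithin (uniqueDiffOn_Ici 0 t ht)
  have hslice : ∀ t : ℝ, 0 ≤ t → ContDiff ℝ (⊤ : ℕ∞) fun x => w x t := fun t ht => by
    rw [← contDiffOn_univ]
    exact hs'.comp (contDiff_id.prodMk contDiff_const).contDiffOn
      (fun _ _ => mk_mem_halfPlane ht)
  refine ⟨?_, fun x t ht => ?_⟩
  · have h1 : ContDiffOn ℝ (⊤ : ℕ∞) (fun q => (1 / 6) * (g₁ q - f q ^ 2)) halfPlane :=
      contDiffOn_const.mul (hg₁s.sub (hs'.pow 2))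
    refine h1.congr fun q hq => ?_
    rw [hu q.1 q.2 hq.2, hD1 q.1 q.2 hq.2]
  -- the `x`-derivatives of `w` at time `t`
  set W : ℕ → ℝ → ℝ := fun j y => Dx j w y t with hW
  have hW' : ∀ j y, HasDerivAt (W j) (W (j + 1) y) y := fun j y => hasDerivAt_Dx (hslice t ht) j y
  have hW0 : ∀ y, w y t = W 0 y := fun y => (Dx_zero w y t).symm
  have u0 : ∀ y, Dx 0 u y t = (1 / 6) * (W 1 y - W 0 y ^ 2) := fun y => by
    rw [Dx_zero, hu y t ht, hW0]
  have u1 : ∀ y, Dx 1 u y t = (1 / 6) * (W 2 y - 2 * W 0 y * W 1 y) := fun y => by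
    refine Dx_succ_eq (g := fun y _ => _) u0 ?_
    convert! ((hW' 1 y).sub ((hW' 0 y).pow 2)).const_mul (1 / 6 : ℝ) using 1
    simp
  have u2 : ∀ y, Dx 2 u y t = (1 / 6) * (W 3 y - 2 * W 1 y ^ 2 - 2 * W 0 y * W 2 y) := fun y => by
    refine Dx_succ_eq (g := fun y _ => _) u1 ?_
    convert! ((hW' 2 y).sub (((hW' 0 y).const_mul 2).mul (hW' 1 y))).const_mul (1 / 6 : ℝ) using 1
    ring
  have u3 : ∀ y, Dx 3 u y t = (1 / 6) * (W 4 y - 6 * W 1 y * W 2 y - 2 * W 0 y * W 3 y) :=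
    fun y => by
    refine Dx_succ_eq (g := fun y _ => _) u2 ?_
    convert! (((hW' 3 y).sub (((hW' 1 y).pow 2).const_mul 2)).sub
      (((hW' 0 y).const_mul 2).mul (hW' 2 y))).const_mul (1 / 6 : ℝ) using 1
    simp; ring
  have u4 : ∀ y, Dx 4 u y t
      = (1 / 6) * (W 5 y - 6 * W 2 y ^ 2 - 8 * W 1 y * W 3 y - 2 * W 0 y * W 4 y) := fun y => by
    refine Dx_succ_eq (g := fun y _ => _) u3 ?_
    convert! (((hW' 4 y).sub (((hW' 1 y).const_mul 6).mul (hW' 2 y))).sub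
      (((hW' 0 y).const_mul 2).mul (hW' 3 y))).const_mul (1 / 6 : ℝ) using 1
    ring
  have u5 : ∀ y, Dx 5 u y t
      = (1 / 6) * (W 6 y - 20 * W 2 y * W 3 y - 10 * W 1 y * W 4 y - 2 * W 0 y * W 5 y) :=
    fun y => by
    refine Dx_succ_eq (g := fun y _ => _) u4 ?_
    convert! ((((hW' 5 y).sub (((hW' 2 y).pow 2).const_mul 6)).sub
      (((hW' 1 y).const_mul 8).mul (hW' 3 y))).sub
      (((hW' 0 y).const_mul 2).mul (hW' 4 y))).const_mul (1 / 6 : ℝ) using 1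
    simp; ring
  have wt : ∀ y, Dt w y t = -W 5 y + 5 * (W 2 y ^ 2 + W 1 y * W 3 y)
      + 5 * (W 1 y ^ 3 + 4 * W 0 y * W 1 y * W 2 y + W 0 y ^ 2 * W 3 y)
      - 5 * W 0 y ^ 4 * W 1 y := fun y => by
    have h1 := heq y t ht
    have h2 : Dx 1 (fun y s => 5 * Dx 1 w y s * Dx 2 w y s + 5 * w y s * Dx 1 w y s ^ 2
          + 5 * w y s ^ 2 * Dx 2 w y s - w y s ^ 5) y t
        = 5 * (W 2 y ^ 2 + W 1 y * W 3 y)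
          + 5 * (W 1 y ^ 3 + 4 * W 0 y * W 1 y * W 2 y + W 0 y ^ 2 * W 3 y)
          - 5 * W 0 y ^ 4 * W 1 y := by
      refine Dx_succ_eq (j := 0) (g := fun y _ => 5 * W 1 y * W 2 y + 5 * W 0 y * W 1 y ^ 2
          + 5 * W 0 y ^ 2 * W 2 y - W 0 y ^ 5) (fun y => ?_) ?_
      · rw [Dx_zero]
        simp only [hW0, hW]
      · convert! ((((((hW' 1 y).const_mul 5).mul (hW' 2 y)).add
          (((hW' 0 y).const_mul 5).mul ((hW' 1 y).pow 2))).add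
          ((((hW' 0 y).pow 2).const_mul 5).mul (hW' 2 y))).sub ((hW' 0 y).pow 5)) using 1
        simp; ring
    rw [h2] at h1
    have h5 : Dx 5 w y t = W 5 y := rfl
    linear_combination h1 - h5
  have wtx : HasDerivAt (fun y => Dt w y t) (-W 6 x + 5 * (3 * W 2 x * W 3 x + W 1 x * W 4 x)
      + 5 * (7 * W 1 x ^ 2 * W 2 x + 4 * W 0 x * W 2 x ^ 2 + 6 * W 0 x * W 1 x * W 3 x
        + W 0 x ^ 2 * W 4 x)
      - 20 * W 0 x ^ 3 * W 1 x ^ 2 - 5 * W 0 x ^ 4 * W 2 x) x := by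
    rw [funext wt]
    convert! (((hW' 5 x).neg.add (((((hW' 2 x).pow 2).add ((hW' 1 x).mul (hW' 3 x)))).const_mul 5)).add
      (((((hW' 1 x).pow 3).add ((((hW' 0 x).const_mul 4).mul (hW' 1 x)).mul (hW' 2 x))).add
        (((hW' 0 x).pow 2).mul (hW' 3 x))).const_mul 5)).sub
      ((((hW' 0 x).pow 4).const_mul 5).mul (hW' 1 x)) using 1
    simp; ring
  have ut : Dt u x t = (1 / 6) * (deriv (fun y => Dt w y t) x - 2 * w x t * Dt w x t) := by
    have e1 : deriv (fun y => Dt w y t) x = fderivWithin ℝ g₁ halfPlane (x, t) (0, 1) := by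
      rw [funext fun y => hDt y t ht,
        (hasDerivAt_fst (hg₂s.differentiableOn (by simp)) ht).deriv]
      exact fderivWithin_fderivWithin_comm hs' (mk_mem_halfPlane ht) _ _
    have h1 := ((hasDerivWithinAt_snd (x := x) (hg₁s.differentiableOn (by simp)) ht).sub
      ((hasDerivWithinAt_snd (x := x) hfd ht).pow 2)).const_mul (1 / 6 : ℝ)
    have h2 := (h1.congr (f₁ := u x) (fun s hs => by
      rw [hu x s hs, hD1 x s hs]; rfl) (by
      rw [hu x t ht, hD1 x t ht]; rfl)).derivWithin (uniqueDiffOn_Ici 0 t ht)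
    rw [Dt, h2, e1, hDt x t ht]
    simp [hf, hg₂]
  have ux0 : u x t = (1 / 6) * (W 1 x - W 0 x ^ 2) := by rw [← u0, Dx_zero]
  rw [ut, wtx.deriv, wt, u5, u3, u2, u1, ux0, hW0]
  ring

/-! ### The potential of the Sawada-Kotera problem -/

section potential

variable {r₁ r₂ : ℝ → ℂ} {w : ℝ → ℝ → ℝ} {m : ℝ → ℝ → ℂ → Mat3}

theorem SolvesRHSK.isRecoveredFrom {u : ℝ → ℝ → ℝ} {M : ℝ → ℝ → ℂ → Mat3}
    (hM : SolvesRHSK r₁ r₂ u M) : IsRecoveredFrom M u := by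
  intro t ht
  refine ⟨fun x => ((∫ y in Ioi x, 2 * u y t : ℝ) : ℂ), fun x => ?_, fun x => ?_⟩
  · have := tendsto_matrix_iff.1 ((hM.infinity t ht).tendsto_mul_sub x) 2 2
    simpa using this
  · have h := hasDerivAt_integral_Ioi (f := fun y => 2 * u y t)
      (continuous_const.mul (hM.continuous t ht))
      (fun x => (hM.integrable x t ht).const_mul 2) x
    refine ⟨_, h.ofReal_comp, ?_⟩
    push_cast
    ring

theorem SolvesRHSK.eq_miura {u : ℝ → ℝ → ℝ} {M : ℝ → ℝ → ℂ → Mat3}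
    (hM : SolvesRHSK r₁ r₂ u M) (hm : SolvesRHmSK r₁ r₂ w m) {t : ℝ} (ht : 0 ≤ t)
    (hw : ContDiff ℝ (⊤ : ℕ∞) fun x => w x t) (x : ℝ) :
    u x t = (1 / 6) * (Dx 1 w x t - w x t ^ 2) := by
  have h1 := hasDerivAt_integral_Ioi (f := fun y => 2 * u y t)
      (continuous_const.mul (hM.continuous t ht))
      (fun x => (hM.integrable x t ht).const_mul 2) x
  have h2 := hasDerivAt_integral_Ioi (f := fun y => w y t ^ 2) (hw.continuous.pow 2)
      (fun x => hm.integrable x t ht) x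
  have h3 : HasDerivAt (fun y => w y t) (Dx 1 w x t) x := by
    have := hasDerivAt_Dx hw 0 x
    simpa only [Dx_zero] using this
  have h4 := (h3.neg.div_const 3).sub (h2.div_const 3)
  rw [funext fun y => (hM.eq_and_integral_eq hm y ht).2] at h1
  have := h1.unique h4
  linarith

end potential

/-! ### The value at zero -/

/-- One-sided boundary values inherit the limit at `0` of the function. -/
theorem tendsto_boundary_value_zero {F Fb : ℂ → Mat3} {P : Mat3} {S T : Set ℂ}
    (hF : Tendsto F (𝓝[S] 0) (𝓝 P)) (h : ∀ k ∈ T, Tendsto F (𝓝[S] k) (𝓝 (Fb k)))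
    (hne : ∀ k ∈ T, (𝓝[S] k).NeBot) : Tendsto Fb (𝓝[T] 0) (𝓝 P) := by
  refine (closed_nhds_basis P).tendsto_right_iff.2 ?_
  rintro V ⟨hV, hVc⟩
  obtain ⟨U, hU, hUo, h0⟩ := eventually_nhds_iff.1 (eventually_nhdsWithin_iff.1 (hF hV))
  filter_upwards [self_mem_nhdsWithin, nhdsWithin_le_nhds (hUo.mem_nhds h0)] with k hkT hkU
  have := hne k hkT
  refine hVc.mem_of_tendsto (h k hkT) ?_
  filter_upwards [self_mem_nhdsWithin, nhdsWithin_le_nhds (hUo.mem_nhds hkU)] with κ h1 h2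
  exact hU κ h2 h1

theorem IsReflectionPair.tendsto₁ {r₁ r₂ : ℝ → ℂ} (hr : IsReflectionPair r₁ r₂) :
    Tendsto r₁ (𝓝[>] 0) (𝓝 (ω ^ 2)) := by
  obtain ⟨c, hc, h⟩ := hr.zero₁
  have h1 := h 0
  simp only [zero_add, Finset.sum_range_one, pow_zero, mul_one, pow_one, hc] at h1
  have h2 : Tendsto (fun k : ℝ => k) (𝓝[>] 0) (𝓝 0) := nhdsWithin_le_nhds
  have h3 := (h1.trans_tendsto h2).add_const (ω ^ 2)
  rw [zero_add] at h3
  exact h3.congr fun k => by ring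

theorem IsReflectionPair.tendsto₂ {r₁ r₂ : ℝ → ℂ} (hr : IsReflectionPair r₁ r₂) :
    Tendsto r₂ (𝓝[<] 0) (𝓝 1) := by
  obtain ⟨c, hc, h⟩ := hr.zero₂
  have h1 := h 0
  simp only [zero_add, Finset.sum_range_one, pow_zero, mul_one, pow_one, hc] at h1
  have h2 : Tendsto (fun k : ℝ => k) (𝓝[<] 0) (𝓝 0) := nhdsWithin_le_nhds
  simpa only [sub_add_cancel, zero_add] using (h1.trans_tendsto h2).add_const 1

theorem tendsto_exp_theta_zero (i j : Fin 3) (x t : ℝ) (s : Set ℂ) :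
    Tendsto (fun k => Complex.exp (θ i j x t k)) (𝓝[s] 0) (𝓝 1) := by
  have h : Continuous fun k => Complex.exp (θ i j x t k) := by
    unfold θ l z
    fin_cases i <;> fin_cases j <;> simp <;> fun_prop
  have h0 : Complex.exp (θ i j x t 0) = 1 := by
    unfold θ l z
    fin_cases i <;> fin_cases j <;> simp
  simpa [h0] using (h.tendsto 0).mono_left (nhdsWithin_le_nhds (s := s))

theorem tendsto_exp_neg_theta_zero (i j : Fin 3) (x t : ℝ) (s : Set ℂ) :
    Tendsto (fun k => Complex.exp (-θ i j x t k)) (𝓝[s] 0) (𝓝 1) := by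
  have := (tendsto_exp_theta_zero i j x t s).inv₀ one_ne_zero
  simpa [Complex.exp_neg] using this

/-- If `a k` is real on the `n`-th ray with sign `ε`, then `(a k).re → 0` with this sign. -/
theorem tendsto_re_ray {n : ℤ} {a : ℂ} {ε : ℝ} (h : a * rot n = ε) :
    Tendsto (fun k => (a * k).re) (𝓝[ray n] 0) (𝓝 0) ∧
      ∀ k ∈ ray n, ∃ s : ℝ, 0 < s ∧ (a * k).re = s * ε := by
  constructor
  · have hc : Continuous fun k : ℂ => (a * k).re := by fun_prop
    simpa using (hc.tendsto 0).mono_left (nhdsWithin_le_nhds (s := ray n))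
  · rintro k ⟨s, hs, rfl⟩
    refine ⟨s, hs, ?_⟩
    have : a * (s * Complex.exp ((n - 1) * Real.pi / 3 * Complex.I)) = ((s * ε : ℝ) : ℂ) := by
      push_cast
      rw [← h, rot]
      ring
    rw [this, Complex.ofReal_re]

theorem tendsto_jump_one_zero {r₁ r₂ : ℝ → ℂ} (hr : IsReflectionPair r₁ r₂) (x t : ℝ) :
    Tendsto (jump r₁ r₂ 1 x t) (𝓝[ray 1] 0) (𝓝 !![1, -ω ^ 2, 0; ω, 0, 0; 0, 0, 1]) := by
  have hre : Tendsto (fun k : ℂ => k.re) (𝓝[ray 1] 0) (𝓝[>] 0) := by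
    obtain ⟨h1, h2⟩ := tendsto_re_ray (n := 1) (a := 1) (ε := 1) (by simp [rot])
    simp only [one_mul] at h1 h2
    refine tendsto_nhdsWithin_iff.2 ⟨h1, ?_⟩
    filter_upwards [self_mem_nhdsWithin] with k hk
    obtain ⟨s, hs, h⟩ := h2 k hk
    simpa [h] using hs
  have hρ := hr.tendsto₁.comp hre
  have hρ' := hρ.star
  have e1 := tendsto_exp_theta_zero 1 0 x t (ray 1)
  have e2 := tendsto_exp_neg_theta_zero 1 0 x t (ray 1)
  have s1 : star (ω ^ 2) = ω := by
    rw [star_pow, star_omega]; linear_combination ω * omega_cube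
  rw [s1] at hρ'
  refine tendsto_matrix_iff.2 fun i j => ?_
  unfold jump
  fin_cases i <;> fin_cases j <;>
    simp only [if_true, Matrix.of_apply, Matrix.cons_val', Matrix.cons_val, Matrix.cons_val_zero,
      Matrix.cons_val_one, Matrix.cons_val_fin_one, Fin.zero_eta, Fin.mk_one, Fin.isValue,
      Fin.reduceFinMk] <;>
    try exact tendsto_const_nhds
  · simpa using hρ.neg.mul e2
  · simpa using hρ'.mul e1
  · have := (hρ.mul hρ').const_sub 1
    rw [show (1 : ℂ) - ω ^ 2 * ω = 0 by linear_combination -omega_cube] at this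
    exact this

theorem tendsto_jump_two_zero {r₁ r₂ : ℝ → ℂ} (hr : IsReflectionPair r₁ r₂) (x t : ℝ) :
    Tendsto (jump r₁ r₂ 2 x t) (𝓝[ray 2] 0) (𝓝 !![1, 0, 0; 0, 0, -1; 0, 1, 1]) := by
  have hre : Tendsto (fun k : ℂ => (ω * k).re) (𝓝[ray 2] 0) (𝓝[<] 0) := by
    obtain ⟨h1, h2⟩ := tendsto_re_ray (n := 2) (a := ω) (ε := -1) (by
      rw [rot, omega_eq, ← Complex.exp_add]
      rw [show ((2 * Real.pi / 3 : ℝ) : ℂ) * Complex.I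
        + (((2 : ℤ) : ℂ) - 1) * Real.pi / 3 * Complex.I = Real.pi * Complex.I by push_cast; ring,
        Complex.exp_pi_mul_I]
      simp)
    refine tendsto_nhdsWithin_iff.2 ⟨h1, ?_⟩
    filter_upwards [self_mem_nhdsWithin] with k hk
    obtain ⟨s, hs, h⟩ := h2 k hk
    rw [mem_Iio, h]
    linarith
  have hρ := hr.tendsto₂.comp hre
  have hρ' := hρ.star
  have e1 := tendsto_exp_theta_zero 2 1 x t (ray 2)
  have e2 := tendsto_exp_neg_theta_zero 2 1 x t (ray 2)
  rw [star_one] at hρ'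
  refine tendsto_matrix_iff.2 fun i j => ?_
  unfold jump
  fin_cases i <;> fin_cases j <;>
    simp only [Int.reduceEq, reduceIte, Matrix.of_apply, Matrix.cons_val', Matrix.cons_val,
      Matrix.cons_val_zero, Matrix.cons_val_one, Matrix.cons_val_fin_one, Fin.zero_eta, Fin.mk_one, Fin.isValue,
      Fin.reduceFinMk] <;>
    try exact tendsto_const_nhds
  · have := (hρ.mul hρ').const_sub 1
    rw [mul_one, sub_self] at this
    exact this
  · simpa using hρ'.neg.mul e2
  · simpa using hρ.mul e1

theorem tendsto_jump_three_zero {r₁ r₂ : ℝ → ℂ} (hr : IsReflectionPair r₁ r₂) (x t : ℝ) :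
    Tendsto (jump r₁ r₂ 3 x t) (𝓝[ray 3] 0) (𝓝 !![0, 0, ω; 0, 1, 0; -ω ^ 2, 0, 1]) := by
  have hre : Tendsto (fun k : ℂ => (ω ^ 2 * k).re) (𝓝[ray 3] 0) (𝓝[>] 0) := by
    obtain ⟨h1, h2⟩ := tendsto_re_ray (n := 3) (a := ω ^ 2) (ε := 1) (by
      have : rot 3 = ω := by
        rw [rot, ω]; congr 1; push_cast; ring
      rw [this]
      push_cast
      linear_combination omega_cube)
    refine tendsto_nhdsWithin_iff.2 ⟨h1, ?_⟩
    filter_upwards [self_mem_nhdsWithin] with k hk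
    obtain ⟨s, hs, h⟩ := h2 k hk
    simpa [h] using hs
  have hρ := hr.tendsto₁.comp hre
  have hρ' := hρ.star
  have e1 := tendsto_exp_theta_zero 2 0 x t (ray 3)
  have e2 := tendsto_exp_neg_theta_zero 2 0 x t (ray 3)
  have s1 : star (ω ^ 2) = ω := by
    rw [star_pow, star_omega]; linear_combination ω * omega_cube
  rw [s1] at hρ'
  refine tendsto_matrix_iff.2 fun i j => ?_
  unfold jump
  fin_cases i <;> fin_cases j <;>
    simp only [Int.reduceEq, reduceIte, Matrix.of_apply, Matrix.cons_val', Matrix.cons_val,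
      Matrix.cons_val_zero, Matrix.cons_val_one, Matrix.cons_val_fin_one, Fin.zero_eta, Fin.mk_one, Fin.isValue,
      Fin.reduceFinMk] <;>
    try exact tendsto_const_nhds
  · have := (hρ.mul hρ').const_sub 1
    rw [show (1 : ℂ) - ω ^ 2 * ω = 0 by linear_combination -omega_cube] at this
    exact this
  · simpa using hρ'.mul e2
  · simpa using hρ.neg.mul e1

theorem matA_inv : matA⁻¹ = !![0, 1, 0; 0, 0, 1; 1, 0, 0] := by
  refine Matrix.inv_eq_left_inv ?_
  ext i j
  fin_cases i <;> fin_cases j <;> simp [matA, Matrix.mul_apply, Fin.sum_univ_three]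

/-- The limit of `F(k)` as `k → 0` in `Ω₁`. -/
noncomputable def zeroValue (F : ℂ → Mat3) : Mat3 := limUnder (𝓝[sector 1] 0) F

section msk

variable {r₁ r₂ : ℝ → ℂ} {w : ℝ → ℝ → ℝ} {m : ℝ → ℝ → ℂ → Mat3}

theorem SolvesRHmSK.tendsto_zeroValue (hm : SolvesRHmSK r₁ r₂ w m) (x : ℝ) {t : ℝ} (ht : 0 ≤ t) :
    Tendsto (m x t) (𝓝[sector 1] 0) (𝓝 (zeroValue (m x t))) :=
  tendsto_nhds_limUnder (hm.exists_tendsto_zero x ht 1)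

theorem SolvesRHmSK.det_zeroValue (hm : SolvesRHmSK r₁ r₂ w m) (x : ℝ) {t : ℝ} (ht : 0 ≤ t) :
    (zeroValue (m x t)).det = 1 := by
  have := neBot_nhdsWithin_sector_zero 1
  refine tendsto_nhds_unique (Tendsto.det (hm.tendsto_zeroValue x ht)) ?_
  refine tendsto_const_nhds.congr' ?_
  filter_upwards [self_mem_nhdsWithin] with k hk
  exact (hm.det_eq_one x ht (sector_subset_compl_Sigma 1 hk)).symm

/-- The limits at `0` from neighbouring sectors are related by the jump matrix at `0`. -/
theorem SolvesRHmSK.limit_zero_eq (hm : SolvesRHmSK r₁ r₂ w m) (x : ℝ) {t : ℝ} (ht : 0 ≤ t)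
    {n : ℤ} (hn : n ∈ Finset.Icc (1 : ℤ) 6) {P Q V : Mat3}
    (hP : Tendsto (m x t) (𝓝[sector n] 0) (𝓝 P))
    (hQ : Tendsto (m x t) (𝓝[sector (n - 1)] 0) (𝓝 Q))
    (hV : Tendsto (jump r₁ r₂ n x t) (𝓝[ray n] 0) (𝓝 V)) : P = Q * V := by
  obtain ⟨Fp, Fm, -, -, h⟩ := hm.jumps x t ht n hn
  have h1 := tendsto_boundary_value_zero hP (fun k hk => (h k hk).1)
    (fun k hk => neBot_nhdsWithin_sector hk)
  have h2 := tendsto_boundary_value_zero hQ (fun k hk => (h k hk).2.1)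
    (fun k hk => neBot_nhdsWithin_sector_pred hk)
  have := neBot_nhdsWithin_ray_zero n
  refine tendsto_nhds_unique h1 ((h2.mul hV).congr' ?_)
  filter_upwards [self_mem_nhdsWithin] with k hk
  exact (h k hk).2.2.symm

/-- `P = 𝒜 P v₂(0) v₃(0) 𝒜⁻¹` for the value `P` at `0` in `Ω₁`, since `ω Ω₁ = Ω₃`. -/
theorem SolvesRHmSK.zeroValue_eq_matA (hr : IsReflectionPair r₁ r₂) (hm : SolvesRHmSK r₁ r₂ w m)
    (x : ℝ) {t : ℝ} (ht : 0 ≤ t) :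
    zeroValue (m x t) = matA * (zeroValue (m x t) * !![1, 0, 0; 0, 0, -1; 0, 1, 1]
      * !![0, 0, ω; 0, 1, 0; -ω ^ 2, 0, 1]) * matA⁻¹ := by
  have hP1 := hm.tendsto_zeroValue x ht
  obtain ⟨P2, hP2⟩ := hm.exists_tendsto_zero x ht 2
  obtain ⟨P3, hP3⟩ := hm.exists_tendsto_zero x ht 3
  have e2 := hm.limit_zero_eq x ht (n := 2) (by simp) hP2 hP1 (tendsto_jump_two_zero hr x t)
  have e3 := hm.limit_zero_eq x ht (n := 3) (by simp) hP3 hP2 (tendsto_jump_three_zero hr x t)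
  rw [← e2, ← e3]
  have := neBot_nhdsWithin_sector_zero 1
  have hrot : Tendsto (fun k => ω * k) (𝓝[sector 1] 0) (𝓝[sector 3] 0) := by
    refine tendsto_nhdsWithin_iff.2 ⟨?_, ?_⟩
    · have hc : Continuous fun k : ℂ => ω * k := by fun_prop
      simpa using (hc.tendsto 0).mono_left (nhdsWithin_le_nhds (s := sector 1))
    · filter_upwards [self_mem_nhdsWithin] with k hk
      exact omega_mul_mem_sector hk
  refine tendsto_nhds_unique hP1
    (((tendsto_const_nhds.mul (hP3.comp hrot)).mul tendsto_const_nhds).congr' ?_)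
  filter_upwards [self_mem_nhdsWithin] with k hk
  exact ((hm.symmetries x t ht k (sector_subset_compl_Sigma 1 hk)).1).symm

/-- `P = ℬ P^* ℬ v₁(0)` for the value `P` at `0` in `Ω₁`, since `Ω₁` and `Ω₀` are conjugate. -/
theorem SolvesRHmSK.zeroValue_eq_matB (hr : IsReflectionPair r₁ r₂) (hm : SolvesRHmSK r₁ r₂ w m)
    (x : ℝ) {t : ℝ} (ht : 0 ≤ t) :
    zeroValue (m x t) = matB * (zeroValue (m x t)).map star * matB
      * !![1, -ω ^ 2, 0; ω, 0, 0; 0, 0, 1] := by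
  have hP1 := hm.tendsto_zeroValue x ht
  obtain ⟨P0, hP0⟩ := hm.exists_tendsto_zero x ht 0
  have e1 := hm.limit_zero_eq x ht (n := 1) (by simp) hP1 (by simpa using hP0)
    (tendsto_jump_one_zero hr x t)
  have hconj : Tendsto (fun k : ℂ => star k) (𝓝[sector 0] 0) (𝓝[sector 1] 0) := by
    refine tendsto_nhdsWithin_iff.2 ⟨?_, ?_⟩
    · have hc : Continuous fun k : ℂ => star k := continuous_star
      simpa using (hc.tendsto 0).mono_left (nhdsWithin_le_nhds (s := sector 0))
    · filter_upwards [self_mem_nhdsWithin] with k hk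
      exact star_mem_sector hk
  have := neBot_nhdsWithin_sector_zero 0
  have hmap : Tendsto (fun k => (m x t (star k)).map star) (𝓝[sector 0] 0)
      (𝓝 ((zeroValue (m x t)).map star)) :=
    tendsto_matrix_iff.2 fun i j => (tendsto_matrix_iff.1 (hP1.comp hconj) i j).star
  have e0 : P0 = matB * (zeroValue (m x t)).map star * matB := by
    refine tendsto_nhds_unique hP0
      (((tendsto_const_nhds.mul hmap).mul tendsto_const_nhds).congr' ?_)
    filter_upwards [self_mem_nhdsWithin] with k hk
    exact ((hm.symmetries x t ht k (sector_subset_compl_Sigma 0 hk)).2).symm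
  rw [← e0]
  exact e1

/-- The row vector `(ω², ω, 1)` times the value at `0` in `Ω₁` is a real multiple of
`(ω², 0, 0)`. It is an eigenvector, with eigenvalue `ω`, of the triangular matrix
`v₂(0) v₃(0) 𝒜⁻¹`, whose eigenvalues are the three cube roots of unity; the multiple is real by
the symmetry with `ℬ`. -/
theorem SolvesRHmSK.exists_real_row (hr : IsReflectionPair r₁ r₂) (hm : SolvesRHmSK r₁ r₂ w m)
    (x : ℝ) {t : ℝ} (ht : 0 ≤ t) : ∃ α : ℝ, ∀ j, ω ^ 2 * zeroValue (m x t) 0 j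
      + ω * zeroValue (m x t) 1 j + zeroValue (m x t) 2 j = ![ω ^ 2 * α, 0, 0] j := by
  have hA := hm.zeroValue_eq_matA hr x ht
  have hB := hm.zeroValue_eq_matB hr x ht
  set P := zeroValue (m x t)
  have hA' : ∀ i j, P i j = _ := fun i j => congrFun (congrFun hA i) j
  have hB' : ∀ i j, P i j = _ := fun i j => congrFun (congrFun hB i) j
  rw [matA_inv] at hA'
  have a02 := hA' 0 2
  have a12 := hA' 1 2
  have a22 := hA' 2 2
  have a01 := hA' 0 1
  have a11 := hA' 1 1
  have a21 := hA' 2 1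
  have b00 := hB' 0 0
  have b10 := hB' 1 0
  have b20 := hB' 2 0
  simp only [matA, matB, Matrix.mul_apply, Fin.sum_univ_three, Matrix.map_apply] at a02 a12 a22 a01 a11 a21 b00 b10 b20
  simp at a02 a12 a22 a01 a11 a21 b00 b10 b20
  have hw2 := omega_sq
  have hw3 := omega_cube
  have hq2 : ω ^ 2 * P 0 2 + ω * P 1 2 + P 2 2 = 0 := by
    linear_combination (P 0 2) * hw2 + ω * a12 + a12 + a22
  have hq1 : ω ^ 2 * P 0 1 + ω * P 1 1 + P 2 1 = 0 := by
    have h : (1 - ω) * (ω ^ 2 * P 0 1 + ω * P 1 1 + P 2 1) = 0 := by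
      linear_combination ω ^ 2 * a01 + ω * a11 + a21 + (ω * P 2 1 - (1 + ω) * P 2 2) * hw3
        - ω ^ 2 * a12 + (ω + 1 - ω ^ 3) * a02 - P 0 2 * hw2
    exact (mul_eq_zero.1 h).resolve_left (sub_ne_zero.2 omega_ne_one.symm)
  set q := ω ^ 2 * P 0 0 + ω * P 1 0 + P 2 0 with hq
  have hqs : q = ω * star q := by
    have e : star q = ω * star (P 0 0) + ω ^ 2 * star (P 1 0) + star (P 2 0) := by
      simp only [hq, star_add, star_mul', star_pow, star_omega]
      linear_combination ω * star (P 0 0) * hw3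
    have e1 : ω * star (P 0 1) + ω ^ 2 * star (P 1 1) + star (P 2 1) = 0 := by
      have := congrArg star hq1
      simp only [star_add, star_mul', star_pow, star_omega, star_zero] at this
      linear_combination this - ω * star (P 0 1) * hw3
    simp only [starRingEnd_apply] at b00 b10 b20
    rw [e]
    linear_combination ω ^ 2 * b00 + ω * b10 + b20 + e1
  have hreal : star (ω * q) = ω * q := by
    rw [star_mul', star_omega]
    linear_combination -ω * hqs
  obtain ⟨α, hα⟩ := Complex.conj_eq_iff_real.1 hreal
  refine ⟨α, fun j => ?_⟩
  fin_cases j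
  · simp only [Fin.zero_eta, Matrix.cons_val_zero]
    rw [← hα, ← hq]
    linear_combination -q * hw3
  · simpa using hq1
  · simpa using hq2

end msk

/-! ### Entrywise bounds of matrices -/

/-- All entries of `A` are at most `c` in absolute value. -/
def EntriesLE (A : Mat3) (c : ℝ) : Prop := ∀ i j, ‖A i j‖ ≤ c

namespace EntriesLE

variable {A B : Mat3} {a b : ℝ}

theorem nonneg (hA : EntriesLE A a) : 0 ≤ a := (norm_nonneg _).trans (hA 0 0)

theorem mono (hA : EntriesLE A a) (h : a ≤ b) : EntriesLE A b := fun i j => (hA i j).trans h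

theorem add (hA : EntriesLE A a) (hB : EntriesLE B b) : EntriesLE (A + B) (a + b) :=
  fun i j => (norm_add_le _ _).trans (add_le_add (hA i j) (hB i j))

theorem sub (hA : EntriesLE A a) (hB : EntriesLE B b) : EntriesLE (A - B) (a + b) :=
  fun i j => (norm_sub_le _ _).trans (add_le_add (hA i j) (hB i j))

theorem smul (hA : EntriesLE A a) (c : ℂ) : EntriesLE (c • A) (‖c‖ * a) := fun i j => by
  rw [Matrix.smul_apply, smul_eq_mul, norm_mul]
  exact mul_le_mul_of_nonneg_left (hA i j) (norm_nonneg _)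

theorem mul (hA : EntriesLE A a) (hB : EntriesLE B b) : EntriesLE (A * B) (3 * (a * b)) :=
  fun i j => by
  rw [Matrix.mul_apply]
  refine (norm_sum_le _ _).trans ?_
  have h : ∀ l ∈ Finset.univ, ‖A i l * B l j‖ ≤ a * b := fun l _ => by
    rw [norm_mul]
    exact mul_le_mul (hA i l) (hB l j) (norm_nonneg _) hA.nonneg
  simpa using Finset.sum_le_card_nsmul _ _ _ h

theorem one : EntriesLE 1 1 := fun i j => by
  rw [Matrix.one_apply]
  split_ifs <;> simp

theorem adjugate (hA : EntriesLE A a) : EntriesLE A.adjugate (2 * a ^ 2) := fun i j => by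
  have h : ∀ i j k l, ‖A i j * A k l‖ ≤ a ^ 2 := fun i j k l => by
    rw [norm_mul, sq]
    exact mul_le_mul (hA i j) (hA k l) (norm_nonneg _) hA.nonneg
  have h2 : ∀ i j k l i' j' k' l', ‖A i j * A k l - A i' j' * A k' l'‖ ≤ 2 * a ^ 2 := by
    intros
    refine (norm_sub_le _ _).trans ?_
    rw [two_mul]
    exact add_le_add (h ..) (h ..)
  have h3 : ∀ i j k l i' j' k' l', ‖-(A i j * A k l) + A i' j' * A k' l'‖ ≤ 2 * a ^ 2 := by
    intros
    refine (norm_add_le _ _).trans ?_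
    rw [norm_neg, two_mul]
    exact add_le_add (h ..) (h ..)
  rw [Matrix.adjugate_fin_three]
  fin_cases i <;> fin_cases j <;>
    simp only [Matrix.of_apply, Matrix.cons_val', Matrix.cons_val, Matrix.cons_val_zero,
      Matrix.cons_val_one, Matrix.cons_val_fin_one, Fin.zero_eta, Fin.mk_one, Fin.isValue,
      Fin.reduceFinMk] <;>
    first | exact h2 .. | exact h3 ..

end EntriesLE

/-! ### The Lax equation in the gauge normalized at zero -/

/-- The diagonal matrix `diag(ω, ω², 1)`, so that `diag(l₁, l₂, l₃) = k J`. -/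
noncomputable def matJ : Mat3 := Matrix.diagonal ![ω, ω ^ 2, 1]

theorem l_apply (k : ℂ) (i : Fin 3) : l k i = k * ![ω, ω ^ 2, 1] i := by
  fin_cases i <;> simp [l, mul_comm]

theorem norm_matJ_diag (i : Fin 3) : ‖![ω, ω ^ 2, 1] i‖ = 1 := by
  fin_cases i <;> simp [norm_omega]

theorem entriesLE_matJ : EntriesLE matJ 1 := fun i j => by
  rw [matJ, Matrix.diagonal_apply]
  split_ifs
  · rw [norm_matJ_diag]
  · simp

theorem entriesLE_expL {h : ℝ} {k : ℂ} (hk : |h| * ‖k‖ ≤ 1) :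
    EntriesLE (expL h k - 1 - ((h : ℂ) * k) • matJ) ((|h| * ‖k‖) ^ 2) := fun i j => by
  simp only [expL, matJ, Matrix.sub_apply, Matrix.smul_apply, Matrix.diagonal_apply,
    Matrix.one_apply]
  split_ifs with hij
  · have e : ‖l k i * h‖ = |h| * ‖k‖ := by
      rw [l_apply, norm_mul, norm_mul, norm_matJ_diag, Complex.norm_real, Real.norm_eq_abs]
      ring
    have := Complex.norm_exp_sub_one_sub_id_le (x := l k i * h) (by rw [e]; exact hk)
    rw [e] at this
    rwa [smul_eq_mul, show (h : ℂ) * k * ![ω, ω ^ 2, 1] i = l k i * h by rw [l_apply]; ring]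
  · simp only [sub_zero, smul_zero, norm_zero]
    positivity

theorem differentiable_entry {D : ℂ → Mat3} (hD : ∀ i j, Differentiable ℂ fun k => D k i j)
    (c : ℂ) (i j : Fin 3) : Differentiable ℂ fun k => (D k - 1 - (c * k) • matJ) i j := by
  simp only [Matrix.sub_apply, Matrix.smul_apply, smul_eq_mul]
  have := hD i j
  fun_prop

section lax

variable {F : ℝ → ℂ → Mat3} {F₁ : ℝ → Mat3}

theorem exists_lipschitz_bound {y : ℝ} (hd : ∀ i j, DifferentiableAt ℝ (fun x => F₁ x i j) y) :
    ∃ K : ℝ, 0 ≤ K ∧ ∀ᶠ h in 𝓝 (0 : ℝ), EntriesLE (F₁ (y + h)) K ∧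
      EntriesLE (F₁ (y + h) - F₁ y) (K * |h|) := by
  have h1 : ∀ i j, ∃ K : ℝ, ∀ᶠ h in 𝓝 (0 : ℝ), ‖F₁ (y + h) i j‖ ≤ K ∧
      ‖F₁ (y + h) i j - F₁ y i j‖ ≤ K * |h| := fun i j => by
    have ht : Tendsto (fun h : ℝ => y + h) (𝓝 0) (𝓝 y) := by
      have : Continuous fun h : ℝ => y + h := by fun_prop
      simpa using this.tendsto 0
    obtain ⟨c, hc⟩ := ((hd i j).isBigO_sub.comp_tendsto ht).bound
    have h2 := (((hd i j).continuousAt.tendsto.comp ht).norm).eventually_lt_const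
      (lt_add_one ‖F₁ y i j‖)
    refine ⟨max c (‖F₁ y i j‖ + 1), ?_⟩
    filter_upwards [hc, h2] with h h3 h4
    refine ⟨h4.le.trans (le_max_right _ _), ?_⟩
    simp only [Function.comp_apply, add_sub_cancel_left, Real.norm_eq_abs] at h3
    exact h3.trans (mul_le_mul_of_nonneg_right (le_max_left _ _) (abs_nonneg _))
  choose K hK using h1
  have hle : ∀ i j, K i j ≤ ∑ i, ∑ j, |K i j| := fun i j => by
    refine (le_abs_self _).trans ?_
    refine (Finset.single_le_sum (f := fun j => |K i j|) (fun _ _ => abs_nonneg _)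
      (Finset.mem_univ j)).trans ?_
    exact Finset.single_le_sum (f := fun i => ∑ j, |K i j|)
      (fun _ _ => Finset.sum_nonneg fun _ _ => abs_nonneg _) (Finset.mem_univ i)
  refine ⟨∑ i, ∑ j, |K i j|, by positivity, ?_⟩
  have := eventually_all.2 fun i => eventually_all.2 fun j => hK i j
  filter_upwards [this] with h hh
  exact ⟨fun i j => (hh i j).1.trans (hle i j), fun i j => ((hh i j).2).trans
    (mul_le_mul_of_nonneg_right (hle i j) (abs_nonneg _))⟩

/-- On circles of radius comparable to `|h|^{-1/2}` the transition matrix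
`F(y+h) exp(h k J) F(y)⁻¹` is `1 + h k J + O(h)`. At this radius the errors `O(k⁻²)` of the
expansion at infinity and `O(h²k²)` of the exponential are both `O(h)`. -/
theorem exists_transition_bound (hF : HasExpansionAtInfinity F F₁)
    (hdet : ∀ x, ∀ k ∉ Sigma, (F x k).det = 1) {y : ℝ}
    (hd : ∀ i j, DifferentiableAt ℝ (fun x => F₁ x i j) y) :
    ∃ C : ℝ, 0 ≤ C ∧ ∀ᶠ h in 𝓝 (0 : ℝ), ∀ k ∉ Sigma, 1 ≤ |h| * ‖k‖ ^ 2 → |h| * ‖k‖ ^ 2 ≤ 4 →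
      EntriesLE (F (y + h) k * expL h k * (F y k).adjugate - 1 - ((h : ℂ) * k) • matJ)
        (C * |h|) := by
  obtain ⟨K₁, hK₁, hL⟩ := exists_lipschitz_bound hd
  obtain ⟨C₀, R, hCR⟩ := hF (|y| + 1)
  set K := max K₁ (max C₀ 1) with hK
  have hKK : K₁ ≤ K := le_max_left _ _
  have hCK : C₀ ≤ K := (le_max_left _ _).trans (le_max_right _ _)
  have hK1 : 1 ≤ K := (le_max_right _ _).trans (le_max_right _ _)
  refine ⟨3 * (51 * K * (18 * K ^ 2)), by positivity, ?_⟩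
  have hδ : ∀ᶠ h in 𝓝 (0 : ℝ), |h| < 1 / (4 + R ^ 2) := by
    have : Tendsto (fun h : ℝ => |h|) (𝓝 0) (𝓝 0) := by
      simpa using continuous_abs.tendsto (0 : ℝ)
    exact this.eventually_lt_const (by positivity)
  filter_upwards [hL, hδ] with h hLh hh k hk h1 h4
  obtain ⟨hb, hl⟩ := hLh
  have hb0 : EntriesLE (F₁ y) K := by
    have := hL.self_of_nhds.1
    rw [add_zero] at this
    exact this.mono hKK
  have habs := abs_nonneg h
  have hn := norm_nonneg k
  rw [lt_div_iff₀ (by positivity)] at hh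
  have hh4 : |h| * 4 ≤ 1 := by nlinarith [sq_nonneg R]
  have hk4 : 4 + R ^ 2 ≤ ‖k‖ ^ 2 := by
    by_contra hcon
    push Not at hcon
    nlinarith
  have hk1 : 1 ≤ ‖k‖ := by nlinarith [sq_nonneg R]
  have hkR : R ≤ ‖k‖ := by
    by_contra hcon
    push Not at hcon
    nlinarith
  have hk0 : 0 < ‖k‖ := by linarith
  have hhk : |h| * ‖k‖ ≤ 1 := by
    have : (|h| * ‖k‖) ^ 2 ≤ 1 := by
      calc (|h| * ‖k‖) ^ 2 = |h| * (|h| * ‖k‖ ^ 2) := by ring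
        _ ≤ |h| * 4 := mul_le_mul_of_nonneg_left h4 habs
        _ ≤ 1 := hh4
    exact (sq_le_one_iff₀ (by positivity)).1 this
  set ε := ‖k‖⁻¹ with hε
  have hε0 : 0 ≤ ε := by positivity
  have hε1 : ε ≤ 1 := inv_le_one_of_one_le₀ hk1
  have hε2 : ε ^ 2 ≤ |h| := by
    rw [hε, inv_pow, inv_le_iff_one_le_mul₀ (by positivity)]
    exact h1
  -- the expansion at infinity of the two factors
  have hexp : ∀ x : ℝ, |x| ≤ |y| + 1 → EntriesLE (F₁ x) K →
      EntriesLE (F x k - 1 - k⁻¹ • F₁ x) (K * ε ^ 2) ∧ EntriesLE (F x k - 1) (2 * K * ε) := by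
    intro x hx hFx
    have e1 : EntriesLE (F x k - 1 - k⁻¹ • F₁ x) (K * ε ^ 2) := fun i j => by
      refine (hCR x hx k hk hkR i j).trans ?_
      rw [div_eq_mul_inv, hε, inv_pow]
      gcongr
    refine ⟨e1, ?_⟩
    have e2 := e1.add (hFx.smul k⁻¹)
    rw [sub_add_cancel, norm_inv, ← hε] at e2
    refine e2.mono ?_
    nlinarith [mul_le_mul_of_nonneg_left hε1 (mul_nonneg (by linarith : (0 : ℝ) ≤ K) hε0)]
  have hyh : |y + h| ≤ |y| + 1 := (abs_add_le _ _).trans (by nlinarith [sq_nonneg R])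
  obtain ⟨n1, n2⟩ := hexp y (by linarith) hb0
  obtain ⟨n1', n2'⟩ := hexp (y + h) hyh (hb.mono hKK)
  set N := F y k
  set N' := F (y + h) k
  set X := expL h k
  have hKε : K * ε ≤ K := mul_le_of_le_one_right (by linarith) hε1
  have b1 : EntriesLE N (3 * K) := by
    have := n2.add EntriesLE.one
    rw [sub_add_cancel] at this
    exact this.mono (by linarith)
  have b1' : EntriesLE N' (3 * K) := by
    have := n2'.add EntriesLE.one
    rw [sub_add_cancel] at this
    exact this.mono (by linarith)
  have b2 : EntriesLE (N' - N) (3 * K * |h|) := by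
    have := (n1'.sub n1).add (hl.smul k⁻¹)
    have e : N' - 1 - k⁻¹ • F₁ (y + h) - (N - 1 - k⁻¹ • F₁ y) + k⁻¹ • (F₁ (y + h) - F₁ y)
        = N' - N := by rw [smul_sub]; abel
    rw [e, norm_inv, ← hε] at this
    refine this.mono ?_
    have a1 : K * ε ^ 2 ≤ K * |h| := mul_le_mul_of_nonneg_left hε2 (by linarith)
    have a2 : ε * (K₁ * |h|) ≤ 1 * (K * |h|) := by gcongr
    linarith
  have b3 : EntriesLE (N' * (X - 1 - ((h : ℂ) * k) • matJ)) (36 * K * |h|) := by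
    refine (b1'.mul (entriesLE_expL hhk)).mono ?_
    have : (|h| * ‖k‖) ^ 2 ≤ 4 * |h| := by
      calc (|h| * ‖k‖) ^ 2 = |h| * (|h| * ‖k‖ ^ 2) := by ring
        _ ≤ |h| * 4 := mul_le_mul_of_nonneg_left h4 habs
        _ = 4 * |h| := mul_comm _ _
    calc 3 * (3 * K * (|h| * ‖k‖) ^ 2) ≤ 3 * (3 * K * (4 * |h|)) := by gcongr
      _ = 36 * K * |h| := by ring
  have b4 : EntriesLE (((h : ℂ) * k) • ((N' - 1) * matJ - matJ * (N - 1))) (12 * K * |h|) := by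
    refine (((n2'.mul entriesLE_matJ).sub (entriesLE_matJ.mul n2)).smul _).mono ?_
    rw [norm_mul, Complex.norm_real, Real.norm_eq_abs]
    have : ‖k‖ * ε = 1 := mul_inv_cancel₀ hk0.ne'
    calc |h| * ‖k‖ * (3 * (2 * K * ε * 1) + 3 * (1 * (2 * K * ε)))
        = 12 * K * |h| * (‖k‖ * ε) := by ring
      _ ≤ 12 * K * |h| := by rw [this, mul_one]
  have hsum := (b2.add b3).add b4
  have hNN : N * N.adjugate = 1 := by rw [Matrix.mul_adjugate, hdet y k hk, one_smul]
  have e : N' * X * N.adjugate - 1 - ((h : ℂ) * k) • matJ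
      = (N' - N + N' * (X - 1 - ((h : ℂ) * k) • matJ)
        + ((h : ℂ) * k) • ((N' - 1) * matJ - matJ * (N - 1))) * N.adjugate := by
    have e1 : N' - N + N' * (X - 1 - ((h : ℂ) * k) • matJ)
        + ((h : ℂ) * k) • ((N' - 1) * matJ - matJ * (N - 1))
        = N' * X - N - ((h : ℂ) * k) • (matJ * N) := by
      simp only [mul_sub, sub_mul, mul_one, one_mul, smul_sub, Matrix.mul_smul]
      abel
    rw [e1, sub_mul, sub_mul, hNN, smul_mul_assoc, mul_assoc matJ, hNN, mul_one]
  rw [e]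
  refine (hsum.mul b1.adjugate).mono (le_of_eq ?_)
  ring

/-- The bound of `exists_transition_bound` propagates to the disc by the maximum principle, since
the transition matrix is entire; then the Schwarz lemma compares its values with the one at `0`. -/
theorem exists_transition_bound_disc (hF : HasExpansionAtInfinity F F₁)
    (hdet : ∀ x, ∀ k ∉ Sigma, (F x k).det = 1) {y : ℝ}
    (hd : ∀ i j, DifferentiableAt ℝ (fun x => F₁ x i j) y) {E : ℝ → ℂ → Mat3}
    (hE : ∀ h i j, Differentiable ℂ fun k => E h k i j)
    (hEF : ∀ h, ∀ k ∉ Sigma, E h k = F (y + h) k * expL h k * (F y k).adjugate) :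
    ∃ C : ℝ, 0 ≤ C ∧ ∀ᶠ h in 𝓝[≠] (0 : ℝ), EntriesLE (E h 0 - 1) (C * |h|) ∧
      ∀ k : ℂ, ‖k‖ < (√|h|)⁻¹ →
        EntriesLE (E h k - E h 0 - ((h : ℂ) * k) • matJ) (2 * C * |h| * √|h| * ‖k‖) := by
  obtain ⟨C, hC, hev⟩ := exists_transition_bound hF hdet hd
  refine ⟨C, hC, ?_⟩
  filter_upwards [nhdsWithin_le_nhds hev, self_mem_nhdsWithin] with h hh hne
  have hpos : 0 < |h| := abs_pos.2 hne
  set s := √|h| with hs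
  have hs0 : 0 < s := Real.sqrt_pos.2 hpos
  have hss : s ^ 2 = |h| := Real.sq_sqrt hpos.le
  -- the annulus `|h|^{-1/2} < |k| < 2 |h|^{-1/2}`
  have hann : ∀ i j, ∀ k ∈ {k : ℂ | s⁻¹ < ‖k‖ ∧ ‖k‖ < 2 * s⁻¹},
      ‖(E h k - 1 - ((h : ℂ) * k) • matJ) i j‖ ≤ C * |h| := by
    intro i j
    refine norm_le_of_norm_le_off_Sigma ?_
      (differentiable_entry (hE h) (h : ℂ) i j).continuous.continuousOn ?_
    · exact (isOpen_lt continuous_const continuous_norm).inter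
        (isOpen_lt continuous_norm continuous_const)
    · rintro k ⟨h1, h2⟩ hk
      rw [hEF h k hk]
      have e1 : 1 ≤ s * ‖k‖ := by
        have := mul_le_mul_of_nonneg_left h1.le hs0.le
        rwa [mul_inv_cancel₀ hs0.ne'] at this
      have e2 : s * ‖k‖ ≤ 2 := by
        have := mul_le_mul_of_nonneg_left h2.le hs0.le
        rwa [mul_left_comm, mul_inv_cancel₀ hs0.ne', mul_one] at this
      refine hh k hk ?_ ?_ i j
      · rw [← hss, ← mul_pow]
        exact one_le_pow₀ e1
      · rw [← hss, ← mul_pow]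
        nlinarith
  have hdisc : ∀ i j, ∀ k : ℂ, ‖k‖ < s⁻¹ →
      ‖(E h k - 1 - ((h : ℂ) * k) • matJ) i j‖ ≤ C * |h| := by
    intro i j k hk
    have hsi : 0 < s⁻¹ := inv_pos.2 hs0
    refine Complex.norm_le_of_forall_mem_frontier_norm_le (U := Metric.ball 0 (3 / 2 * s⁻¹))
      Metric.isBounded_ball (differentiable_entry (hE h) (h : ℂ) i j).diffContOnCl ?_ ?_
    · intro κ hκ
      rw [frontier_ball _ (by positivity), mem_sphere_zero_iff_norm] at hκ
      exact hann i j κ ⟨by rw [hκ]; linarith, by rw [hκ]; linarith⟩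
    · refine subset_closure (mem_ball_zero_iff.2 ?_)
      linarith
  have hsi : 0 < s⁻¹ := inv_pos.2 hs0
  have h0 : ∀ i j, ‖(E h 0 - 1) i j‖ ≤ C * |h| := fun i j => by
    simpa using hdisc i j 0 (by simpa using hs0)
  refine ⟨h0, fun k hk i j => ?_⟩
  have := Complex.dist_le_div_mul_dist_of_mapsTo_ball (c := 0) (R₁ := s⁻¹) (R₂ := 2 * (C * |h|))
    (z := k) (differentiable_entry (hE h) (h : ℂ) i j).differentiableOn
    (fun κ hκ => by
      rw [mem_ball_zero_iff] at hκ
      rw [Metric.mem_closedBall, dist_eq_norm, two_mul]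
      refine (norm_sub_le _ _).trans (add_le_add (hdisc i j κ hκ) (hdisc i j 0 ?_))
      simpa using hs0) (mem_ball_zero_iff.2 hk)
  rw [dist_eq_norm, dist_zero_right] at this
  have e : (E h k - E h 0 - ((h : ℂ) * k) • matJ) i j
      = (E h k - 1 - ((h : ℂ) * k) • matJ) i j - (E h 0 - 1 - ((h : ℂ) * 0) • matJ) i j := by
    simp only [Matrix.sub_apply, Matrix.smul_apply, smul_eq_mul, mul_zero, zero_mul]
    ring
  rw [e]
  refine this.trans (le_of_eq ?_)
  field_simp

end lax

theorem tendsto_slope_expL (k : ℂ) :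
    Tendsto (fun h : ℝ => (h : ℂ)⁻¹ • (expL (-h) k - 1)) (𝓝[≠] 0) (𝓝 (-(k • matJ))) := by
  refine tendsto_matrix_iff.2 fun i j => ?_
  simp only [expL, matJ, Matrix.sub_apply, Matrix.smul_apply, Matrix.neg_apply,
    Matrix.diagonal_apply, Matrix.one_apply]
  split_ifs with hij
  · have h1 : HasDerivAt (fun h : ℝ => Complex.exp (l k i * ((-h : ℝ) : ℂ))) (-(l k i)) 0 := by
      have h2 : HasDerivAt (fun h : ℝ => l k i * ((-h : ℝ) : ℂ)) (l k i * ((-1 : ℝ) : ℂ)) 0 :=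
        ((hasDerivAt_id (0 : ℝ)).neg.ofReal_comp).const_mul (l k i)
      have h3 := h2.cexp
      simpa using h3
    have h2 := hasDerivAt_iff_tendsto_slope_zero.1 h1
    rw [l_apply] at h2
    refine h2.congr fun h => ?_
    simp only [zero_add, neg_zero, Complex.ofReal_zero, mul_zero, Complex.exp_zero, l_apply,
      Complex.real_smul, Complex.ofReal_inv, smul_eq_mul]
  · simp

section gauge

variable {F : ℝ → ℂ → Mat3} {F₁ : ℝ → Mat3} {P : ℝ → Mat3} {E : ℝ → ℝ → ℂ → Mat3}

/-- The value at `0` is continuous in `x`. -/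
theorem continuous_zero_limit (hF : HasExpansionAtInfinity F F₁)
    (hdet : ∀ x, ∀ k ∉ Sigma, (F x k).det = 1) (hPdet : ∀ x, (P x).det = 1)
    (hd : ∀ y i j, DifferentiableAt ℝ (fun x => F₁ x i j) y)
    (hE : ∀ y h i j, Differentiable ℂ fun k => E y h k i j)
    (hEF : ∀ y h, ∀ k ∉ Sigma, E y h k = F (y + h) k * expL h k * (F y k).adjugate)
    (hE0 : ∀ y h, E y h 0 = P (y + h) * (P y).adjugate) : Continuous P := by
  refine continuous_iff_continuousAt.2 fun y => ?_
  obtain ⟨C, hC, hev⟩ := exists_transition_bound_disc hF hdet (hd y) (hE y) (hEF y)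
  have habs : Tendsto (fun h : ℝ => C * |h|) (𝓝[≠] 0) (𝓝 0) := by
    have : Continuous fun h : ℝ => C * |h| := by fun_prop
    simpa using (this.tendsto 0).mono_left nhdsWithin_le_nhds
  have h1 : Tendsto (fun h => E y h 0) (𝓝[≠] 0) (𝓝 1) := by
    refine tendsto_matrix_iff.2 fun i j => ?_
    rw [tendsto_iff_norm_sub_tendsto_zero]
    refine squeeze_zero' (Eventually.of_forall fun _ => norm_nonneg _) ?_ habs
    filter_upwards [hev] with h hh
    exact hh.1 i j
  have h2 : Tendsto (fun h => P (y + h)) (𝓝[≠] 0) (𝓝 (P y)) := by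
    have := h1.mul_const (P y)
    rw [one_mul] at this
    refine this.congr fun h => ?_
    rw [hE0, mul_assoc, Matrix.adjugate_mul, hPdet, one_smul, mul_one]
  have h3 : ContinuousAt (fun h => P (y + h)) 0 := by
    rw [continuousAt_iff_punctured_nhds, add_zero]
    exact h2
  have h4 : ContinuousAt ((fun h => P (y + h)) ∘ fun x => x - y) y :=
    ContinuousAt.comp (by rwa [sub_self]) (by fun_prop)
  refine h4.congr (Eventually.of_forall fun x => ?_)
  simp

/-- In the gauge normalized at `0` the solution is differentiable in `x`, for each fixed `k`, and
satisfies the Lax equation `(P⁻¹F)' = k P⁻¹(JF - FJ)`. Nothing but continuity of `P` is needed,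
since the transition matrix of `P⁻¹F` is `1` at `k = 0`. -/
theorem hasDerivAt_gauge (hF : HasExpansionAtInfinity F F₁)
    (hdet : ∀ x, ∀ k ∉ Sigma, (F x k).det = 1) (hPdet : ∀ x, (P x).det = 1)
    (hd : ∀ y i j, DifferentiableAt ℝ (fun x => F₁ x i j) y)
    (hE : ∀ y h i j, Differentiable ℂ fun k => E y h k i j)
    (hEF : ∀ y h, ∀ k ∉ Sigma, E y h k = F (y + h) k * expL h k * (F y k).adjugate)
    (hE0 : ∀ y h, E y h 0 = P (y + h) * (P y).adjugate) (y : ℝ) {k : ℂ} (hk : k ∉ Sigma)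
    (i j : Fin 3) :
    HasDerivAt (fun x => ((P x).adjugate * F x k) i j)
      (((P y).adjugate * (k • (matJ * F y k - F y k * matJ))) i j) y := by
  have hPc := continuous_zero_limit hF hdet hPdet hd hE hEF hE0
  obtain ⟨C, hC, hev⟩ := exists_transition_bound_disc hF hdet (hd y) (hE y) (hEF y)
  -- the difference quotient of the transition matrix
  have hR : Tendsto (fun h : ℝ => (h : ℂ)⁻¹ • (E y h k - E y h 0)) (𝓝[≠] 0) (𝓝 (k • matJ)) := by
    refine tendsto_matrix_iff.2 fun i j => ?_
    rw [tendsto_iff_norm_sub_tendsto_zero]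
    have hlim : Tendsto (fun h : ℝ => 2 * C * √|h| * ‖k‖) (𝓝[≠] 0) (𝓝 0) := by
      have : Continuous fun h : ℝ => 2 * C * √|h| * ‖k‖ := by fun_prop
      simpa using (this.tendsto 0).mono_left nhdsWithin_le_nhds
    refine squeeze_zero' (Eventually.of_forall fun _ => norm_nonneg _) ?_ hlim
    have hsmall : ∀ᶠ h in 𝓝[≠] (0 : ℝ), √|h| * ‖k‖ < 1 := by
      have hc : Continuous fun h : ℝ => √|h| * ‖k‖ := by fun_prop
      have : Tendsto (fun h : ℝ => √|h| * ‖k‖) (𝓝[≠] 0) (𝓝 0) := by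
        simpa using (hc.tendsto 0).mono_left nhdsWithin_le_nhds
      exact this.eventually_lt_const one_pos
    filter_upwards [hev, hsmall, self_mem_nhdsWithin] with h hh hs hne
    have hpos : 0 < |h| := abs_pos.2 hne
    have hkh : ‖k‖ < (√|h|)⁻¹ := by
      rw [lt_inv_comm₀ (norm_pos_iff.2 (ne_zero_of_notMem_Sigma hk)) (Real.sqrt_pos.2 hpos)]
      rw [lt_inv_comm₀ (Real.sqrt_pos.2 hpos) (norm_pos_iff.2 (ne_zero_of_notMem_Sigma hk)),
        ← one_div, lt_div_iff₀ (Real.sqrt_pos.2 hpos), mul_comm]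
      exact hs
    have h1 := hh.2 k hkh i j
    have hne' : (h : ℂ) ≠ 0 := Complex.ofReal_ne_zero.2 hne
    have e : ((h : ℂ)⁻¹ • (E y h k - E y h 0)) i j - (k • matJ) i j
        = (h : ℂ)⁻¹ * (E y h k - E y h 0 - ((h : ℂ) * k) • matJ) i j := by
      simp only [Matrix.sub_apply, Matrix.smul_apply, smul_eq_mul]
      field_simp
    rw [e, norm_mul, norm_inv, Complex.norm_real, Real.norm_eq_abs]
    calc |h|⁻¹ * _ ≤ |h|⁻¹ * (2 * C * |h| * √|h| * ‖k‖) := by gcongr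
      _ = 2 * C * √|h| * ‖k‖ := by field_simp
  have hQ : Tendsto (fun h => (P (y + h)).adjugate) (𝓝[≠] 0) (𝓝 (P y).adjugate) := by
    have hc : Continuous fun h => (P (y + h)).adjugate :=
      (hPc.comp (continuous_const.add continuous_id)).matrix_adjugate
    simpa using (hc.tendsto 0).mono_left nhdsWithin_le_nhds
  have hY : Tendsto (fun h : ℝ => expL (-h) k) (𝓝[≠] 0) (𝓝 1) := by
    have hc : Continuous fun h : ℝ => expL (-h) k := by
      unfold expL
      exact Continuous.matrix_diagonal (by fun_prop)
    have h0 : expL 0 k = 1 := by simp [expL]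
    simpa [h0] using (hc.tendsto 0).mono_left nhdsWithin_le_nhds
  have hlim := (((tendsto_slope_expL k).const_mul ((P y).adjugate * F y k))).add
    (((hQ.mul hR).mul_const (F y k)).mul hY)
  rw [hasDerivAt_iff_tendsto_slope_zero]
  have e0 : (P y).adjugate * F y k * -(k • matJ) + (P y).adjugate * k • matJ * F y k * 1
      = (P y).adjugate * (k • (matJ * F y k - F y k * matJ)) := by
    simp only [Matrix.mul_smul, Matrix.smul_mul, mul_neg, smul_sub, mul_sub, mul_one, mul_assoc]
    abel
  rw [e0] at hlim
  refine (tendsto_matrix_iff.1 hlim i j).congr' ?_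
  filter_upwards [self_mem_nhdsWithin] with h hne
  have hne' : (h : ℂ) ≠ 0 := Complex.ofReal_ne_zero.2 hne
  have hXY : expL h k * expL (-h) k = 1 := by
    rw [expL, expL, Matrix.diagonal_mul_diagonal, ← Matrix.diagonal_one]
    congr 1
    ext a
    rw [← Complex.exp_add]
    push_cast
    simp
  have hm' : F (y + h) k = E y h k * F y k * expL (-h) k := by
    rw [hEF y h k hk, mul_assoc _ _ (F y k), Matrix.adjugate_mul, hdet y k hk, one_smul, mul_one,
      mul_assoc, hXY, mul_one]
  have hPP : (P (y + h)).adjugate * E y h 0 = (P y).adjugate := by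
    rw [hE0, ← mul_assoc, Matrix.adjugate_mul, hPdet, one_smul, one_mul]
  have e : (P (y + h)).adjugate * F (y + h) k - (P y).adjugate * F y k
      = (P y).adjugate * F y k * (expL (-h) k - 1)
        + (P (y + h)).adjugate * (E y h k - E y h 0) * F y k * expL (-h) k := by
    rw [hm', mul_sub (P (y + h)).adjugate, hPP]
    noncomm_ring
  have e' : (P y).adjugate * F y k * ((h : ℂ)⁻¹ • (expL (-h) k - 1))
        + (P (y + h)).adjugate * ((h : ℂ)⁻¹ • (E y h k - E y h 0)) * F y k * expL (-h) k
      = (h : ℂ)⁻¹ • ((P (y + h)).adjugate * F (y + h) k - (P y).adjugate * F y k) := by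
    rw [e, smul_add, Matrix.mul_smul, Matrix.mul_smul, Matrix.smul_mul, Matrix.smul_mul]
  rw [e', Matrix.smul_apply, Matrix.sub_apply, Complex.real_smul, smul_eq_mul,
    Complex.ofReal_inv]

/-- The inverse of the value at `0` satisfies `(P⁻¹)' = P⁻¹ [J, F₁]`: the limit `k → ∞` of the Lax
equation in the gauge normalized at `0`. -/
theorem hasDerivAt_zero_limit_inv (hF : HasExpansionAtInfinity F F₁)
    (hdet : ∀ x, ∀ k ∉ Sigma, (F x k).det = 1) (hPdet : ∀ x, (P x).det = 1)
    (hd : ∀ y i j, DifferentiableAt ℝ (fun x => F₁ x i j) y)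
    (hE : ∀ y h i j, Differentiable ℂ fun k => E y h k i j)
    (hEF : ∀ y h, ∀ k ∉ Sigma, E y h k = F (y + h) k * expL h k * (F y k).adjugate)
    (hE0 : ∀ y h, E y h 0 = P (y + h) * (P y).adjugate) (y : ℝ) (i j : Fin 3) :
    HasDerivAt (fun x => (P x).adjugate i j)
      (((P y).adjugate * (matJ * F₁ y - F₁ y * matJ)) i j) y := by
  have hPc := continuous_zero_limit hF hdet hPdet hd hE hEF hE0
  have hB : ∃ B : ℝ, 0 ≤ B ∧ ∀ x ∈ Icc (y - 1) (y + 1), EntriesLE (P x).adjugate B := by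
    have h1 : ∀ i j, ∃ B, ∀ x ∈ Icc (y - 1) (y + 1), ‖(P x).adjugate i j‖ ≤ B := fun i j =>
      isCompact_Icc.exists_bound_of_continuousOn
        ((hPc.matrix_adjugate).matrix_elem i j).continuousOn
    choose B hB using h1
    refine ⟨∑ i, ∑ j, |B i j|, by positivity, fun x hx i j => (hB i j x hx).trans ?_⟩
    refine (le_abs_self _).trans ?_
    refine (Finset.single_le_sum (f := fun j => |B i j|) (fun _ _ => abs_nonneg _)
      (Finset.mem_univ j)).trans ?_
    exact Finset.single_le_sum (f := fun i => ∑ j, |B i j|)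
      (fun _ _ => Finset.sum_nonneg fun _ _ => abs_nonneg _) (Finset.mem_univ i)
  obtain ⟨B, hB0, hB⟩ := hB
  obtain ⟨C, R, hCR⟩ := hF (|y| + 1)
  refine hasDerivAt_of_tendstoUniformlyOn (𝕜 := ℝ) (l := atInf) (s := Ioo (y - 1) (y + 1))
    (f := fun k x => ((P x).adjugate * F x k) i j)
    (f' := fun k x => ((P x).adjugate * (k • (matJ * F x k - F x k * matJ))) i j)
    (g' := fun x => ((P x).adjugate * (matJ * F₁ x - F₁ x * matJ)) i j) isOpen_Ioo
    ?_ ?_ ?_ ⟨by linarith, by linarith⟩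
  · rw [Metric.tendstoUniformlyOn_iff]
    intro ε hε
    have hlim : Tendsto (fun k : ℂ => 18 * B * C * ‖k‖⁻¹) atInf (𝓝 0) := by
      simpa using tendsto_inv_norm_atInf.const_mul (18 * B * C)
    have hbig : ∀ᶠ k in atInf, k ∉ Sigma ∧ R ≤ ‖k‖ := eventually_atInf fun k hk hR => ⟨hk, hR⟩
    filter_upwards [hlim.eventually_lt_const hε, hbig] with k hk hkR x hx
    refine lt_of_le_of_lt ?_ hk
    have hkn : 0 < ‖k‖ := norm_pos_iff.2 (ne_zero_of_notMem_Sigma hkR.1)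
    have hxy : |x| ≤ |y| + 1 := by
      have h1 : |x - y| ≤ 1 := abs_le.2 ⟨by linarith [hx.1], by linarith [hx.2]⟩
      have h2 := abs_add_le (x - y) y
      rw [sub_add_cancel] at h2
      linarith
    set Δ := k • (F x k - 1 - k⁻¹ • F₁ x) with hΔ
    have hΔb : EntriesLE Δ (C * ‖k‖⁻¹) := fun a b => by
      have h1 := hCR x hxy k hkR.1 hkR.2 a b
      rw [hΔ, Matrix.smul_apply, smul_eq_mul, norm_mul]
      calc ‖k‖ * _ ≤ ‖k‖ * (C / ‖k‖ ^ 2) := by gcongr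
        _ = C * ‖k‖⁻¹ := by field_simp
    have hk0 := ne_zero_of_notMem_Sigma hkR.1
    have e : (P x).adjugate * (k • (matJ * F x k - F x k * matJ))
        - (P x).adjugate * (matJ * F₁ x - F₁ x * matJ)
        = (P x).adjugate * (matJ * Δ - Δ * matJ) := by
      rw [← mul_sub]
      congr 1
      have hΔ' : Δ = k • F x k - k • (1 : Mat3) - F₁ x := by
        rw [hΔ, smul_sub, smul_sub, smul_smul, mul_inv_cancel₀ hk0, one_smul]
      rw [hΔ', smul_sub, mul_sub, mul_sub, sub_mul, sub_mul, Matrix.mul_smul, Matrix.mul_smul,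
        Matrix.smul_mul, Matrix.smul_mul, mul_one, one_mul]
      abel
    have h1 := (hB x (Ioo_subset_Icc_self hx)).mul
      ((entriesLE_matJ.mul hΔb).sub (hΔb.mul entriesLE_matJ))
    have h2 := h1 i j
    rw [dist_comm, dist_eq_norm, ← Matrix.sub_apply, e]
    refine h2.trans (le_of_eq ?_)
    ring
  · filter_upwards [mem_inf_of_right (mem_principal_self _)] with k hk x _
    exact hasDerivAt_gauge hF hdet hPdet hd hE hEF hE0 x hk i j
  · intro x _
    have := tendsto_matrix_iff.1 ((hF.tendsto_one x).const_mul (P x).adjugate) i j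
    rwa [mul_one] at this

end gauge

/-! ### The row at zero stays bounded -/

section msk

variable {r₁ r₂ : ℝ → ℂ} {w : ℝ → ℝ → ℝ} {m : ℝ → ℝ → ℂ → Mat3}

theorem SolvesRHmSK.differentiable_mskCoeff (hm : SolvesRHmSK r₁ r₂ w m) {t : ℝ} (ht : 0 ≤ t)
    (hw : ContDiff ℝ (⊤ : ℕ∞) fun x => w x t) (i j : Fin 3) :
    Differentiable ℝ fun x => mskCoeff w t x i j := by
  have h1 : Differentiable ℝ fun x => (w x t : ℂ) := fun x =>
    ((hw.differentiable (by simp)) x).hasDerivAt.ofReal_comp.differentiableAt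
  have h2 : Differentiable ℝ fun x => ((-∫ y in Ioi x, w y t ^ 2 : ℝ) : ℂ) := fun x =>
    (hasDerivAt_integral_Ioi (f := fun y => w y t ^ 2) (hw.continuous.pow 2)
      (fun x => hm.integrable x t ht) x).neg.ofReal_comp.differentiableAt
  unfold mskCoeff
  simp only [Matrix.add_apply, Matrix.smul_apply, smul_eq_mul]
  exact ((h1.div_const 3).mul_const _).add ((h2.div_const 3).mul_const _)

theorem SolvesRHmSK.hasDerivAt_zeroValue_inv (hm : SolvesRHmSK r₁ r₂ w m) {t : ℝ} (ht : 0 ≤ t)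
    (hw : ContDiff ℝ (⊤ : ℕ∞) fun x => w x t) (y : ℝ) (i j : Fin 3) :
    HasDerivAt (fun x => (zeroValue (m x t)).adjugate i j)
      (((zeroValue (m y t)).adjugate * (matJ * mskCoeff w t y - mskCoeff w t y * matJ)) i j) y := by
  have hlim : ∀ (y h : ℝ) (n : ℤ), ∃ P Q : Mat3, Tendsto (m (y + h) t) (𝓝[sector n] 0) (𝓝 P) ∧
      Tendsto (m y t) (𝓝[sector n] 0) (𝓝 Q) := fun y h n => by
    obtain ⟨P, hP⟩ := hm.exists_tendsto_zero (y + h) ht n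
    obtain ⟨Q, hQ⟩ := hm.exists_tendsto_zero y ht n
    exact ⟨P, Q, hP, hQ⟩
  have hexp : ∀ (h : ℝ) (s : Set ℂ), Tendsto (expL h) (𝓝[s] 0) (𝓝 1) := fun h s => by
    have hc : Continuous (expL h) :=
      continuous_matrix fun i j => (differentiable_expL h i j).continuous
    have h0 : expL h 0 = 1 := by
      rw [expL, ← Matrix.diagonal_one]
      congr 1
      ext i
      simp [l_apply]
    simpa [h0] using (hc.tendsto 0).mono_left (nhdsWithin_le_nhds (s := s))
  have hex : ∀ y h : ℝ, ∃ E : ℂ → Mat3, (∀ i j, Differentiable ℂ fun k => E k i j) ∧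
      ∀ k ∉ Sigma, E k = m (y + h) t k * expL h k * (m y t k).adjugate := fun y h =>
    exists_entire_quotient (hm.analytic _ t ht) (hm.analytic _ t ht) (differentiable_expL h)
      (hm.jumps _ t ht) (hm.jumps _ t ht) (fun _ _ => det_jump ..)
      (fun n k => by
        have := expL_mul_jump r₁ r₂ n (y + h) y t k
        rwa [add_sub_cancel_left] at this)
      (fun n => by
        obtain ⟨P, Q, hP, hQ⟩ := hlim y h n
        exact ⟨_, (hP.mul (hexp h _)).mul (Tendsto.adjugate hQ)⟩)
  choose E hE hEF using hex
  refine hasDerivAt_zero_limit_inv (F := fun x => m x t) (P := fun x => zeroValue (m x t))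
    (hm.infinity' ht) (fun x k hk => hm.det_eq_one x ht hk) (fun x => hm.det_zeroValue x ht)
    (fun y i j => hm.differentiable_mskCoeff ht hw i j y) hE hEF ?_ y i j
  intro y h
  have hEc : Continuous (E y h) := continuous_matrix fun i j => (hE y h i j).continuous
  have := neBot_nhdsWithin_sector_zero 1
  have h1 := (hEc.tendsto 0).mono_left (nhdsWithin_le_nhds (s := sector 1))
  have h2 := ((hm.tendsto_zeroValue (y + h) ht).mul (hexp h _)).mul
    (Tendsto.adjugate (hm.tendsto_zeroValue y ht))
  rw [mul_one] at h2
  refine tendsto_nhds_unique h1 (h2.congr' ?_)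
  filter_upwards [self_mem_nhdsWithin] with k hk
  exact (hEF y h k (sector_subset_compl_Sigma 1 hk)).symm

/-- The real factor `α` of `exists_real_row` satisfies `α' = -w α` and is therefore bounded as
`x → +∞`. In terms of `β = 1/(ω² α)`, an entry of `P⁻¹`, the equation is `β' = w β`, because
`(ω², ω, 1)` is a left eigenvector of `[J, m_∞⁽¹⁾]` with eigenvalue `w`. -/
theorem SolvesRHmSK.real_row_isBigO_one (hm : SolvesRHmSK r₁ r₂ w m) {t : ℝ} (ht : 0 ≤ t)
    (hw : ContDiff ℝ (⊤ : ℕ∞) fun x => w x t) (hdec : RapidlyDecreasing fun x => w x t)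
    {α : ℝ → ℝ} (hα : ∀ x j, ω ^ 2 * zeroValue (m x t) 0 j
      + ω * zeroValue (m x t) 1 j + zeroValue (m x t) 2 j = ![ω ^ 2 * (α x : ℂ), 0, 0] j) :
    α =O[atTop] fun _ => (1 : ℝ) := by
  set Q : ℝ → Mat3 := fun x => (zeroValue (m x t)).adjugate with hQ
  have hPQ : ∀ x, zeroValue (m x t) * Q x = 1 := fun x => by
    rw [hQ, Matrix.mul_adjugate, hm.det_zeroValue x ht, one_smul]
  have hrow : ∀ x j, ω ^ 2 * α x * Q x 0 j = ![ω ^ 2, ω, 1] j := fun x j => by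
    have h1 : ∀ i, (zeroValue (m x t) * Q x) i j = (1 : Mat3) i j := fun i => by rw [hPQ]
    have h10 := h1 0
    have h11 := h1 1
    have h12 := h1 2
    simp only [Matrix.mul_apply, Fin.sum_univ_three] at h10 h11 h12
    have a0 := hα x 0
    have a1 := hα x 1
    have a2 := hα x 2
    simp only [Matrix.cons_val_zero, Matrix.cons_val_one, Matrix.cons_val] at a0 a1 a2
    have e : ![ω ^ 2, ω, 1] j = ω ^ 2 * (1 : Mat3) 0 j + ω * (1 : Mat3) 1 j + (1 : Mat3) 2 j := by
      fin_cases j <;> simp [Matrix.one_apply]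
    rw [e, ← h10, ← h11, ← h12]
    linear_combination -(Q x 0 j) * a0 - (Q x 1 j) * a1 - (Q x 2 j) * a2
  set β : ℝ → ℂ := fun x => Q x 0 2 with hβ
  have hβ1 : ∀ x, ω ^ 2 * α x * β x = 1 := fun x => by simpa using hrow x 2
  have hQβ : ∀ x j, Q x 0 j = ![ω ^ 2, ω, 1] j * β x := fun x j => by
    rw [← hrow x j]
    linear_combination -(Q x 0 j) * hβ1 x
  have hode : ∀ x, HasDerivAt β (w x t * β x) x := fun x => by
    have h1 := hm.hasDerivAt_zeroValue_inv ht hw x 0 2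
    convert! h1 using 1
    have : (zeroValue (m x t)).adjugate = Q x := rfl
    rw [this]
    simp only [Matrix.mul_apply, Fin.sum_univ_three, hQβ]
    simp only [matJ, Matrix.sub_apply, Matrix.diagonal_mul, Matrix.mul_diagonal]
    simp [mskCoeff]
    linear_combination (-(w x t : ℂ) / 3 * β x) * (2 * omega_cube - omega_sq)
  -- integrate the equation for `β`
  set W : ℝ → ℝ := fun x => ∫ y in (0 : ℝ)..x, w y t with hW
  have hWd : ∀ x, HasDerivAt W (w x t) x := fun x =>
    intervalIntegral.integral_hasDerivAt_right (hw.continuous.intervalIntegrable _ _)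
      hw.continuous.stronglyMeasurable.stronglyMeasurableAtFilter hw.continuous.continuousAt
  have hconst : ∀ x, β x * Complex.exp (-(W x : ℂ)) = β 0 := fun x => by
    have hd : ∀ x, HasDerivAt (fun x => β x * Complex.exp (-(W x : ℂ))) 0 x := fun x => by
      have := (hode x).mul ((hWd x).ofReal_comp.neg.cexp)
      convert! this using 1
      ring
    have := is_const_of_deriv_eq_zero (𝕜 := ℝ) (fun x => (hd x).differentiableAt)
      (fun x => (hd x).deriv) x 0
    refine this.trans ?_
    simp [hW]
  have hαW : ∀ x, α x = α 0 * Real.exp (-W x) := fun x => by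
    have h1 := hβ1 x
    have h2 := hβ1 0
    have h3 := hconst x
    have hne : β x ≠ 0 := fun h => by rw [h, mul_zero] at h1; exact zero_ne_one h1
    have : (α x : ℂ) = ((α 0 * Real.exp (-W x) : ℝ) : ℂ) := by
      push_cast
      have hc : ω ^ 2 * β x * (α x - α 0 * Complex.exp (-(W x : ℂ))) = 0 := by
        linear_combination h1 - h2 - ω ^ 2 * α 0 * h3
      have := (mul_eq_zero.1 hc).resolve_left (mul_ne_zero (pow_ne_zero 2 omega_ne_zero) hne)
      exact sub_eq_zero.1 this
    exact_mod_cast this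
  have hWlim : Tendsto W atTop (𝓝 (∫ y in Ioi 0, w y t)) :=
    intervalIntegral_tendsto_integral_Ioi 0 (hdec.integrableOn hw.continuous 0) tendsto_id
  have hlim : Tendsto α atTop (𝓝 (α 0 * Real.exp (-∫ y in Ioi 0, w y t))) := by
    exact (((Real.continuous_exp.tendsto _).comp hWlim.neg).const_mul (α 0)).congr
      fun x => (hαW x).symm
  exact hlim.isBigO_one ℝ

end msk

/-! ### The transformed solution solves the Sawada-Kotera problem -/

theorem matA_inv_mul_matA : matA⁻¹ * matA = 1 := by
  rw [matA_inv]
  ext i j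
  fin_cases i <;> fin_cases j <;> simp [matA]

theorem matA_mul_matA_inv : matA * matA⁻¹ = 1 := by
  rw [matA_inv]
  ext i j
  fin_cases i <;> fin_cases j <;> simp [matA]

theorem matB_mul_matB : matB * matB = 1 := by
  ext i j
  fin_cases i <;> fin_cases j <;> simp [matB]

theorem matA_conj_miuraMatrix (w : ℝ) :
    matA * miuraMatrix w * matA⁻¹ = ω • miuraMatrix w := by
  have h3 := omega_cube
  rw [matA_inv]
  ext i j
  fin_cases i <;> fin_cases j <;>
    simp [matA, miuraMatrix] <;>
    first
    | ring1
    | linear_combination (w / 3 : ℂ) * h3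

theorem matB_conj_miuraMatrix (w : ℝ) :
    matB * (miuraMatrix w).map star * matB = miuraMatrix w := by
  have h1 : (starRingEnd ℂ) ω = ω ^ 2 := star_omega
  have h4 : ω ^ 4 = ω := by linear_combination ω * omega_cube
  have h5 : (starRingEnd ℂ) 3 = 3 := Complex.conj_ofNat 3
  have e : (miuraMatrix w).map star
      = (-(w : ℂ) / 3) • !![ω, ω ^ 2, 1; ω, ω ^ 2, 1; ω, ω ^ 2, 1] := by
    ext i j
    fin_cases i <;> fin_cases j <;> simp [miuraMatrix, h1, ← pow_mul, h4, h5]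
  rw [e]
  ext i j
  fin_cases i <;> fin_cases j <;> simp [matB, miuraMatrix]

theorem map_star_mul (A B : Mat3) : (A * B).map star = A.map star * B.map star := by
  ext i j
  simp [Matrix.mul_apply, Matrix.map_apply]

/-- Multiplication by `1 + A / k` turns an expansion at `0` into one that starts with `k⁻¹`; the
remainder of order `p` needs that of `F` at the orders `p - 1` and `p`. -/
theorem HasExpansionAtZero.miura {n : ℤ} {F : ℂ → Mat3} {c : ℕ → Mat3}
    (h : HasExpansionAtZero 0 n F c) (A : Mat3) :
    HasExpansionAtZero 1 n (fun k => (1 + k⁻¹ • A) * F k)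
      (fun j => Nat.casesOn j (A * c 0) fun i => c i + A * c (i + 1)) := by
  intro p a b
  have hk0 : ∀ᶠ k in 𝓝[sector n] (0 : ℂ), k ≠ 0 := by
    filter_upwards [self_mem_nhdsWithin] with k hk
    exact ne_zero_of_notMem_Sigma (sector_subset_compl_Sigma n hk)
  -- the remainder of order `p + 1`, divided by `k`
  have h1 : ∀ i, (fun k : ℂ => k⁻¹ * (F k - ∑ j ∈ Finset.range (p + 1),
      k ^ ((j : ℤ) - (0 : ℕ)) • c j) i b) =O[𝓝[sector n] 0] fun k : ℂ => k ^ ((p : ℤ) + 1 - (1 : ℕ)) :=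
    fun i => by
    refine ((isBigO_refl (fun k : ℂ => k⁻¹) (𝓝[sector n] 0)).mul (h p i b)).congr' EventuallyEq.rfl ?_
    filter_upwards [hk0] with k hk
    rw [← zpow_neg_one, ← zpow_add₀ hk]
    congr 1
  -- the remainder of order `p`
  have h2 : (fun k : ℂ => (F k - ∑ j ∈ Finset.range p, k ^ ((j : ℤ) - (0 : ℕ)) • c j) a b)
      =O[𝓝[sector n] 0] fun k : ℂ => k ^ ((p : ℤ) + 1 - (1 : ℕ)) := by
    have h3 := h p a b
    have h4 : (fun k : ℂ => k ^ ((p : ℤ) + 1 - (0 : ℕ)))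
        =O[𝓝[sector n] 0] fun k : ℂ => k ^ ((p : ℤ) + 1 - (1 : ℕ)) := by
      have h5 : (fun k : ℂ => k) =O[𝓝[sector n] 0] fun _ => (1 : ℂ) := by
        have : Tendsto (fun k : ℂ => k) (𝓝[sector n] 0) (𝓝 0) := nhdsWithin_le_nhds
        exact this.isBigO_one ℂ
      refine (h5.mul (isBigO_refl (fun k : ℂ => k ^ ((p : ℤ) + 1 - (1 : ℕ)))
        (𝓝[sector n] 0))).congr' ?_ ?_
      · filter_upwards [hk0] with k hk
        rw [← zpow_one_add₀ hk]
        congr 1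
        push_cast
        ring
      · exact Eventually.of_forall fun k => one_mul _
    have h6 : (fun k : ℂ => (k ^ ((p : ℤ) - (0 : ℕ)) • c p) a b)
        =O[𝓝[sector n] 0] fun k : ℂ => k ^ ((p : ℤ) + 1 - (1 : ℕ)) := by
      have : ∀ k : ℂ, (k ^ ((p : ℤ) - (0 : ℕ)) • c p) a b
          = c p a b * k ^ ((p : ℤ) + 1 - (1 : ℕ)) := fun k => by
        rw [Matrix.smul_apply, smul_eq_mul, mul_comm]
        congr 2
        push_cast
        ring
      simp only [this]
      exact (isBigO_refl _ _).const_mul_left _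
    refine ((h3.trans h4).add h6).congr_left fun k => ?_
    rw [Finset.sum_range_succ]
    simp only [Matrix.sub_apply, Matrix.add_apply]
    ring
  have h3 := h2.add (IsBigO.sum (s := Finset.univ) fun i _ => (h1 i).const_mul_left (A a i))
  refine h3.congr' ?_ EventuallyEq.rfl
  filter_upwards [hk0] with k hk
  have e : (1 + k⁻¹ • A) * F k - ∑ j ∈ Finset.range (p + 1), k ^ ((j : ℤ) - (1 : ℕ)) •
        (Nat.casesOn j (A * c 0) fun i => c i + A * c (i + 1) : Mat3)
      = (F k - ∑ j ∈ Finset.range p, k ^ ((j : ℤ) - (0 : ℕ)) • c j)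
        + A * (k⁻¹ • (F k - ∑ j ∈ Finset.range (p + 1), k ^ ((j : ℤ) - (0 : ℕ)) • c j)) := by
    have s1 : ∑ j ∈ Finset.range (p + 1), k ^ ((j : ℤ) - (1 : ℕ)) •
        (Nat.casesOn j (A * c 0) fun i => c i + A * c (i + 1) : Mat3)
        = ∑ j ∈ Finset.range p, k ^ ((j : ℤ) - (0 : ℕ)) • c j
          + A * (k⁻¹ • ∑ j ∈ Finset.range (p + 1), k ^ ((j : ℤ) - (0 : ℕ)) • c j) := by
      have s2 : A * (k⁻¹ • ∑ j ∈ Finset.range (p + 1), k ^ ((j : ℤ) - (0 : ℕ)) • c j)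
          = ∑ j ∈ Finset.range p, A * (k⁻¹ • k ^ (((j + 1 : ℕ) : ℤ) - (0 : ℕ)) • c (j + 1))
            + A * (k⁻¹ • k ^ (((0 : ℕ) : ℤ) - (0 : ℕ)) • c 0) := by
        rw [Finset.sum_range_succ', smul_add, mul_add, Finset.smul_sum, Finset.mul_sum]
      rw [s2, Finset.sum_range_succ', ← add_assoc, ← Finset.sum_add_distrib]
      congr 1
      · refine Finset.sum_congr rfl fun j _ => ?_
        rw [smul_add, Matrix.mul_smul, Matrix.mul_smul, smul_smul]
        congr 2
        · congr 1; push_cast; ring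
        · rw [← zpow_neg_one, ← zpow_add₀ hk]; congr 1
      · rw [Matrix.mul_smul, Matrix.mul_smul, smul_smul]
        simp
    rw [s1, smul_sub, mul_sub, add_mul, one_mul, Matrix.smul_mul, Matrix.mul_smul A k⁻¹ (F k)]
    abel
  rw [e]
  simp only [Finset.sum_apply, Matrix.add_apply, Matrix.mul_apply, Matrix.smul_apply, smul_eq_mul]

section msk

variable {r₁ r₂ : ℝ → ℂ} {w : ℝ → ℝ → ℝ} {m : ℝ → ℝ → ℂ → Mat3}

/-- The diagonal coefficient of the transformed solution is the integral of its potential. -/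
theorem integral_two_mul_miura {t : ℝ} (hw : ContDiff ℝ (⊤ : ℕ∞) fun x => w x t)
    (hdec : RapidlyDecreasing fun x => w x t) (hdec' : RapidlyDecreasing fun x => Dx 1 w x t)
    (hi : ∀ x, IntegrableOn (fun y => w y t ^ 2) (Ioi x)) (x : ℝ) :
    ∫ y in Ioi x, 2 * ((1 / 6) * (Dx 1 w y t - w y t ^ 2))
      = -(w x t) / 3 - (∫ y in Ioi x, w y t ^ 2) / 3 := by
  have hd : ∀ x, HasDerivAt (fun y => w y t) (Dx 1 w x t) x := fun x => by
    have := hasDerivAt_Dx hw 0 x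
    simpa only [Dx_zero] using this
  have hc : Continuous fun y => Dx 1 w y t :=
    continuous_iff_continuousAt.2 fun x => (hasDerivAt_Dx hw 1 x).continuousAt
  have hi' := hdec'.integrableOn hc x
  have h1 := integral_Ioi_of_hasDerivAt_of_tendsto' (fun y _ => hd y) hi' hdec.tendsto_zero
  have e : (fun y => 2 * ((1 / 6) * (Dx 1 w y t - w y t ^ 2)))
      = fun y => (1 / 3) * (Dx 1 w y t - w y t ^ 2) := by
    ext y; ring
  rw [e, integral_const_mul, integral_sub hi' (hi x), h1]
  ring

/-- The off-diagonal parts cancel, so that the coefficient of `k⁻¹` of the transformed solution is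
diagonal. -/
theorem miuraMatrix_add_mskCoeff (t x : ℝ) :
    miuraMatrix (w x t) + mskCoeff w t x
      = ((-(w x t) / 3 - (∫ y in Ioi x, w y t ^ 2) / 3 : ℝ) : ℂ) •
        !![ω ^ 2, 0, 0; 0, ω, 0; 0, 0, 1] := by
  ext i j
  fin_cases i <;> fin_cases j <;> simp [miuraMatrix, mskCoeff] <;> ring

theorem exists_entriesLE_of_continuous {G : ℝ → Mat3} (hG : ∀ i j, Continuous fun x => G x i j)
    (X : ℝ) : ∃ K : ℝ, 0 ≤ K ∧ ∀ x : ℝ, |x| ≤ X → EntriesLE (G x) K := by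
  have h1 : ∀ i j, ∃ B, ∀ x ∈ Icc (-X) X, ‖G x i j‖ ≤ B := fun i j =>
    isCompact_Icc.exists_bound_of_continuousOn (hG i j).continuousOn
  choose B hB using h1
  refine ⟨∑ i, ∑ j, |B i j|, by positivity, fun x hx i j => (hB i j x (abs_le.1 hx)).trans ?_⟩
  refine (le_abs_self _).trans ?_
  refine (Finset.single_le_sum (f := fun j => |B i j|) (fun _ _ => abs_nonneg _)
    (Finset.mem_univ j)).trans ?_
  exact Finset.single_le_sum (f := fun i => ∑ j, |B i j|)
    (fun _ _ => Finset.sum_nonneg fun _ _ => abs_nonneg _) (Finset.mem_univ i)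

theorem HasExpansionAtInfinity.miura {F : ℝ → ℂ → Mat3} {F₁ : ℝ → Mat3}
    (h : HasExpansionAtInfinity F F₁) (hF₁ : ∀ i j, Continuous fun x => F₁ x i j)
    {A : ℝ → Mat3} (hA : ∀ i j, Continuous fun x => A x i j) :
    HasExpansionAtInfinity (fun x k => (1 + k⁻¹ • A x) * F x k) fun x => A x + F₁ x := by
  intro X
  obtain ⟨C, R, hCR⟩ := h X
  obtain ⟨K, hK0, hK⟩ := exists_entriesLE_of_continuous hF₁ X
  obtain ⟨L, hL0, hL⟩ := exists_entriesLE_of_continuous hA X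
  refine ⟨C + 3 * (L * (C + K)), max R 1, fun x hx k hk hkR => ?_⟩
  have hk1 : 1 ≤ ‖k‖ := (le_max_right _ _).trans hkR
  have hk0 : 0 < ‖k‖ := by linarith
  have b1 : EntriesLE (F x k - 1 - k⁻¹ • F₁ x) (C / ‖k‖ ^ 2) :=
    hCR x hx k hk ((le_max_left _ _).trans hkR)
  have hC : 0 ≤ C / ‖k‖ ^ 2 := b1.nonneg
  have hCnn : 0 ≤ C := by
    have := mul_nonneg hC (sq_nonneg ‖k‖)
    rwa [div_mul_cancel₀ _ (by positivity)] at this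
  have b2 : EntriesLE (F x k - 1) ((C + K) * ‖k‖⁻¹) := by
    have := b1.add ((hK x hx).smul k⁻¹)
    rw [sub_add_cancel, norm_inv] at this
    refine this.mono ?_
    have h1 : C / ‖k‖ ^ 2 ≤ C * ‖k‖⁻¹ := by
      rw [← div_eq_mul_inv]
      exact div_le_div_of_nonneg_left hCnn hk0 (by nlinarith)
    linarith
  have b3 := b1.add (((hL x hx).smul k⁻¹).mul b2)
  have e : (1 + k⁻¹ • A x) * F x k - 1 - k⁻¹ • (A x + F₁ x)
      = F x k - 1 - k⁻¹ • F₁ x + k⁻¹ • A x * (F x k - 1) := by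
    rw [add_mul, one_mul, smul_add, mul_sub, mul_one]
    abel
  intro i j
  refine (show EntriesLE _ _ from e ▸ b3.mono (le_of_eq ?_)) i j
  rw [norm_inv]
  field_simp

/-- The residue at `0` of the transformed solution in `Ω₁`, where `P` is the value of `m` there. -/
theorem miuraMatrix_mul_of_row {P : Mat3} {α : ℝ} (a : ℝ)
    (hP : ∀ j, ω ^ 2 * P 0 j + ω * P 1 j + P 2 j = ![ω ^ 2 * (α : ℂ), 0, 0] j) :
    miuraMatrix a * P = ((-a * α / 3 : ℝ) : ℂ) • !![ω ^ 2, 0, 0; ω ^ 2, 0, 0; ω ^ 2, 0, 0] := by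
  have h0 := hP 0
  have h1 := hP 1
  have h2 := hP 2
  simp only [Matrix.cons_val_zero, Matrix.cons_val_one, Matrix.cons_val] at h0 h1 h2
  ext i j
  rw [Matrix.mul_apply, Fin.sum_univ_three]
  fin_cases i <;> fin_cases j <;> simp [miuraMatrix] <;>
    first
    | linear_combination (-a / 3 : ℂ) * h0
    | linear_combination (-a / 3 : ℂ) * h1
    | linear_combination (-a / 3 : ℂ) * h2

theorem AnalyticOff.miura {F : ℂ → Mat3} (hF : AnalyticOff F) (A : Mat3) :
    AnalyticOff fun k => (1 + k⁻¹ • A) * F k := by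
  refine AnalyticOff.mul (fun i j => ?_) hF
  simp only [Matrix.add_apply, Matrix.smul_apply, smul_eq_mul]
  refine (differentiableOn_const _).add (DifferentiableOn.mul_const ?_ _)
  exact differentiableOn_inv.mono fun k hk => ne_zero_of_notMem_Sigma hk

theorem HasJumps.miura {v : ℤ → ℂ → Mat3} {F : ℂ → Mat3} (hF : HasJumps v F) (A : Mat3) :
    HasJumps v fun k => (1 + k⁻¹ • A) * F k := by
  intro n hn
  obtain ⟨Fp, Fm, cp, cm, h⟩ := hF n hn
  have h0 : ∀ k ∈ ray n, k ≠ 0 := by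
    rintro k ⟨s, hs, rfl⟩
    exact mul_ne_zero (by exact_mod_cast hs.ne') (Complex.exp_ne_zero _)
  have hc : ∀ k ≠ 0, ContinuousAt (fun k : ℂ => 1 + k⁻¹ • A) k := fun k hk =>
    continuousAt_const.add ((continuousAt_inv₀ hk).smul continuousAt_const)
  have hc' : ContinuousOn (fun k : ℂ => 1 + k⁻¹ • A) (ray n) := fun k hk =>
    (hc k (h0 k hk)).continuousWithinAt
  refine ⟨fun k => (1 + k⁻¹ • A) * Fp k, fun k => (1 + k⁻¹ • A) * Fm k, hc'.mul cp, hc'.mul cm,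
    fun k hk => ?_⟩
  obtain ⟨h1, h2, h3⟩ := h k hk
  have ht := (hc k (h0 k hk)).tendsto
  refine ⟨(ht.mono_left nhdsWithin_le_nhds).mul h1, (ht.mono_left nhdsWithin_le_nhds).mul h2, ?_⟩
  change (1 + k⁻¹ • A) * Fp k = (1 + k⁻¹ • A) * Fm k * v n k
  rw [h3, mul_assoc]

theorem HasSymmetries.miura {F : ℂ → Mat3} (hF : HasSymmetries F) (a : ℝ) :
    HasSymmetries fun k => (1 + k⁻¹ • miuraMatrix a) * F k := by
  intro k hk
  obtain ⟨h1, h2⟩ := hF k hk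
  constructor
  · have e : matA * (1 + (ω * k)⁻¹ • miuraMatrix a) * matA⁻¹ = 1 + k⁻¹ • miuraMatrix a := by
      rw [mul_add, add_mul, mul_one, matA_mul_matA_inv, Matrix.mul_smul, Matrix.smul_mul,
        matA_conj_miuraMatrix, smul_smul, mul_inv, mul_comm ω⁻¹, mul_assoc,
        inv_mul_cancel₀ omega_ne_zero, mul_one]
    calc (1 + k⁻¹ • miuraMatrix a) * F k
        = matA * (1 + (ω * k)⁻¹ • miuraMatrix a) * matA⁻¹ * (matA * F (ω * k) * matA⁻¹) := by
          rw [e, ← h1]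
      _ = matA * (1 + (ω * k)⁻¹ • miuraMatrix a) * (matA⁻¹ * matA) * F (ω * k) * matA⁻¹ := by
          simp only [mul_assoc]
      _ = _ := by rw [matA_inv_mul_matA, mul_one, mul_assoc matA]
  · have e : matB * ((1 + (star k)⁻¹ • miuraMatrix a).map star) * matB
        = 1 + k⁻¹ • miuraMatrix a := by
      have e1 : (1 + (star k)⁻¹ • miuraMatrix a).map star
          = 1 + k⁻¹ • (miuraMatrix a).map star := by
        ext i j
        simp only [Matrix.map_apply, Matrix.add_apply, Matrix.smul_apply, smul_eq_mul, star_add,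
          star_mul', star_inv₀, star_star, Matrix.one_apply]
        split_ifs <;> simp
      rw [e1, mul_add, add_mul, mul_one, matB_mul_matB, Matrix.mul_smul, Matrix.smul_mul,
        matB_conj_miuraMatrix]
    calc (1 + k⁻¹ • miuraMatrix a) * F k
        = matB * ((1 + (star k)⁻¹ • miuraMatrix a).map star) * matB
          * (matB * (F (star k)).map star * matB) := by rw [e, ← h2]
      _ = matB * ((1 + (star k)⁻¹ • miuraMatrix a).map star) * (matB * matB)
          * (F (star k)).map star * matB := by simp only [mul_assoc]
      _ = _ := by rw [matB_mul_matB, mul_one, map_star_mul, mul_assoc matB]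

/-- The transformed solution solves the Sawada-Kotera problem, with the Miura transform of `w` as
potential. The coefficient `a₊` is `-w α / 3`; it inherits rapid decrease from `w` because `α` is
bounded as `x → +∞`. -/
theorem SolvesRHmSK.solvesRHSK (hr : IsReflectionPair r₁ r₂) (hm : SolvesRHmSK r₁ r₂ w m)
    (hw : ∀ t : ℝ, 0 ≤ t → ContDiff ℝ (⊤ : ℕ∞) (fun x => w x t) ∧
      ∀ j : ℕ, RapidlyDecreasing fun x => Dx j w x t) :
    SolvesRHSK r₁ r₂ (fun x t => (1 / 6) * (Dx 1 w x t - w x t ^ 2)) (miuraTransform w m) := by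
  have hdec : ∀ t : ℝ, 0 ≤ t → RapidlyDecreasing fun x => w x t := fun t ht => by
    have := (hw t ht).2 0
    simpa only [Dx_zero] using this
  have hc1 : ∀ t : ℝ, 0 ≤ t → Continuous fun x => Dx 1 w x t := fun t ht =>
    continuous_iff_continuousAt.2 fun x => (hasDerivAt_Dx (hw t ht).1 1 x).continuousAt
  refine
    { analytic := fun x t ht => (hm.analytic x t ht).miura _
      jumps := fun x t ht => (hm.jumps x t ht).miura _
      symmetries := fun x t ht => (hm.symmetries x t ht).miura _
      continuous := fun t ht =>
        continuous_const.mul ((hc1 t ht).sub ((hw t ht).1.continuous.pow 2))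
      integrable := fun x t ht =>
        ((((hw t ht).2 1).integrableOn (hc1 t ht) x).sub (hm.integrable x t ht)).const_mul _
      infinity := fun t ht => ?_
      zero := ?_ }
  · have hA : ∀ i j, Continuous fun x => miuraMatrix (w x t) i j := fun i j => by
      have := (hw t ht).1.continuous
      unfold miuraMatrix
      simp only [Matrix.smul_apply, smul_eq_mul]
      fun_prop
    have h1 := (hm.infinity' ht).miura
      (fun i j => (hm.differentiable_mskCoeff ht (hw t ht).1 i j).continuous) hA
    have e : (fun x => miuraMatrix (w x t) + mskCoeff w t x) = fun x =>
        ((∫ y in Ioi x, 2 * ((1 / 6) * (Dx 1 w y t - w y t ^ 2)) : ℝ) : ℂ) •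
          !![ω ^ 2, 0, 0; 0, ω, 0; 0, 0, 1] := by
      ext1 x
      rw [miuraMatrix_add_mskCoeff, integral_two_mul_miura (hw t ht).1 (hdec t ht) ((hw t ht).2 1)
        (fun x => hm.integrable x t ht)]
    rw [e] at h1
    exact h1
  · choose α hα using fun (t : ℝ) (ht : 0 ≤ t) (x : ℝ) => hm.exists_real_row hr x ht
    classical
    refine ⟨fun x t => if ht : 0 ≤ t then -(w x t) * α t ht x / 3 else 0, fun t ht => ?_,
      fun x t ht n => ?_⟩
    · intro N
      have h1 := hm.real_row_isBigO_one ht (hw t ht).1 (hdec t ht) (hα t ht)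
      have h2 := ((hdec t ht N).mul h1).const_mul_left (-(1 / 3))
      simp only [mul_one] at h2
      refine h2.congr_left fun x => ?_
      simp only [dif_pos ht]
      ring
    · obtain ⟨c, hc⟩ := hm.zero x t ht n
      refine ⟨_, hc.miura (miuraMatrix (w x t)), ?_⟩
      rintro rfl
      have hc0 : c 0 = zeroValue (m x t) := by
        have := neBot_nhdsWithin_sector_zero 1
        exact tendsto_nhds_unique (by simpa using hc.tendsto) (hm.tendsto_zeroValue x ht)
      change miuraMatrix (w x t) * c 0 = _
      rw [hc0, miuraMatrix_mul_of_row (w x t) (hα t ht x)]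
      simp only [dif_pos ht]

end msk

end Miura

theorem theorem2p6 (r₁ r₂ : ℝ → ℂ) (hr : Miura.IsReflectionPair r₁ r₂)
    (w : ℝ → ℝ → ℝ)
    (hw : ∀ t : ℝ, 0 ≤ t → ContDiff ℝ (⊤ : ℕ∞) (fun x => w x t) ∧
      ∀ j : ℕ, Miura.RapidlyDecreasing fun x => Miura.Dx j w x t)
    (m : ℝ → ℝ → ℂ → Miura.Mat3) (hm : Miura.SolvesRHmSK r₁ r₂ w m) :
    (∃ u : ℝ → ℝ → ℝ, Miura.SolvesRHSK r₁ r₂ u (Miura.miuraTransform w m)) ∧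
    ∀ (u : ℝ → ℝ → ℝ) (M : ℝ → ℝ → ℂ → Miura.Mat3), Miura.SolvesRHSK r₁ r₂ u M →
      (∀ x t : ℝ, 0 ≤ t → ∀ k ∉ Miura.Sigma, M x t k = Miura.miuraTransform w m x t k) ∧
      Miura.IsRecoveredFrom M u ∧
      (∀ x t : ℝ, 0 ≤ t → u x t = (1 / 6) * (Miura.Dx 1 w x t - w x t ^ 2)) ∧
      (Miura.SolvesmSK w → Miura.SolvesSK u) := by
  refine ⟨⟨_, hm.solvesRHSK hr hw⟩, fun u M hM => ?_⟩
  have hu : ∀ x t : ℝ, 0 ≤ t → u x t = (1 / 6) * (Miura.Dx 1 w x t - w x t ^ 2) :=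
    fun x t ht => hM.eq_miura hm ht (hw t ht).1 x
  exact ⟨fun x t ht => (hM.eq_and_integral_eq hm x ht).1, hM.isRecoveredFrom, hu,
    fun h => h.solvesSK hu⟩
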